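/- Write $\lg$ for the logarithm to base two. For a string $\mathbf{x}=x_1\dots x_n\in\Sigma^n$ over a finite ordered alphabet $\Sigma$ of size $\sigma\le n$ and $a_l,a_r\in\Sigma$ let $I_{[a_l;a_r]}=\{i \mid a_l\le x_i\le a_r\}$ and $z=|I_{[a_l;a_r]}|$. Let $H_0=\sum_{a}\frac{n_a}{n}\lg\frac{n}{n_a}$ be the $0$th order entropy of $\mathbf{x}$, where $n_a$ is the number of occurrences of $a$ in $\mathbf{x}$. In the I/O model the internal memory has $M$ bits, a disk block has $B\ge\lg n$ bits, the cost of a computation is the number of blocks read and written, and internal computation is free; let $b=\max(2,B/\lg n)$. Let $\delta>0$. There are constants $C$ and $n_0$, depending only on $\delta$, such that the following holds for all $n\ge n_0$, all ordered alphabets $\Sigma$ of size $\sigma\le n$, all $B\ge\lg n$ and all $M\ge B(\sigma\lg n)^{\delta}$. There are a randomized way of storing the strings $\mathbf{x}\in\Sigma^n$ on disk and a deterministic query algorithm such that, for every $\mathbf{x}\in\Sigma^n$: (1) the stored data structure always has at most $C\,(nH_0+n+\sigma\lg^2 n)$ bits; (2) for all $a_l,a_r\in\Sigma$ and every $\varepsilon\in(0,1)$,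 given as an argument of the query and not known when $\mathbf{x}$ is stored, the query algorithm always generates, with at most $$C\left(\frac{z\,\max(1,\lg(1/\varepsilon))}{B}+\lg_b n+\lg\lg n\right)$$ I/Os, a set $\hat I\supseteq I_{[a_l;a_r]}$, and for every $i\notin I_{[a_l;a_r]}$ the probability, over the random choices made when $\mathbf{x}$ was stored, that $i\in\hat I$ is at most $\varepsilon$. The I/O bound covers generating the elements of $\hat I$, but not writing them to an output. -/

import Mathlib

namespace SecondaryIndex

/-- The logarithm to base two. -/
noncomputable def lg (t : ℝ) : ℝ := Real.logb 2 t

/-! ### Strings and alphabet range queries -/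

section Strings

variable {n : ℕ} {A : Type*} [LinearOrder A]

/-- The answer to the alphabet range query `[a_l ; a_r]` on the string `x`: the set of the
positions whose character lies in the range. -/
def rangeAnswer (x : Fin n → A) (l r : A) : Finset (Fin n) :=
  Finset.univ.filter fun i => l ≤ x i ∧ x i ≤ r

/-- The number of occurrences of the character `a` in `x`. -/
def occ (x : Fin n → A) (a : A) : ℕ :=
  (Finset.univ.filter fun i => x i = a).card

/-- The zeroth order empirical entropy of `x`, in bits per character. A character that does not
occur contributes zero. -/
noncomputable def entropyZero [Fintype A] (x : Fin n → A) : ℝ :=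
  ∑ a : A, ((occ x a : ℝ) / n) * lg ((n : ℝ) / occ x a)

end Strings

/-! ### The I/O model

Internal memory consists of `M` bits, external memory (the disk) of infinitely many blocks of `B`
bits. Internal computation is free; moving one block between the memory and the disk, in either
direction, costs one I/O. -/

/-- The contents of the internal memory. -/
abbrev Memory (M : ℕ) : Type := Fin M → Bool

/-- The contents of one disk block. -/
abbrev Block (B : ℕ) : Type := Fin B → Bool

/-- The contents of the disk. -/
abbrev Disk (B : ℕ) : Type := ℕ → Block B

/-- The disk that holds a given bit string in its first blocks, and zeros everywhere else. -/
def Disk.ofBits (B : ℕ) (bits : List Bool) : Disk B :=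
  fun k j => bits.getD (k * B + j) false

/-- What a program does after a phase of internal computation: it stops, or it moves one block
between the disk (block number `a`) and the memory cells `p, p + 1, …, p + B - 1`. -/
inductive Op (B M : ℕ) : Type
  | halt : Op B M
  | read (a p : ℕ) (h : p + B ≤ M) : Op B M
  | write (a p : ℕ) (h : p + B ≤ M) : Op B M

/-- The memory after block `blk` has been loaded into the cells `p, …, p + B - 1`. -/
def loadBlock {B M : ℕ} (p : ℕ) (mem : Memory M) (blk : Block B) : Memory M :=
  fun k => if h : p ≤ k.val ∧ k.val < p + B then blk ⟨k.val - p, by omega⟩ else mem k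

/-- The memory cells `p, …, p + B - 1` as one block. -/
def fetchBlock {B M : ℕ} (p : ℕ) (h : p + B ≤ M) (mem : Memory M) : Block B :=
  fun j => mem ⟨p + j.val, by have := j.isLt; omega⟩

/-- The outcome of one phase of internal computation: the new contents of the memory, the elements
of the result that are generated during the phase, and the operation that ends the phase. -/
structure Phase (n B M : ℕ) : Type where
  mem : Memory M
  emit : Finset (Fin n)
  op : Op B M

/-- A query algorithm, for queries of type `Q` whose results are subsets of `[n]`: how the query is
presented in internal memory at the start, and what one phase of internal computation does. All
that the algorithm knows during its run is in its `M` bits of memory. -/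
structure Algorithm (Q : Type*) (n B M : ℕ) where
  init : Q → Memory M
  phase : Memory M → Phase n B M

namespace Algorithm

variable {Q : Type*} {n B M : ℕ}

/-- Run the algorithm from a given memory and disk, allowing at most `T` I/Os: the set of all the
elements that are generated, or `none` if more than `T` I/Os are needed. Generating elements of the
result is free of charge, and so is internal computation; each `read` or `write` costs one I/O. -/
def run (P : Algorithm Q n B M) : ℕ → Memory M → Disk B → Option (Finset (Fin n))
  | T, mem, disk =>
    match (P.phase mem).op, T with
    | .halt, _ => some (P.phase mem).emit
    | .read _ _ _, 0 => none
    | .write _ _ _, 0 => none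
    | .read a p _, T + 1 =>
        (P.run T (loadBlock p (P.phase mem).mem (disk a)) disk).map ((P.phase mem).emit ∪ ·)
    | .write a p h, T + 1 =>
        (P.run T (P.phase mem).mem
          (Function.update disk a (fetchBlock p h (P.phase mem).mem))).map
            ((P.phase mem).emit ∪ ·)

/-- The result of the query `q` on the data structure `bits`, if at most `T` I/Os suffice. -/
def answer (P : Algorithm Q n B M) (T : ℕ) (bits : List Bool) (q : Q) :
    Option (Finset (Fin n)) :=
  P.run T (P.init q) (Disk.ofBits B bits)

end Algorithm

/-- An approximate range query: the two ends of the range and the false positive probability. -/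
structure ApproxQuery (A : Type*) where
  left : A
  right : A
  eps : ℝ

/-! ### The bounds -/

/-- The space bound `n H₀ + n + σ lg² n`, in bits. -/
noncomputable def spaceBound {n : ℕ} {A : Type*} [LinearOrder A] [Fintype A]
    (x : Fin n → A) : ℝ :=
  n * entropyZero x + n + Fintype.card A * lg n ^ 2

/-- The block size in words of `lg n` bits, at least two. -/
noncomputable def wordsPerBlock (n B : ℕ) : ℝ := max 2 ((B : ℝ) / lg n)

/-- The query bound `z lg(1/ε) / B + lg_b n + lg lg n`, in I/Os, where `lg(1/ε)` is read as `1` for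
`ε` above one half. -/
noncomputable def queryBound (n B z : ℕ) (ε : ℝ) : ℝ :=
  z * max 1 (lg (1 / ε)) / B + Real.logb (wordsPerBlock n B) n + lg (lg n)

end SecondaryIndex

open SecondaryIndex

/-!
The positions are sorted by their characters, so that the answer to a range query is an interval of
ranks `s, …, t - 1` whose ends are boundaries between runs of equal characters. Each position `i` is
replaced with its hash value, the product `a * i` in the field with `2 ^ L` elements, where
`2 ^ (L - 1) ≤ n < 2 ^ L` and the nonzero factor `a` is the only random choice (`exists_hash`). The
hash functions are bijective, and two positions agree on a given set of `k < L` bits of their hash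
values with probability at most `2 ^ (-k)`. A query determines, for each rank `ρ` of the interval, a
set of bits, and generates all positions which agree on these bits with the hash value of the element
of rank `ρ` (`query_hits_iff`). No element of the answer is missed, and by the union bound the error
probability is small if each `ρ` has its share of `ε` (`sum_weight_query_le`). Since `ε` is not known
in advance, every hash value has to be stored so that an arbitrary number of its bits can be read.

Cut the interval at a multiple of the largest possible power of two. Each half is then, up to
reflection, an interval from a boundary `s` to a multiple of a power of two above its length, and it
is the disjoint union of dyadic intervals `[ceilPow j s, ceilPow (j + 1) s)` of increasing sizes. The
data structure is made for such intervals, and is stored twice, for the sorted order and its reverse.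

*Space.* Let the depth of a rank be `L - k` if `2 ^ k` is the size of the largest dyadic interval
around it that lies within one run. A run of length `l` has average depth `L - log l + O(1)`
(`sum_dep_run_le`), so the sum of the depths is at most `n H₀ + O(n)` (`sum_runs_le`), and it is
allowed to store `O(depth)` bits for each rank. There are two kinds of data.

*Nodes.* At level `d` each dyadic interval of size `2 ^ (L - d)`, a node, is sorted by hash value. A
bitmap with two bits for each element records the highest hash bits, so many that there are as many
values as elements; and for each element there is one bit that leads to its place at level `d + 1`,
and one fresh hash bit. Level `d` contributes bit `ordCompl[2] d / 2`, so that the levels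
`d, …, 2 d - 1` contribute all bits below the `d`-th, each once: with a rank stored at the levels
up to twice its depth, every accuracy `e` can be had, at the price of `e` levels of the node. The
reads are sequential within each of the `2 ^ (e + 1)` nodes below, so that a node of size `2 ^ j` is
processed in chunks with `O((e + 1) 2 ^ j / B)` I/Os if memory has room for a block for each of
them (`taskRun_node`). This is where `M ≥ B (σ lg n) ^ δ` enters: it permits all `e ≤ E₀`, where
`E₀` is proportional to `lg (σ lg n)`.

*Pieces.* The ranks next to a boundary are in many small nodes. The maximal dyadic intervals within
runs, the pieces, are coded one after the other, in several arrays: the array of accuracy `j`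
records `2 ^ j` bits beyond those that are implied by a bitmap (`path_scan`). An array is scanned with
one random access and `O(2 ^ j)` bits for each rank, and an answer that needs `e` bits takes the
arrays with `2 ^ j` up to about `e`, of which there are `O(lg lg n)`. In a piece of size `2 ^ k` the
`k` highest hash bits come for free, so that each piece, whatever its size, contributes `2 ^ (-e)` to
the error probability. Therefore the accuracy includes the logarithm of the number of all pieces,
which is `O(lg (σ lg n))`; this is within a constant factor of `E₀`, hence of the accuracy of the
nodes that the scans replace, and costs only a constant factor. Short queries use a second family of
arrays, whose pieces have at least the number `2 ^ g` of ranks whose hash values fill a block.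

The I/Os of a query therefore are `O((e + 1) z / B + lg lg n)` (`query_cost_le`) with `e` about
`lg (1 / ε)`; the term `lg_b n` is not needed. The boundaries and the addresses are in a table of
`O(σ lg n)` numbers of `O(lg n)` bits. Finally, the queries run on the machine because its control
states, together with the blocks received in one round, fit into memory (`exists_algorithm`,
`exists_query_algorithm`).
-/

namespace SecondaryIndex
/-! ### Decision trees of block reads and their simulation -/

/-- A computation that reads blocks adaptively and remembers every block it has read. -/
inductive Tree (B : ℕ) (α : Type*) : Type _
  | ret (x : α) : Tree B α
  | read (a : ℕ) (k : Block B → Tree B α) : Tree B α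

namespace Tree

variable {B : ℕ} {α β : Type*}

/-- The result of the computation on a disk. -/
def run (D : Disk B) : Tree B α → α
  | ret x => x
  | read a k => (k (D a)).run D

/-- The number of blocks that the computation reads on a disk. -/
def cost (D : Disk B) : Tree B α → ℕ
  | ret _ => 0
  | read a k => (k (D a)).cost D + 1

/-- Sequential composition. -/
def bind : Tree B α → (α → Tree B β) → Tree B β
  | ret x, f => f x
  | read a k, f => read a fun b => (k b).bind f

/-- The rest of the computation once the given blocks have been received. -/
def follow : Tree B α → List (Block B) → Tree B α
  | t, [] => t
  | ret x, _ :: _ => ret x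
  | read _ k, b :: bs => (k b).follow bs

@[simp] theorem run_ret (D : Disk B) (x : α) : (ret x).run D = x := rfl
@[simp] theorem cost_ret (D : Disk B) (x : α) : (ret x : Tree B α).cost D = 0 := rfl
@[simp] theorem run_read (D : Disk B) (a : ℕ) (k : Block B → Tree B α) :
    (read a k).run D = (k (D a)).run D := rfl
@[simp] theorem cost_read (D : Disk B) (a : ℕ) (k : Block B → Tree B α) :
    (read a k).cost D = (k (D a)).cost D + 1 := rfl

@[simp] theorem run_bind (D : Disk B) (t : Tree B α) (f : α → Tree B β) :
    (t.bind f).run D = (f (t.run D)).run D := by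
  induction t with
  | ret x => rfl
  | read a k ih => exact ih _

@[simp] theorem cost_bind (D : Disk B) (t : Tree B α) (f : α → Tree B β) :
    (t.bind f).cost D = t.cost D + (f (t.run D)).cost D := by
  induction t with
  | ret x => simp [bind]
  | read a k ih => simp only [bind, cost_read, run_read, ih]; ring

theorem follow_append (t : Tree B α) (l l' : List (Block B)) :
    t.follow (l ++ l') = (t.follow l).follow l' := by
  induction l generalizing t with
  | nil => simp [follow]
  | cons b bs ih =>
    cases t with
    | ret x => cases l' <;> simp [follow]
    | read a k => simpa [follow] using ih (k b)

end Tree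

section Machine

variable {n B M : ℕ} {Q Γ : Type*}

/-- Repeated execution of a loop body from one control state to another within a number of I/Os:
every control state that is passed to the next round is `Good`, and no round reads more than `T₀`
blocks. What is generated on the way, and a bound on the number of I/Os, including one for the
transition to the next round, stand between the two states. -/
inductive Steps (body : Γ → Tree B (Finset (Fin n) × Option Γ)) (Good : Γ → Prop) (T₀ : ℕ)
    (D : Disk B) : Γ → Finset (Fin n) → ℕ → Γ → Prop
  | refl (γ : Γ) (c : ℕ) : Steps body Good T₀ D γ ∅ c γ
  | head {γ γ' γ'' : Γ} {E F : Finset (Fin n)} {c c' : ℕ} (hcost : (body γ).cost D ≤ T₀)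
      (hrun : (body γ).run D = (E, some γ')) (hgood : Good γ')
      (h : Steps body Good T₀ D γ' F c γ'') (hle : (body γ).cost D + 1 + c ≤ c') :
      Steps body Good T₀ D γ (E ∪ F) c' γ''

theorem Steps.mono {body : Γ → Tree B (Finset (Fin n) × Option Γ)} {Good : Γ → Prop} {T₀ : ℕ}
    {D : Disk B} {γ γ' : Γ} {E : Finset (Fin n)} {c c' : ℕ}
    (h : Steps body Good T₀ D γ E c γ') (hc : c ≤ c') : Steps body Good T₀ D γ E c' γ' := by
  cases h with
  | refl => exact .refl _ _
  | head h1 h2 h3 h4 h5 => exact .head h1 h2 h3 h4 (h5.trans hc)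

theorem Steps.trans {body : Γ → Tree B (Finset (Fin n) × Option Γ)} {Good : Γ → Prop} {T₀ : ℕ}
    {D : Disk B} {γ γ' γ'' : Γ} {E F : Finset (Fin n)} {c c' : ℕ}
    (h : Steps body Good T₀ D γ E c γ') (h' : Steps body Good T₀ D γ' F c' γ'') :
    Steps body Good T₀ D γ (E ∪ F) (c + c') γ'' := by
  induction h with
  | refl => simpa using h'.mono (by omega)
  | head h1 h2 h3 _ h5 ih =>
    rw [Finset.union_assoc]
    exact .head h1 h2 h3 (ih h') (by omega)

/-- The control state together with the blocks received in the current round, as kept in memory. -/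
abbrev Pending (Γ' : Type*) (B T₀ : ℕ) : Type _ := Γ' × Σ t : Fin (T₀ + 1), (Fin t → Block B)

theorem card_pending (Γ' : Type*) [Fintype Γ'] (B T₀ G : ℕ) (hB : 0 < B)
    (hG : Fintype.card Γ' ≤ 2 ^ G) :
    Fintype.card (Pending Γ' B T₀) ≤ 2 ^ (G + (B * T₀ + 1)) := by
  have hgeom : ∀ T : ℕ, ∑ t : Fin (T + 1), (2 ^ B) ^ (t : ℕ) ≤ 2 ^ (B * T + 1) := by
    intro T
    rw [Fin.sum_univ_eq_sum_range (fun t => (2 ^ B) ^ t)]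
    induction T with
    | zero => simp
    | succ T ih =>
      rw [Finset.sum_range_succ]
      have h1 : (2 ^ B) ^ (T + 1) = 2 ^ (B * (T + 1)) := by rw [← pow_mul]
      have h2 : 2 ^ (B * T + 1) ≤ 2 ^ (B * (T + 1)) :=
        Nat.pow_le_pow_right (by norm_num) (by rw [Nat.mul_succ]; omega)
      rw [h1, pow_succ 2 (B * (T + 1))]
      omega
  rw [Fintype.card_prod, Fintype.card_sigma, pow_add]
  refine Nat.mul_le_mul hG ?_
  simpa [Block] using hgeom T₀

theorem run_of_read (P : Algorithm Q n B M) {mem mem' : Memory M} {E : Finset (Fin n)} {a p : ℕ}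
    {h : p + B ≤ M} (hp : P.phase mem = ⟨mem', E, .read a p h⟩) (T : ℕ) (D : Disk B) :
    P.run (T + 1) mem D = (P.run T (loadBlock p mem' (D a)) D).map (E ∪ ·) := by
  conv_lhs => unfold Algorithm.run
  simp [hp]

theorem run_of_halt (P : Algorithm Q n B M) {mem mem' : Memory M} {E : Finset (Fin n)}
    (hp : P.phase mem = ⟨mem', E, .halt⟩) (T : ℕ) (D : Disk B) : P.run T mem D = some E := by
  unfold Algorithm.run
  cases T <;> simp [hp]

/-- The memory that holds an encoded pending computation, its first `B` cells being free for the
next block. -/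
def saveState {Γ' : Type*} {T₀ : ℕ} (enc : Pending Γ' B T₀ → Fin (M - B) → Bool)
    (p : Pending Γ' B T₀) : Memory M :=
  fun k => if h : k < B then false else enc p ⟨k - B, by omega⟩

/-- The phase in which the loop body is followed as far as the blocks `l` of the current round
allow. The first block of each round is a dummy. -/
def roundPhase {Γ' : Type*} {T₀ : ℕ} (body : Γ → Tree B (Finset (Fin n) × Option Γ))
    (encΓ : Γ → Γ') (enc : Pending Γ' B T₀ → Fin (M - B) → Bool) (hM : B ≤ M) (mem : Memory M)
    (γ : Γ) (l : List (Block B)) : Phase n B M :=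
  match (Tree.read 0 fun _ => body γ).follow l with
  | .ret (E, none) => ⟨mem, E, .halt⟩
  | .ret (E, some γ') =>
    ⟨saveState enc (encΓ γ', ⟨0, fun j => j.elim0⟩), E, .read 0 0 (by omega)⟩
  | .read a _ =>
    if h : l.length ≤ T₀ then
      ⟨saveState enc (encΓ γ, ⟨⟨l.length, by omega⟩, l.get⟩), ∅, .read a 0 (by omega)⟩
    else ⟨mem, ∅, .halt⟩

/-- A loop whose good control states can be told apart with `G` bits, and that reads at most `T₀`
blocks in each round, runs on a machine with `G + B T₀ + 1 + B` bits of memory. -/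
theorem exists_algorithm {Γ' : Type*} [Fintype Γ'] [Nonempty Γ]
    (body : Γ → Tree B (Finset (Fin n) × Option Γ))
    (Good : Γ → Prop) (T₀ G : ℕ) (encΓ : Γ → Γ') (henc : Set.InjOn encΓ {γ | Good γ})
    (hB : 0 < B) (hG : Fintype.card Γ' ≤ 2 ^ G) (hM : G + (B * T₀ + 1) + B ≤ M) (init : Q → Γ) :
    ∃ P : Algorithm Q n B M, ∀ (q : Q) (bits : List Bool) (E : Finset (Fin n)) (T : ℕ) (γ : Γ),
      Good (init q) → Steps body Good T₀ (Disk.ofBits B bits) (init q) E T γ →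
      body γ = .ret (∅, none) → P.answer T bits q = some E := by
  classical
  have hBM : B ≤ M := by omega
  have hcard : Fintype.card (Pending Γ' B T₀) ≤ Fintype.card (Fin (M - B) → Bool) := by
    refine (card_pending Γ' B T₀ G hB hG).trans ?_
    rw [Fintype.card_fun, Fintype.card_bool, Fintype.card_fin]
    exact Nat.pow_le_pow_right (by norm_num) (by omega)
  obtain ⟨⟨enc, hencinj⟩⟩ := Function.Embedding.nonempty_of_card_le hcard
  by_cases hQ : Nonempty Q
  swap
  · exact ⟨⟨fun _ _ => false, fun m => ⟨m, ∅, .halt⟩⟩, fun q => (hQ ⟨q⟩).elim⟩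
  have : Nonempty (Pending Γ' B T₀) := ⟨(encΓ (Classical.arbitrary Γ), ⟨0, fun j => j.elim0⟩)⟩
  let dec := Function.invFun enc
  have hdec : ∀ p, dec (enc p) = p := Function.leftInverse_invFun hencinj
  let decΓ := Function.invFunOn encΓ {γ | Good γ}
  have hdecΓ : ∀ γ, Good γ → decΓ (encΓ γ) = γ := fun γ h => henc.leftInvOn_invFunOn h
  let P : Algorithm Q n B M :=
    ⟨fun q k => if h : k < B then false else
        enc (encΓ (init q), ⟨0, fun j => j.elim0⟩) ⟨k - B, by omega⟩,
      fun mem =>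
        let p := dec fun k => mem ⟨B + k, by omega⟩
        roundPhase body encΓ enc hBM mem (decΓ p.1)
          (List.ofFn p.2.2 ++ [fun j : Fin B => mem ⟨j, by omega⟩])⟩
  refine ⟨P, ?_⟩
  -- `Holds mem γ l` : the memory holds the control state `γ` and the blocks `l` of this round.
  let Holds : Memory M → Γ → List (Block B) → Prop := fun mem γ l =>
    ∃ (l' : List (Block B)) (blk : Block B),
    ∃ h : l'.length ≤ T₀, l = l' ++ [blk] ∧ (fun j : Fin B => mem ⟨j, by omega⟩) = blk ∧
    (fun k : Fin (M - B) => mem ⟨B + k, by omega⟩) =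
      enc (encΓ γ, ⟨⟨l'.length, by omega⟩, l'.get⟩)
  have hsave : ∀ (γ : Γ) (l : List (Block B)) (h : l.length ≤ T₀) (blk : Block B),
      Holds (loadBlock 0 (saveState enc (encΓ γ, ⟨⟨l.length, by omega⟩, l.get⟩)) blk) γ (l ++ [blk]) := by
    intro γ l h blk
    refine ⟨l, blk, h, rfl, ?_, ?_⟩
    · funext j; simp [loadBlock]
    · funext k; simp [loadBlock, saveState]
  have hphase : ∀ mem γ l, Good γ → Holds mem γ l → P.phase mem =
      roundPhase body encΓ enc hBM mem γ l := by
    rintro mem γ l hγ ⟨l', blk, h, rfl, h1, h2⟩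
    have e1 : dec (fun k : Fin (M - B) => mem ⟨B + k, by omega⟩) =
        (encΓ γ, ⟨⟨l'.length, by omega⟩, l'.get⟩) := by rw [h2, hdec]
    have e2 : decΓ (dec (fun k : Fin (M - B) => mem ⟨B + k, by omega⟩)).1 = γ := by
      rw [e1]; exact hdecΓ γ hγ
    have e3 : List.ofFn (dec (fun k : Fin (M - B) => mem ⟨B + k, by omega⟩)).2.2 = l' := by
      rw [e1]; exact List.ofFn_get l'
    simp only [P, e2, e3, h1]
  -- one round of the loop
  have hround : ∀ (D : Disk B) (γ γ' : Γ) (E : Finset (Fin n)) (tr : Tree B _) (mem : Memory M)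
      (l : List (Block B)) (T : ℕ) (F : Finset (Fin n)), Good γ → Holds mem γ l →
      (Tree.read 0 fun _ => body γ).follow l = tr → tr.run D = (E, some γ') →
      tr.cost D + l.length ≤ T₀ + 1 →
      (∀ mem', Holds mem' γ' [D 0] → P.run T mem' D = some F) →
      P.run (tr.cost D + 1 + T) mem D = some (E ∪ F) := by
    intro D γ γ' E tr
    induction tr with
    | ret x =>
      intro mem l T F hγ hm hf hr hc hT
      simp only [Tree.run_ret] at hr
      subst hr
      have hp := hphase mem γ l hγ hm
      rw [roundPhase, hf] at hp
      simp only [Tree.cost_ret]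
      rw [show 0 + 1 + T = T + 1 by ring, run_of_read P hp]
      have hs : (⟨0, fun j => j.elim0⟩ : Σ t : Fin (T₀ + 1), (Fin t → Block B)) =
          ⟨⟨([] : List (Block B)).length, by simp⟩, ([] : List (Block B)).get⟩ := by
        refine Sigma.ext rfl (heq_of_eq ?_)
        funext j
        exact j.elim0
      rw [hs, hT _ (hsave γ' [] (by simp) (D 0))]
      simp
    | read a k ih =>
      intro mem l T F hγ hm hf hr hc hT
      have hp := hphase mem γ l hγ hm
      rw [roundPhase, hf] at hp
      simp only [Tree.cost_read] at hc ⊢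
      have hl : l.length ≤ T₀ := by omega
      simp only [hl, dif_pos] at hp
      rw [show (k (D a)).cost D + 1 + 1 + T = ((k (D a)).cost D + 1 + T) + 1 by ring,
        run_of_read P hp]
      rw [ih (D a) _ (l ++ [D a]) T F hγ (hsave γ l hl (D a)) (by
        rw [Tree.follow_append, hf]; simp [Tree.follow]) (by simpa using hr) (by simp; omega) hT]
      simp
  have hsteps : ∀ (D : Disk B) (γ γ' : Γ) (E : Finset (Fin n)) (T : ℕ),
      Steps body Good T₀ D γ E T γ' → Good γ → body γ' = .ret (∅, none) →
      ∀ mem blk, Holds mem γ [blk] → P.run T mem D = some E := by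
    intro D γ γ' E T h
    induction h with
    | refl γ c =>
      intro hγ hb mem blk hm
      have hp := hphase mem γ _ hγ hm
      simp only [roundPhase, Tree.follow, hb] at hp
      exact run_of_halt P hp _ _
    | @head γ γ₁ γ₂ E F c c' h1 h2 h3 h4 h5 ih =>
      intro hγ hb mem blk hm
      obtain ⟨r, rfl⟩ := Nat.exists_eq_add_of_le h5
      rw [add_assoc]
      refine hround D γ γ₁ E (body γ) mem [blk] (c + r) F hγ hm (by simp [Tree.follow]) h2
        (by simpa using h1) ?_
      intro mem' hm'
      have := ih h3 hb mem' _ hm'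
      -- more I/Os than needed do no harm
      have hmono : ∀ (T r : ℕ) (mem : Memory M) (D : Disk B) (E : Finset (Fin n)),
          P.run T mem D = some E → P.run (T + r) mem D = some E := by
        intro T
        induction T with
        | zero =>
          intro r mem D E
          unfold Algorithm.run
          cases hop : (P.phase mem).op <;> cases r <;> simp
        | succ T ihT =>
          intro r mem D E
          rw [show T + 1 + r = (T + r) + 1 by ring]
          unfold Algorithm.run
          cases hop : (P.phase mem).op with
          | halt => simp
          | read a p h =>
            simp only [Option.map_eq_some_iff]
            rintro ⟨E', h1, h2⟩
            exact ⟨E', ihT r _ _ _ h1, h2⟩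
          | write a p h =>
            simp only [Option.map_eq_some_iff]
            rintro ⟨E', h1, h2⟩
            exact ⟨E', ihT r _ _ _ h1, h2⟩
      exact hmono _ _ _ _ _ this
  intro q bits E T γ hq h hγ
  refine hsteps _ _ _ _ _ h hq hγ _ (fun _ => false) ⟨[], _, by simp, rfl, ?_, ?_⟩
  · funext j; simp [P]
  · funext k
    simp only [P]
    rw [dif_neg (by simp)]
    have hk : (⟨B + (k : ℕ) - B, by omega⟩ : Fin (M - B)) = k := by ext; simp
    rw [hk]
    congr 2
    refine Sigma.ext rfl (heq_of_eq ?_)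
    funext j
    exact j.elim0

end Machine

/-! ### Reading bits and numbers -/

/-- Bit `j` of a block, `false` beyond the end. -/
def bitOf {B : ℕ} (blk : Block B) (j : ℕ) : Bool := if h : j < B then blk ⟨j, h⟩ else false

/-- The bit with address `a` of a disk. -/
def diskBit {B : ℕ} (D : Disk B) (a : ℕ) : Bool := bitOf (D (a / B)) (a % B)

theorem diskBit_ofBits {B : ℕ} (hB : 0 < B) (bits : List Bool) (a : ℕ) :
    diskBit (Disk.ofBits B bits) a = bits.getD a false := by
  simp [diskBit, bitOf, Disk.ofBits, Nat.mod_lt _ hB, Nat.div_add_mod']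

/-- Read the listed blocks; the result is the contents of the disk as far as they are known. -/
def readBlocks {B : ℕ} : List ℕ → Tree B (ℕ → Block B)
  | [] => .ret fun _ _ => false
  | b :: bs => .read b fun blk => (readBlocks bs).bind fun f => .ret (Function.update f b blk)

theorem run_readBlocks {B : ℕ} (D : Disk B) (l : List ℕ) (b : ℕ) (hb : b ∈ l) :
    (readBlocks l).run D b = D b := by
  induction l with
  | nil => simp at hb
  | cons c l ih =>
    simp only [readBlocks, Tree.run_read, Tree.run_bind, Tree.run_ret, Function.update_apply]
    split_ifs with h
    · rw [h]
    · exact ih (by simpa [h] using hb)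

theorem cost_readBlocks {B : ℕ} (D : Disk B) (l : List ℕ) :
    (readBlocks l).cost D = l.length := by
  induction l with
  | nil => rfl
  | cons c l ih => simp [readBlocks, ih]

/-- Read the bits with the addresses in `S`, each block only once. -/
noncomputable def readAt (B : ℕ) (S : Finset ℕ) : Tree B (ℕ → Bool) :=
  (readBlocks (S.image (· / B)).toList).bind fun f => .ret fun a => bitOf (f (a / B)) (a % B)

theorem run_readAt {B : ℕ} (D : Disk B) (S : Finset ℕ) (a : ℕ) (ha : a ∈ S) :
    (readAt B S).run D a = diskBit D a := by
  simp only [readAt, Tree.run_bind, Tree.run_ret, diskBit]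
  rw [run_readBlocks]
  simpa using ⟨a, ha, rfl⟩

theorem cost_readAt {B : ℕ} (D : Disk B) (S : Finset ℕ) :
    (readAt B S).cost D = (S.image (· / B)).card := by
  simp [readAt, cost_readBlocks]

/-- An interval of `l` bits meets at most `l / B + 2` blocks, in multiplied form. -/
theorem card_blocks_mul_le {B : ℕ} (S : Finset ℕ) (a l : ℕ)
    (hS : ∀ x ∈ S, a ≤ x ∧ x < a + l) : (S.image (· / B)).card * B ≤ l + 2 * B := by
  rcases Nat.eq_zero_or_pos B with rfl | hB
  · simp
  have h : S.image (· / B) ⊆ Finset.Icc (a / B) ((a + l) / B) := by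
    intro y hy
    obtain ⟨x, hx, rfl⟩ := Finset.mem_image.1 hy
    exact Finset.mem_Icc.2 ⟨Nat.div_le_div_right (hS x hx).1,
      Nat.div_le_div_right (hS x hx).2.le⟩
  have h2 := Finset.card_le_card h
  rw [Nat.card_Icc] at h2
  have h3 := Nat.div_add_mod a B
  have h4 := Nat.div_add_mod (a + l) B
  have h5 := Nat.mod_lt a hB
  have h6 := Nat.mod_lt (a + l) hB
  have h7 : a / B ≤ (a + l) / B := Nat.div_le_div_right (by omega)
  obtain ⟨r, hr⟩ := Nat.exists_eq_add_of_le h7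
  rw [hr] at h2 h4
  have h8 : (S.image (· / B)).card * B ≤ (r + 1) * B := Nat.mul_le_mul_right _ (by omega)
  rw [mul_add] at h4
  rw [add_mul, one_mul, mul_comm r B] at h8
  omega

/-- Read the `W`-bit number with index `i` in the table at the start of the disk. -/
noncomputable def readNum (B W i : ℕ) : Tree B ℕ :=
  (readAt B (Finset.Ico (W * i) (W * i + W))).bind fun g =>
    .ret (Nat.ofBits fun j : Fin W => g (W * i + j))

theorem run_readNum {B : ℕ} (D : Disk B) (W i v : ℕ) (hv : v < 2 ^ W)
    (h : ∀ j < W, diskBit D (W * i + j) = v.testBit j) : (readNum B W i).run D = v := by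
  simp only [readNum, Tree.run_bind, Tree.run_ret]
  have : (fun j : Fin W => (readAt B (Finset.Ico (W * i) (W * i + W))).run D (W * i + j)) =
      fun j : Fin W => v.testBit j := by
    funext j
    rw [run_readAt _ _ _ (by simp), h j j.2]
  rw [this, Nat.ofBits_testBit, Nat.mod_eq_of_lt hv]

theorem cost_readNum {B W c : ℕ} (D : Disk B) (i : ℕ) (hB : 0 < B) (hW : W ≤ c * B) :
    (readNum B W i).cost D ≤ c + 2 := by
  simp only [readNum, Tree.cost_bind, Tree.cost_ret, cost_readAt, add_zero]
  have := card_blocks_mul_le (B := B) (Finset.Ico (W * i) (W * i + W)) (W * i) W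
    (by intro x hx; simpa using hx)
  exact Nat.le_of_mul_le_mul_right (by nlinarith) hB

/-! ### Machines that work through a list of tasks -/

section Tasks

variable {n B : ℕ} {Q Par Task I : Type*}

/-- The loop body of a machine that first computes parameters from the query, and then performs the
tasks that the parameters determine, one after the other; each task is itself a loop. -/
def taskBody (start : Q → Tree B Par) (tasks : Par → List Task) (fresh : I)
    (step : Par → Task → I → Tree B (Finset (Fin n) × Option I)) :
    Q ⊕ Par × ℕ × I → Tree B (Finset (Fin n) × Option (Q ⊕ Par × ℕ × I))
  | .inl q => (start q).bind fun p => .ret (∅, some (.inr (p, 0, fresh)))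
  | .inr (p, k, x) =>
    match (tasks p)[k]? with
    | none => .ret (∅, none)
    | some τ => (step p τ x).bind fun r =>
        .ret (r.1, some (.inr (r.2.elim (p, k + 1, fresh) fun x' => (p, k, x'))))

/-- A task started in an inner state terminates within a number of I/Os. -/
inductive TaskRun (stepτ : I → Tree B (Finset (Fin n) × Option I)) (GoodI : I → Prop) (T₀ : ℕ)
    (D : Disk B) : I → Finset (Fin n) → ℕ → Prop
  | last {x : I} {E : Finset (Fin n)} {c : ℕ} (hcost : (stepτ x).cost D ≤ T₀)
      (hrun : (stepτ x).run D = (E, none)) (hle : (stepτ x).cost D + 1 ≤ c) :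
      TaskRun stepτ GoodI T₀ D x E c
  | next {x x' : I} {E F : Finset (Fin n)} {c c' : ℕ} (hcost : (stepτ x).cost D ≤ T₀)
      (hrun : (stepτ x).run D = (E, some x')) (hgood : GoodI x')
      (h : TaskRun stepτ GoodI T₀ D x' F c) (hle : (stepτ x).cost D + 1 + c ≤ c') :
      TaskRun stepτ GoodI T₀ D x (E ∪ F) c'

theorem TaskRun.mono {stepτ : I → Tree B (Finset (Fin n) × Option I)} {GoodI : I → Prop} {T₀ : ℕ}
    {D : Disk B} {x : I} {E : Finset (Fin n)} {c c' : ℕ} (h : TaskRun stepτ GoodI T₀ D x E c)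
    (hc : c ≤ c') : TaskRun stepτ GoodI T₀ D x E c' := by
  cases h with
  | last h1 h2 h3 => exact .last h1 h2 (h3.trans hc)
  | next h1 h2 h3 h4 h5 => exact .next h1 h2 h3 h4 (h5.trans hc)

/-- A state of a task machine is good if its position in the list of tasks is one of `0, …, kmax`
and its other components are good. -/
def TaskGood (GoodQ : Q → Prop) (GoodP : Par → Prop) (GoodI : I → Prop) (kmax : ℕ) :
    Q ⊕ Par × ℕ × I → Prop
  | .inl q => GoodQ q
  | .inr (p, k, x) => GoodP p ∧ k ≤ kmax ∧ GoodI x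

variable {start : Q → Tree B Par} {tasks : Par → List Task} {fresh : I}
  {step : Par → Task → I → Tree B (Finset (Fin n) × Option I)} {GoodQ : Q → Prop}
  {GoodP : Par → Prop} {GoodI : I → Prop} {kmax T₀ : ℕ} {D : Disk B}

theorem TaskRun.steps {p : Par} {k : ℕ} {τ : Task} (hτ : (tasks p)[k]? = some τ)
    (hp : GoodP p) (hk : k + 1 ≤ kmax) (hfresh : GoodI fresh) {x : I} {E : Finset (Fin n)} {c : ℕ}
    (h : TaskRun (step p τ) GoodI T₀ D x E c) :
    Steps (taskBody start tasks fresh step) (TaskGood GoodQ GoodP GoodI kmax) T₀ D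
      (.inr (p, k, x)) E c (.inr (p, k + 1, fresh)) := by
  induction h with
  | @last x E c h1 h2 h3 =>
    rw [← Finset.union_empty E]
    refine .head (γ' := .inr (p, k + 1, fresh)) (c := 0) ?_ ?_ ?_ (.refl _ _) ?_
    · simpa [taskBody, hτ] using h1
    · simp [taskBody, hτ, h2]
    · exact ⟨hp, hk, hfresh⟩
    · simpa [taskBody, hτ] using h3
  | @next x x' E F c c' h1 h2 h3 _ h5 ih =>
    refine .head (γ' := .inr (p, k, x')) (c := c) ?_ ?_ ?_ ih ?_
    · simpa [taskBody, hτ] using h1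
    · simp [taskBody, hτ, h2]
    · exact ⟨hp, by omega, h3⟩
    · simpa [taskBody, hτ] using h5

theorem steps_tasks {p : Par} (hp : GoodP p) (hfresh : GoodI fresh)
    (hlen : (tasks p).length ≤ kmax) (out : Task → Finset (Fin n)) (cost : Task → ℕ)
    (h : ∀ τ ∈ tasks p, TaskRun (step p τ) GoodI T₀ D fresh (out τ) (cost τ)) :
    ∃ E : Finset (Fin n), (∀ i, i ∈ E ↔ ∃ τ ∈ tasks p, i ∈ out τ) ∧
      Steps (taskBody start tasks fresh step) (TaskGood GoodQ GoodP GoodI kmax) T₀ D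
        (.inr (p, 0, fresh)) E ((tasks p).map cost).sum (.inr (p, (tasks p).length, fresh)) := by
  suffices H : ∀ k ≤ (tasks p).length, ∃ E : Finset (Fin n),
      (∀ i, i ∈ E ↔ ∃ τ ∈ (tasks p).take k, i ∈ out τ) ∧
      Steps (taskBody start tasks fresh step) (TaskGood GoodQ GoodP GoodI kmax) T₀ D
        (.inr (p, 0, fresh)) E (((tasks p).take k).map cost).sum (.inr (p, k, fresh)) by
    simpa using H _ le_rfl
  intro k
  induction k with
  | zero => intro _; exact ⟨∅, by simp, .refl _ _⟩
  | succ k ih =>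
    intro hk
    obtain ⟨E, hE, hs⟩ := ih (by omega)
    have hk' : k < (tasks p).length := hk
    have hτ : (tasks p)[k]? = some (tasks p)[k] := List.getElem?_eq_getElem hk'
    have e : (tasks p).take (k + 1) = (tasks p).take k ++ [(tasks p)[k]] := by simp
    rw [e]
    generalize (tasks p).take k = l at hE hs
    refine ⟨E ∪ out (tasks p)[k], ?_, ?_⟩
    · intro i
      simp [hE, or_and_right, exists_or]
    · simpa using hs.trans ((h _ (List.getElem_mem hk')).steps hτ hp (by omega) hfresh)

/-- A task machine runs through all its tasks. -/
theorem steps_machine {q : Q} {p : Par} (hp : GoodP p) (hfresh : GoodI fresh)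
    (hlen : (tasks p).length ≤ kmax) (out : Task → Finset (Fin n)) (cost : Task → ℕ)
    (h : ∀ τ ∈ tasks p, TaskRun (step p τ) GoodI T₀ D fresh (out τ) (cost τ))
    (hstart : (start q).run D = p) (hcost : (start q).cost D ≤ T₀) :
    ∃ E : Finset (Fin n), (∀ i, i ∈ E ↔ ∃ τ ∈ tasks p, i ∈ out τ) ∧
      Steps (taskBody start tasks fresh step) (TaskGood GoodQ GoodP GoodI kmax) T₀ D
        (.inl q) E ((start q).cost D + 1 + ((tasks p).map cost).sum)
        (.inr (p, (tasks p).length, fresh)) := by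
  obtain ⟨E, hE, hs⟩ := steps_tasks (start := start) (GoodQ := GoodQ) hp hfresh hlen out cost h
  refine ⟨E, hE, ?_⟩
  rw [← Finset.empty_union E]
  refine .head (γ' := .inr (p, 0, fresh)) ?_ ?_ ?_ hs ?_
  · simpa [taskBody] using hcost
  · simp [taskBody, hstart]
  · exact ⟨hp, by omega, hfresh⟩
  · simp [taskBody]

theorem taskBody_end (p : Par) (x : I) :
    taskBody start tasks fresh step (.inr (p, (tasks p).length, x)) = .ret (∅, none) := by
  simp [taskBody]

end Tasks

/-! ### Dyadic intervals of ranks -/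

/-- The least multiple of `2 ^ k` that is at least `s`. -/
def ceilPow (k s : ℕ) : ℕ := (s + 2 ^ k - 1) / 2 ^ k * 2 ^ k

theorem dvd_ceilPow (k s : ℕ) : 2 ^ k ∣ ceilPow k s := Dvd.intro_left _ rfl

theorem le_ceilPow (k s : ℕ) : s ≤ ceilPow k s := by
  have h := Nat.div_add_mod (s + 2 ^ k - 1) (2 ^ k)
  have h2 := Nat.mod_lt (s + 2 ^ k - 1) (Nat.two_pow_pos k)
  have h3 := Nat.two_pow_pos k
  rw [ceilPow, mul_comm]
  omega

theorem ceilPow_lt (k s : ℕ) : ceilPow k s < s + 2 ^ k := by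
  have h := Nat.div_mul_le_self (s + 2 ^ k - 1) (2 ^ k)
  have h3 := Nat.two_pow_pos k
  rw [ceilPow]
  omega

theorem eq_of_dvd_of_lt {a b c : ℕ} (ha : c ∣ a) (hb : c ∣ b) (h : a ≤ b) (h' : b < a + c) :
    a = b := by
  obtain ⟨x, rfl⟩ := ha
  obtain ⟨y, rfl⟩ := hb
  have hc : 0 < c := by omega
  have h1 : x ≤ y := Nat.le_of_mul_le_mul_left h hc
  have h2 : y < x + 1 := Nat.lt_of_mul_lt_mul_left (a := c) (by rw [mul_add]; omega)
  rw [show x = y by omega]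

theorem ceilPow_le {k s t : ℕ} (h : s ≤ t) (ht : 2 ^ k ∣ t) : ceilPow k s ≤ t := by
  by_contra hlt
  push Not at hlt
  have h1 := ceilPow_lt k s
  have := eq_of_dvd_of_lt ht (dvd_ceilPow k s) hlt.le (by omega)
  omega

theorem ceilPow_eq {k s t : ℕ} (h : s ≤ t) (ht : 2 ^ k ∣ t) (h2 : t < s + 2 ^ k) :
    ceilPow k s = t :=
  eq_of_dvd_of_lt (dvd_ceilPow k s) ht (ceilPow_le h ht) (by have := le_ceilPow k s; omega)

theorem ceilPow_mono {j k : ℕ} (h : j ≤ k) (s : ℕ) : ceilPow j s ≤ ceilPow k s :=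
  ceilPow_le (le_ceilPow k s) ((pow_dvd_pow 2 h).trans (dvd_ceilPow k s))

theorem ceilPow_zero (s : ℕ) : ceilPow 0 s = s := by simp [ceilPow]

/-- Between the roundings of `s` to two consecutive powers of two there is one dyadic interval,
or nothing. -/
theorem ceilPow_succ (j s : ℕ) :
    ceilPow (j + 1) s = ceilPow j s ∨ ceilPow (j + 1) s = ceilPow j s + 2 ^ j := by
  obtain ⟨c, hc⟩ := dvd_ceilPow j s
  have h1 := le_ceilPow j s
  have h2 := ceilPow_lt j s
  have h3 := pow_succ 2 j
  rcases Nat.even_or_odd' c with ⟨x, hx | hx⟩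
  · left
    exact ceilPow_eq h1 ⟨x, by rw [hc, hx]; ring⟩ (by omega)
  · right
    exact ceilPow_eq (by omega) ⟨x + 1, by rw [hc, hx]; ring⟩ (by omega)

/-- A string seen from its ranks: the positions, in number `2 ^ L`, are sorted by their characters,
the runs of equal characters are separated by the boundaries `b 0, …, b m`, and `key` is the hash
value of the position of a given rank. -/
structure World where
  L : ℕ
  m : ℕ
  b : ℕ → ℕ
  key : ℕ → ℕ

namespace World

variable (w : World)

/-- The dyadic interval of size `2 ^ k` around the rank `r` has no boundary in its interior, so it
lies in one run. -/
def Mono (k r : ℕ) : Prop :=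
  ∀ i ≤ w.m, ¬ (r / 2 ^ k * 2 ^ k < w.b i ∧ w.b i < r / 2 ^ k * 2 ^ k + 2 ^ k)

open Classical in
/-- The exponent of the largest dyadic interval around `r` that lies in one run. -/
noncomputable def kmono (r : ℕ) : ℕ := Nat.findGreatest (fun k => w.Mono k r) w.L

/-- The depth of that interval in the tree of the dyadic intervals. -/
noncomputable def dep (r : ℕ) : ℕ := w.L - w.kmono r

/-- The exponent of the piece around `r`: the pieces are the maximal dyadic intervals that lie in
one run, but those of size less than `2 ^ g` are replaced with intervals of this size. -/
noncomputable def kap (g r : ℕ) : ℕ := max g (w.kmono r)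

theorem mono_zero (r : ℕ) : w.Mono 0 r := by
  intro i _ h
  simp at h
  omega

theorem mono_congr {k r r' : ℕ} (h : r / 2 ^ k = r' / 2 ^ k) : w.Mono k r ↔ w.Mono k r' := by
  simp [Mono, h]

theorem div_mul_le_div_mul {j k : ℕ} (h : j ≤ k) (r : ℕ) :
    r / 2 ^ k * 2 ^ k ≤ r / 2 ^ j * 2 ^ j ∧
      r / 2 ^ j * 2 ^ j + 2 ^ j ≤ r / 2 ^ k * 2 ^ k + 2 ^ k := by
  obtain ⟨c, rfl⟩ := Nat.exists_eq_add_of_le h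
  have e : r / 2 ^ (j + c) = r / 2 ^ j / 2 ^ c := by rw [pow_add, Nat.div_div_eq_div_mul]
  rw [e, pow_add]
  generalize r / 2 ^ j = x
  have h1 := Nat.div_add_mod x (2 ^ c)
  have h2 := Nat.mod_lt x (Nat.two_pow_pos c)
  have h3 : x / 2 ^ c * 2 ^ c ≤ x := Nat.div_mul_le_self _ _
  have h4 : x + 1 ≤ x / 2 ^ c * 2 ^ c + 2 ^ c := by rw [mul_comm]; omega
  constructor
  · calc _ = (x / 2 ^ c * 2 ^ c) * 2 ^ j := by ring
      _ ≤ _ := Nat.mul_le_mul_right _ h3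
  · calc _ = (x + 1) * 2 ^ j := by ring
      _ ≤ (x / 2 ^ c * 2 ^ c + 2 ^ c) * 2 ^ j := Nat.mul_le_mul_right _ h4
      _ = _ := by ring

theorem mono_anti {j k r : ℕ} (h : j ≤ k) (hk : w.Mono k r) : w.Mono j r := by
  intro i hi hb
  have := div_mul_le_div_mul h r
  exact hk i hi ⟨by omega, by omega⟩

theorem mono_kmono (r : ℕ) : w.Mono (w.kmono r) r := by
  classical
  exact Nat.findGreatest_spec (P := fun k => w.Mono k r) (Nat.zero_le _) (w.mono_zero r)

theorem kmono_le (r : ℕ) : w.kmono r ≤ w.L := by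
  classical exact Nat.findGreatest_le _

theorem le_kmono {k r : ℕ} (hk : k ≤ w.L) (h : w.Mono k r) : k ≤ w.kmono r := by
  classical exact Nat.le_findGreatest hk h

theorem mono_of_le_kmono {k r : ℕ} (h : k ≤ w.kmono r) : w.Mono k r :=
  w.mono_anti h (w.mono_kmono r)

theorem kmono_lt {k r : ℕ} (h : ¬ w.Mono k r) : w.kmono r < k := by
  by_contra hk
  exact h (w.mono_of_le_kmono (by omega))

theorem div_eq_div_of_le {j k r r' : ℕ} (h : j ≤ k) (hr : r / 2 ^ j = r' / 2 ^ j) :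
    r / 2 ^ k = r' / 2 ^ k := by
  obtain ⟨c, rfl⟩ := Nat.exists_eq_add_of_le h
  rw [pow_add, ← Nat.div_div_eq_div_mul, hr, Nat.div_div_eq_div_mul]

theorem kap_le {g : ℕ} (hg : g ≤ w.L) (r : ℕ) : w.kap g r ≤ w.L := max_le hg (w.kmono_le r)

/-- All ranks in one piece agree on it. -/
theorem kap_congr {g r r' : ℕ} (h : r / 2 ^ w.kap g r = r' / 2 ^ w.kap g r) :
    w.kap g r' = w.kap g r := by
  have h1 : ∀ k, w.kap g r ≤ k → (w.Mono k r ↔ w.Mono k r') := fun k hk =>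
    w.mono_congr (div_eq_div_of_le hk h)
  have h2 : w.kmono r' ≤ w.kap g r := by
    by_contra hlt
    push Not at hlt
    have := w.le_kmono (w.kmono_le r') ((h1 _ hlt.le).2 (w.mono_kmono r'))
    have h3 : w.kmono r ≤ w.kap g r := le_max_right _ _
    omega
  rcases le_total g (w.kmono r) with hg | hg
  · have e : w.kap g r = w.kmono r := max_eq_right hg
    rw [e] at h1 h2 ⊢
    have := w.le_kmono (w.kmono_le r) ((h1 _ le_rfl).1 (w.mono_kmono r))
    rw [kap, max_eq_right (by omega)]
    omega
  · have e : w.kap g r = g := max_eq_left hg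
    rw [e] at h2 ⊢
    exact max_eq_left h2

/-- The rank `r` is the first of its piece. -/
def IsStart (g r : ℕ) : Prop := 2 ^ w.kap g r ∣ r

theorem not_isStart {g r x : ℕ} (h : w.IsStart g r) (h1 : r < x) (h2 : x < r + 2 ^ w.kap g r) :
    ¬ w.IsStart g x := by
  obtain ⟨c, hc⟩ := h
  have e : r / 2 ^ w.kap g r = x / 2 ^ w.kap g r := by
    rw [Nat.div_eq_of_lt_le (k := c) (by rw [mul_comm]; omega) (by rw [add_mul, mul_comm]; omega),
      Nat.div_eq_of_lt_le (k := c) (by rw [mul_comm]; omega) (by rw [add_mul, mul_comm]; omega)]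
  intro h'
  rw [IsStart, w.kap_congr e] at h'
  have := eq_of_dvd_of_lt ⟨c, hc⟩ h' h1.le h2
  omega

theorem kap_eq_of_mem {g r x : ℕ} (h : w.IsStart g r) (h1 : r ≤ x)
    (h2 : x < r + 2 ^ w.kap g r) : w.kap g x = w.kap g r := by
  obtain ⟨c, hc⟩ := h
  apply w.kap_congr
  rw [Nat.div_eq_of_lt_le (k := c) (by rw [mul_comm]; omega) (by rw [add_mul, mul_comm]; omega),
      Nat.div_eq_of_lt_le (k := c) (by rw [mul_comm]; omega) (by rw [add_mul, mul_comm]; omega)]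

theorem isStart_next {g r : ℕ} (h : w.IsStart g r) : w.IsStart g (r + 2 ^ w.kap g r) := by
  set k := w.kap g r with hk
  set r' := r + 2 ^ k with hr'
  have hd : 2 ^ k ∣ r' := dvd_add h (dvd_refl _)
  rcases le_or_gt (w.kap g r') k with h1 | h1
  · exact (pow_dvd_pow 2 h1).trans hd
  · have hg : g ≤ k := le_max_left _ _
    have e : w.kap g r' = w.kmono r' := by
      rcases max_choice g (w.kmono r') with h2 | h2
      · rw [kap] at h1; omega
      · exact h2
    rw [IsStart, e]
    rw [e] at h1
    set k' := w.kmono r' with hk'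
    by_contra hnd
    have h3 : r' / 2 ^ k' * 2 ^ k' ≤ r' := Nat.div_mul_le_self _ _
    have h4 : r' / 2 ^ k' * 2 ^ k' ≠ r' := fun h5 => hnd (Dvd.intro_left _ h5)
    have h5 : 2 ^ k ∣ r' / 2 ^ k' * 2 ^ k' := (pow_dvd_pow 2 h1.le).trans (Dvd.intro_left _ rfl)
    have h6 : r' / 2 ^ k' * 2 ^ k' ≤ r := by
      by_contra h7
      have := eq_of_dvd_of_lt h5 hd h3 (by omega)
      omega
    have h7 : r / 2 ^ k' = r' / 2 ^ k' := by
      have := Nat.two_pow_pos k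
      refine Nat.div_eq_of_lt_le h6 ?_
      have := Nat.lt_div_mul_add (a := r') (Nat.two_pow_pos k')
      rw [add_mul]; omega
    have h8 := w.le_kmono (w.kmono_le r') ((w.mono_congr h7).2 (w.mono_kmono r'))
    have : w.kmono r ≤ k := le_max_right _ _
    omega

/-- Ranks between a boundary and its rounding to a multiple of `2 ^ k`. -/
theorem not_mono_of_mem {i k r : ℕ} (hi : i ≤ w.m) (h1 : w.b i ≤ r) (h2 : r < ceilPow k (w.b i)) :
    ¬ w.Mono k r := by
  intro h
  have h3 : r / 2 ^ k * 2 ^ k ≤ r := Nat.div_mul_le_self _ _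
  have h4 := Nat.lt_div_mul_add (a := r) (Nat.two_pow_pos k)
  have h5 : r / 2 ^ k * 2 ^ k < w.b i := by
    by_contra hle
    push Not at hle
    have := ceilPow_le hle (Dvd.intro_left _ rfl)
    omega
  exact h i hi ⟨h5, by omega⟩

theorem isStart_ceilPow {i g : ℕ} (hi : i ≤ w.m) : w.IsStart g (ceilPow g (w.b i)) := by
  set r := ceilPow g (w.b i) with hr
  rcases max_choice g (w.kmono r) with h | h
  · rw [IsStart, kap, h]; exact dvd_ceilPow _ _
  · rw [IsStart, kap, h]
    have hg : g ≤ w.kmono r := by rw [← h]; exact le_max_left _ _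
    by_contra hnd
    set k := w.kmono r with hk
    have h3 : r / 2 ^ k * 2 ^ k ≤ r := Nat.div_mul_le_self _ _
    have h4 : r / 2 ^ k * 2 ^ k ≠ r := fun h5 => hnd (Dvd.intro_left _ h5)
    have h5 : 2 ^ g ∣ r / 2 ^ k * 2 ^ k := (pow_dvd_pow 2 hg).trans (Dvd.intro_left _ rfl)
    have h6 : r / 2 ^ k * 2 ^ k < w.b i := by
      by_contra hle
      push Not at hle
      have := ceilPow_le hle h5
      omega
    have h7 := Nat.lt_div_mul_add (a := r) (Nat.two_pow_pos k)
    have h8 := le_ceilPow g (w.b i)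
    exact w.mono_kmono r i hi ⟨h6, lt_of_le_of_lt h8 h7⟩

/-- No piece straddles the end of the rounding of a boundary. -/
theorem piece_le_ceilPow {i g j r : ℕ} (h : w.IsStart g r)
    (h1 : w.b i ≤ r) (h2 : r < ceilPow j (w.b i)) :
    r + 2 ^ w.kap g r ≤ ceilPow j (w.b i) := by
  by_contra hlt
  push Not at hlt
  have hk : j < w.kap g r := by
    by_contra hle
    push Not at hle
    have := eq_of_dvd_of_lt h ((pow_dvd_pow 2 hle).trans (dvd_ceilPow j (w.b i))) h2.le hlt
    omega
  have h3 : 2 ^ j ∣ r := (pow_dvd_pow 2 hk.le).trans h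
  have := ceilPow_le h1 h3
  omega

/-! ### Counting the ranks in mixed dyadic intervals -/

theorem card_node_le (k c N : ℕ) :
    ((Finset.range N).filter fun r => r / 2 ^ k = c).card ≤ 2 ^ k := by
  have : (Finset.range N).filter (fun r => r / 2 ^ k = c) ⊆
      Finset.Ico (c * 2 ^ k) (c * 2 ^ k + 2 ^ k) := by
    intro r hr
    have h := (Finset.mem_filter.1 hr).2
    have h1 := Nat.div_mul_le_self r (2 ^ k)
    have h2 := Nat.lt_div_mul_add (a := r) (Nat.two_pow_pos k)
    rw [h] at h1 h2
    exact Finset.mem_Ico.2 ⟨h1, h2⟩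
  simpa using Finset.card_le_card this

open Classical in
theorem card_not_mono_le (k N : ℕ) :
    ((Finset.range N).filter fun r => ¬ w.Mono k r).card ≤ (w.m + 1) * 2 ^ k := by
  have : (Finset.range N).filter (fun r => ¬ w.Mono k r) ⊆
      (Finset.range (w.m + 1)).biUnion fun i =>
        (Finset.range N).filter fun r => r / 2 ^ k = w.b i / 2 ^ k := by
    intro r hr
    obtain ⟨h1, h2⟩ := Finset.mem_filter.1 hr
    simp only [Mono, not_forall, not_not] at h2
    obtain ⟨i, hi, h3, h4⟩ := h2
    refine Finset.mem_biUnion.2 ⟨i, by simpa using Nat.lt_succ_of_le hi,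
      Finset.mem_filter.2 ⟨h1, ?_⟩⟩
    exact (Nat.div_eq_of_lt_le h3.le (by rw [add_mul]; omega)).symm
  refine (Finset.card_le_card this).trans (Finset.card_biUnion_le.trans ?_)
  refine (Finset.sum_le_sum fun i _ => card_node_le k (w.b i / 2 ^ k) N).trans ?_
  simp

open Classical in
theorem card_not_mono_run_le (hb : Monotone w.b) (k i : ℕ) :
    ((Finset.Ico (w.b i) (w.b (i + 1))).filter fun r => ¬ w.Mono k r).card ≤ 2 ^ (k + 1) := by
  have : (Finset.Ico (w.b i) (w.b (i + 1))).filter (fun r => ¬ w.Mono k r) ⊆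
      ((Finset.range (w.b (i + 1))).filter fun r => r / 2 ^ k = w.b i / 2 ^ k) ∪
      ((Finset.range (w.b (i + 1))).filter fun r => r / 2 ^ k = w.b (i + 1) / 2 ^ k) := by
    intro r hr
    obtain ⟨h1, h2⟩ := Finset.mem_filter.1 hr
    rw [Finset.mem_Ico] at h1
    simp only [Mono, not_forall, not_not] at h2
    obtain ⟨l, _, h3, h4⟩ := h2
    rw [Finset.mem_union, Finset.mem_filter, Finset.mem_filter, Finset.mem_range]
    have h5 := Nat.div_mul_le_self r (2 ^ k)
    have h6 := Nat.lt_div_mul_add (a := r) (Nat.two_pow_pos k)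
    rcases le_or_gt l i with h | h
    · have := hb h
      exact Or.inl ⟨h1.2, (Nat.div_eq_of_lt_le (by omega) (by rw [add_mul]; omega)).symm⟩
    · have := hb (show i + 1 ≤ l from h)
      exact Or.inr ⟨h1.2, (Nat.div_eq_of_lt_le (by omega) (by rw [add_mul]; omega)).symm⟩
  refine (Finset.card_le_card this).trans ((Finset.card_union_le _ _).trans ?_)
  have h1 := card_node_le k (w.b i / 2 ^ k) (w.b (i + 1))
  have h2 := card_node_le k (w.b (i + 1) / 2 ^ k) (w.b (i + 1))
  rw [pow_succ]
  omega

open Classical in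
theorem dep_eq_card (r : ℕ) :
    w.dep r = ((Finset.Ioc 0 w.L).filter fun k => ¬ w.Mono k r).card := by
  have : (Finset.Ioc 0 w.L).filter (fun k => ¬ w.Mono k r) = Finset.Ioc (w.kmono r) w.L := by
    ext k
    simp only [Finset.mem_filter, Finset.mem_Ioc]
    constructor
    · rintro ⟨⟨_, h2⟩, h3⟩; exact ⟨w.kmono_lt h3, h2⟩
    · rintro ⟨h1, h2⟩
      exact ⟨⟨by omega, h2⟩, fun h => by have := w.le_kmono h2 h; omega⟩
  rw [this, Nat.card_Ioc, dep]

/-- The ranks of a run of length `l` have depth `L - log l + O(1)` on average. -/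
theorem sum_dep_run_le (hb : Monotone w.b) (i : ℕ) (hi : w.b (i + 1) ≤ 2 ^ w.L) :
    ∑ r ∈ Finset.Ico (w.b i) (w.b (i + 1)), w.dep r ≤
      (w.b (i + 1) - w.b i) * (w.L - Nat.log 2 (w.b (i + 1) - w.b i) + 4) := by
  classical
  set l := w.b (i + 1) - w.b i with hl
  rcases Nat.eq_zero_or_pos l with h0 | hpos
  · have : Finset.Ico (w.b i) (w.b (i + 1)) = ∅ := Finset.Ico_eq_empty (by omega)
    simp [this]
  have hswap : ∑ r ∈ Finset.Ico (w.b i) (w.b (i + 1)), w.dep r =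
      ∑ k ∈ Finset.Ioc 0 w.L,
        ((Finset.Ico (w.b i) (w.b (i + 1))).filter fun r => ¬ w.Mono k r).card := by
    simp only [dep_eq_card, Finset.card_filter]
    rw [Finset.sum_comm]
  have hlog : Nat.log 2 l ≤ w.L :=
    (Nat.log_mono_right (show l ≤ 2 ^ w.L by omega)).trans (by rw [Nat.log_pow (by norm_num)])
  have hsplit : Finset.Ioc 0 w.L = Finset.Ioc 0 (Nat.log 2 l) ∪ Finset.Ioc (Nat.log 2 l) w.L :=
    (Finset.Ioc_union_Ioc_eq_Ioc (Nat.zero_le _) hlog).symm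
  have hgeom : ∀ t : ℕ, ∑ k ∈ Finset.Ioc 0 t, 2 ^ (k + 1) ≤ 4 * 2 ^ t := by
    intro t
    induction t with
    | zero => simp
    | succ t ih =>
      have : Finset.Ioc 0 (t + 1) = insert (t + 1) (Finset.Ioc 0 t) := by
        ext; simp; omega
      rw [this, Finset.sum_insert (by simp)]
      rw [pow_succ 2 (t + 1), pow_succ 2 t]
      omega
  rw [hswap, hsplit, Finset.sum_union (by
    rw [Finset.disjoint_left]; intro x; simp only [Finset.mem_Ioc]; omega)]
  have h1 : ∑ k ∈ Finset.Ioc 0 (Nat.log 2 l),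
      ((Finset.Ico (w.b i) (w.b (i + 1))).filter fun r => ¬ w.Mono k r).card ≤ 4 * l :=
    (Finset.sum_le_sum fun k _ => w.card_not_mono_run_le hb k i).trans
      ((hgeom _).trans (Nat.mul_le_mul_left _ (Nat.pow_log_le_self 2 (by omega))))
  have h2 : ∑ k ∈ Finset.Ioc (Nat.log 2 l) w.L,
      ((Finset.Ico (w.b i) (w.b (i + 1))).filter fun r => ¬ w.Mono k r).card ≤
      (w.L - Nat.log 2 l) * l := by
    refine (Finset.sum_le_card_nsmul _ _ l fun k _ => ?_).trans (by simp)
    exact (Finset.card_filter_le _ _).trans (by simp [hl])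
  calc _ ≤ 4 * l + (w.L - Nat.log 2 l) * l := Nat.add_le_add h1 h2
    _ = _ := by ring

/-- The number of pieces, counted by giving each rank its share of the piece it lies in. -/
theorem sum_half_pow_kmono_le :
    ∑ r ∈ Finset.range (2 ^ w.L), (1 / 2 : ℝ) ^ w.kmono r ≤ 2 * (w.m + 1) * w.L + 1 := by
  classical
  have h1 : ∀ r, (1 / 2 : ℝ) ^ w.kmono r ≤
      (∑ k ∈ Finset.Ioc 0 w.L, if ¬ w.Mono k r then (1 / 2 : ℝ) ^ (k - 1) else 0) +
        (1 / 2) ^ w.L := by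
    intro r
    rcases (w.kmono_le r).lt_or_eq with h | h
    · have h2 : ¬ w.Mono (w.kmono r + 1) r := fun h3 => by
        have := w.le_kmono (by omega) h3; omega
      have := Finset.single_le_sum (f := fun k => if ¬ w.Mono k r then (1 / 2 : ℝ) ^ (k - 1) else 0)
        (s := Finset.Ioc 0 w.L) (a := w.kmono r + 1)
        (fun k _ => by split_ifs <;> positivity) (by simp; omega)
      simp only [h2, not_false_eq_true, if_true, Nat.add_sub_cancel] at this
      have h5 : (0 : ℝ) ≤ (1 / 2) ^ w.L := by positivity
      linarith
    · rw [h]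
      have : (0 : ℝ) ≤ ∑ k ∈ Finset.Ioc 0 w.L, if ¬ w.Mono k r then (1 / 2 : ℝ) ^ (k - 1) else 0 :=
        Finset.sum_nonneg fun k _ => by split_ifs <;> positivity
      linarith
  refine (Finset.sum_le_sum fun r _ => h1 r).trans ?_
  rw [Finset.sum_add_distrib, Finset.sum_comm]
  have h2 : ∀ k ∈ Finset.Ioc 0 w.L, ∑ r ∈ Finset.range (2 ^ w.L),
      (if ¬ w.Mono k r then (1 / 2 : ℝ) ^ (k - 1) else 0) ≤ 2 * (w.m + 1) := by
    intro k hk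
    rw [← Finset.sum_filter, Finset.sum_const, nsmul_eq_mul]
    have h3 : (((Finset.range (2 ^ w.L)).filter fun r => ¬ w.Mono k r).card : ℝ) ≤
        (w.m + 1) * 2 ^ k := by exact_mod_cast w.card_not_mono_le k (2 ^ w.L)
    obtain ⟨k', rfl⟩ : ∃ k', k = k' + 1 := ⟨k - 1, by simp at hk; omega⟩
    calc _ ≤ (w.m + 1) * 2 ^ (k' + 1) * (1 / 2 : ℝ) ^ (k' + 1 - 1) := by gcongr
      _ = 2 * (w.m + 1) := by
        rw [Nat.add_sub_cancel, pow_succ, one_div, inv_pow]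
        field_simp
  refine (add_le_add (Finset.sum_le_sum h2) le_rfl).trans ?_
  rw [Finset.sum_const, Finset.sum_const, Nat.card_Ioc, Finset.card_range, nsmul_eq_mul,
    nsmul_eq_mul]
  push_cast
  rw [← mul_pow]
  norm_num
  ring_nf
  rfl

end World

/-! ### Agreement of hash values -/

/-- Two hash values agree on a set of bit positions. -/
def Agree (P : Finset ℕ) (h h' : ℕ) : Prop := ∀ p ∈ P, h.testBit p = h'.testBit p

theorem div_two_pow_eq_iff {L t h h' : ℕ} (hh : h < 2 ^ L) (hh' : h' < 2 ^ L) :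
    h / 2 ^ t = h' / 2 ^ t ↔ ∀ p, t ≤ p → p < L → h.testBit p = h'.testBit p := by
  constructor
  · intro e p hp _
    obtain ⟨q, rfl⟩ := Nat.exists_eq_add_of_le hp
    rw [Nat.add_comm, ← Nat.testBit_div_two_pow, e, Nat.testBit_div_two_pow]
  · intro e
    apply Nat.eq_of_testBit_eq
    intro q
    rw [Nat.testBit_div_two_pow, Nat.testBit_div_two_pow]
    by_cases hq : q + t < L
    · exact e _ (by omega) hq
    · have h1 : 2 ^ L ≤ 2 ^ (q + t) := Nat.pow_le_pow_right (by norm_num) (by omega)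
      rw [Nat.testBit_lt_two_pow (by omega), Nat.testBit_lt_two_pow (by omega)]

/-- The positions of the bits from `t` upwards. -/
def topBits (L t : ℕ) : Finset ℕ := (Finset.range L).filter fun p => t ≤ p

theorem agree_topBits {L t h h' : ℕ} (hh : h < 2 ^ L) (hh' : h' < 2 ^ L) :
    Agree (topBits L t) h h' ↔ h / 2 ^ t = h' / 2 ^ t := by
  rw [div_two_pow_eq_iff hh hh']
  simp only [Agree, topBits, Finset.mem_filter, Finset.mem_range]
  exact ⟨fun h p h1 h2 => h p ⟨h2, h1⟩, fun h p hp => h p hp.2 hp.1⟩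

theorem card_topBits (L t : ℕ) : (topBits L t).card = L - t := by
  have : topBits L t = Finset.Ico t L := by
    ext p; simp [topBits, and_comm]
  rw [this, Nat.card_Ico]

/-- The position of the hash bit that level `d` contributes. Since two different numbers in
`[d, 2 d)` have different odd parts, the levels `d, d + 1, …, 2 d - 1` contribute the `d` lowest
bits, each once. -/
def freshBit (d : ℕ) : ℕ := ordCompl[2] d / 2

theorem freshBit_lt {d x : ℕ} (h2 : x < 2 * d) : freshBit x < d := by
  have : ordCompl[2] x ≤ x := Nat.div_le_self _ _
  rw [freshBit]
  omega

theorem freshBit_inj {d x y : ℕ} (hx : d ≤ x) (hx2 : x < 2 * d) (hy : d ≤ y) (hy2 : y < 2 * d)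
    (h : freshBit x = freshBit y) : x = y := by
  wlog hxy : x.factorization 2 ≤ y.factorization 2 generalizing x y
  · exact (this hy hy2 hx hx2 h.symm (by omega)).symm
  have h1 := Nat.ordProj_mul_ordCompl_eq_self x 2
  have h2 := Nat.ordProj_mul_ordCompl_eq_self y 2
  have o1 : ¬ 2 ∣ ordCompl[2] x := Nat.not_dvd_ordCompl Nat.prime_two (by omega)
  have o2 : ¬ 2 ∣ ordCompl[2] y := Nat.not_dvd_ordCompl Nat.prime_two (by omega)
  have e : ordCompl[2] x = ordCompl[2] y := by
    unfold freshBit at h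
    omega
  rw [← e] at h2
  obtain ⟨c, hc⟩ := Nat.exists_eq_add_of_le hxy
  rw [hc, pow_add] at h2
  have h3 : y = 2 ^ c * x := by
    rw [← h2]
    nth_rewrite 4 [← h1]
    ring
  rcases Nat.eq_zero_or_pos c with rfl | hc0
  · omega
  · have : 2 ^ 1 ≤ 2 ^ c := Nat.pow_le_pow_right (by norm_num) hc0
    nlinarith

/-- The bit positions that determine the answer from a node of depth `d` whose answer uses `e`
further levels. -/
def nodeBits (L d e : ℕ) : Finset ℕ :=
  topBits L d ∪ (Finset.range e).image fun k => freshBit (d + k)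

theorem card_nodeBits {L d e : ℕ} (he : e ≤ d) : (nodeBits L d e).card = L - d + e := by
  rw [nodeBits, Finset.card_union_of_disjoint, card_topBits, Finset.card_image_of_injOn,
    Finset.card_range]
  · intro x hx y hy h
    simp only [Finset.coe_range, Set.mem_Iio] at hx hy
    have := freshBit_inj (d := d) (by omega) (by omega) (by omega) (by omega) h
    omega
  · rw [Finset.disjoint_left]
    intro p hp hp'
    obtain ⟨k, hk, rfl⟩ := Finset.mem_image.1 hp'
    have h1 := (Finset.mem_filter.1 hp).2
    have := freshBit_lt (d := d) (x := d + k) (by simp at hk; omega)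
    omega

theorem nodeBits_subset {L d e : ℕ} (he : e ≤ d) (hd : d ≤ L) :
    nodeBits L d e ⊆ Finset.range L := by
  intro p hp
  rcases Finset.mem_union.1 hp with h | h
  · exact (Finset.mem_filter.1 h).1
  · obtain ⟨k, hk, rfl⟩ := Finset.mem_image.1 h
    have := freshBit_lt (d := d) (x := d + k) (by simp at hk; omega)
    simp only [Finset.mem_range]
    omega

theorem agree_nodeBits {L d e h h' : ℕ} (hh : h < 2 ^ L) (hh' : h' < 2 ^ L) :
    Agree (nodeBits L d e) h h' ↔ h / 2 ^ d = h' / 2 ^ d ∧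
      ∀ k < e, h.testBit (freshBit (d + k)) = h'.testBit (freshBit (d + k)) := by
  rw [← agree_topBits hh hh']
  constructor
  · intro H
    exact ⟨fun p hp => H p (Finset.mem_union_left _ hp), fun k hk => H _
      (Finset.mem_union_right _ (Finset.mem_image.2 ⟨k, by simpa using hk, rfl⟩))⟩
  · rintro ⟨h1, h2⟩ p hp
    rcases Finset.mem_union.1 hp with h | h
    · exact h1 p h
    · obtain ⟨k, hk, rfl⟩ := Finset.mem_image.1 h
      exact h2 k (by simpa using hk)

/-! ### Nodes of a level, sorted by hash value -/

namespace World

variable (w : World)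

/-- The hash values are different numbers below `2 ^ L`. -/
structure Valid : Prop where
  key_lt : ∀ r < 2 ^ w.L, w.key r < 2 ^ w.L
  key_inj : ∀ r < 2 ^ w.L, ∀ r' < 2 ^ w.L, w.key r = w.key r' → r = r'

/-- The node of level `d` that contains the rank `r`. Beyond level `L` the nodes are single
ranks, numbered with gaps. -/
def node (d r : ℕ) : ℕ := r * 2 ^ d / 2 ^ w.L

/-- The first rank of that node. -/
def nodeStart (d r : ℕ) : ℕ := w.node d r * 2 ^ w.L / 2 ^ d

/-- The ranks in that node. -/
def nodeSet (d r : ℕ) : Finset ℕ := (Finset.range (2 ^ w.L)).filter fun x => w.node d x = w.node d r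

/-- The number of ranks in the node of `r` whose hash value is less than that of `r`. -/
def idx (d r : ℕ) : ℕ := ((w.nodeSet d r).filter fun x => w.key x < w.key r).card

/-- The place of the rank `r` when each node of level `d` is sorted by hash value. -/
def slot (d r : ℕ) : ℕ := w.nodeStart d r + w.idx d r

theorem node_succ (d r : ℕ) : w.node (d + 1) r / 2 = w.node d r := by
  rw [node, node, pow_succ, ← mul_assoc, Nat.div_div_eq_div_mul, Nat.mul_div_mul_right _ _ two_pos]

theorem node_eq_div {d : ℕ} (hd : d ≤ w.L) (r : ℕ) : w.node d r = r / 2 ^ (w.L - d) := by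
  have : 2 ^ w.L = 2 ^ (w.L - d) * 2 ^ d := by rw [← pow_add]; congr 1; omega
  rw [node, this, Nat.mul_div_mul_right _ _ (Nat.two_pow_pos d)]

theorem nodeStart_eq {d : ℕ} (hd : d ≤ w.L) (r : ℕ) :
    w.nodeStart d r = r / 2 ^ (w.L - d) * 2 ^ (w.L - d) := by
  have : 2 ^ w.L = 2 ^ (w.L - d) * 2 ^ d := by rw [← pow_add]; congr 1; omega
  rw [nodeStart, w.node_eq_div hd, this, ← mul_assoc, Nat.mul_div_cancel _ (Nat.two_pow_pos d)]

theorem node_inj_of_le {d : ℕ} (hd : w.L ≤ d) {r r' : ℕ} (h : w.node d r = w.node d r') :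
    r = r' := by
  obtain ⟨c, rfl⟩ := Nat.exists_eq_add_of_le hd
  have e : ∀ x, w.node (w.L + c) x = x * 2 ^ c := fun x => by
    rw [node, pow_add, show x * (2 ^ w.L * 2 ^ c) = x * 2 ^ c * 2 ^ w.L by ring,
      Nat.mul_div_cancel _ (Nat.two_pow_pos _)]
  rw [e, e] at h
  exact Nat.eq_of_mul_eq_mul_right (Nat.two_pow_pos c) h

theorem nodeStart_of_le {d : ℕ} (hd : w.L ≤ d) (r : ℕ) : w.nodeStart d r = r := by
  obtain ⟨c, rfl⟩ := Nat.exists_eq_add_of_le hd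
  rw [nodeStart, node, pow_add, show r * (2 ^ w.L * 2 ^ c) = r * 2 ^ c * 2 ^ w.L by ring,
      Nat.mul_div_cancel _ (Nat.two_pow_pos _),
      show r * 2 ^ c * 2 ^ w.L = r * (2 ^ w.L * 2 ^ c) by ring,
      Nat.mul_div_cancel _ (by positivity)]

theorem mem_nodeSet_self {d r : ℕ} (hr : r < 2 ^ w.L) : r ∈ w.nodeSet d r := by
  simp [nodeSet, hr]

theorem nodeSet_congr {d r r' : ℕ} (h : w.node d r = w.node d r') :
    w.nodeSet d r = w.nodeSet d r' := by simp [nodeSet, h]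

theorem idx_lt_idx {d r r' : ℕ} (hr : r < 2 ^ w.L) (h : w.node d r = w.node d r')
    (hk : w.key r < w.key r') : w.idx d r < w.idx d r' := by
  rw [idx, idx, w.nodeSet_congr h]
  refine Finset.card_lt_card (Finset.ssubset_iff_of_subset ?_ |>.2 ⟨r, ?_, ?_⟩)
  · intro x hx
    rw [Finset.mem_filter] at hx ⊢
    exact ⟨hx.1, hx.2.trans hk⟩
  · rw [Finset.mem_filter]
    exact ⟨by rw [← w.nodeSet_congr h]; exact w.mem_nodeSet_self hr, hk⟩
  · simp

theorem card_nodeSet_le {d : ℕ} (hd : d ≤ w.L) (r : ℕ) :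
    (w.nodeSet d r).card ≤ 2 ^ (w.L - d) := by
  simp only [nodeSet, w.node_eq_div hd]
  exact card_node_le _ _ _

theorem idx_lt {d r : ℕ} (hd : d ≤ w.L) (hr : r < 2 ^ w.L) : w.idx d r < 2 ^ (w.L - d) := by
  refine lt_of_lt_of_le (Finset.card_lt_card ?_) (w.card_nodeSet_le hd r)
  refine Finset.ssubset_iff_of_subset (Finset.filter_subset _ _) |>.2
    ⟨r, w.mem_nodeSet_self hr, by simp⟩

theorem slot_of_le {d r : ℕ} (hd : w.L ≤ d) : w.slot d r = r := by
  rw [slot, w.nodeStart_of_le hd, idx, Nat.add_eq_left, Finset.card_eq_zero,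
    Finset.filter_eq_empty_iff]
  intro x hx
  have := w.node_inj_of_le hd (Finset.mem_filter.1 hx).2
  simp [this]

/-- The slots of a node are its ranks. -/
theorem node_slot {d r : ℕ} (hr : r < 2 ^ w.L) : w.node d (w.slot d r) = w.node d r := by
  rcases le_total w.L d with hd | hd
  · rw [w.slot_of_le hd]
  · rw [w.node_eq_div hd, w.node_eq_div hd, slot, w.nodeStart_eq hd]
    have := w.idx_lt hd hr
    exact Nat.div_eq_of_lt_le (by omega) (by rw [add_mul]; omega)

theorem slot_inj (hw : w.Valid) {d r r' : ℕ} (hr : r < 2 ^ w.L) (hr' : r' < 2 ^ w.L)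
    (h : w.slot d r = w.slot d r') : r = r' := by
  have h1 : w.node d r = w.node d r' := by rw [← w.node_slot hr, h, w.node_slot hr']
  have h2 : w.idx d r = w.idx d r' := by
    rw [slot, slot, nodeStart, nodeStart, h1] at h
    omega
  apply hw.key_inj r hr r' hr'
  rcases lt_trichotomy (w.key r) (w.key r') with h3 | h3 | h3
  · have := w.idx_lt_idx hr h1 h3; omega
  · exact h3
  · have := w.idx_lt_idx hr' h1.symm h3; omega

/-- The position, in the bitmap of a node of level `d`, of the one bit that stands for `r`: the
number of elements before `r` plus the number formed by the `L - d` highest bits of its hash value.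
The bitmap has two bits for each element of the node. -/
def gpos (d r : ℕ) : ℕ := w.key r / 2 ^ d + w.idx d r

theorem gpos_lt (hw : w.Valid) {d r : ℕ} (hd : d ≤ w.L) (hr : r < 2 ^ w.L) :
    w.gpos d r < 2 * 2 ^ (w.L - d) := by
  have h1 := w.idx_lt hd hr
  have h2 : w.key r / 2 ^ d < 2 ^ (w.L - d) := by
    rw [Nat.div_lt_iff_lt_mul (Nat.two_pow_pos d), ← pow_add, Nat.sub_add_cancel hd]
    exact hw.key_lt r hr
  rw [gpos]
  omega

theorem gpos_lt_gpos {d r r' : ℕ} (hr : r < 2 ^ w.L) (h : w.node d r = w.node d r')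
    (hk : w.key r < w.key r') : w.gpos d r < w.gpos d r' := by
  have := w.idx_lt_idx hr h hk
  have : w.key r / 2 ^ d ≤ w.key r' / 2 ^ d := Nat.div_le_div_right hk.le
  rw [gpos, gpos]
  omega

theorem gpos_lt_iff (hw : w.Valid) {d r r' : ℕ} (hr : r < 2 ^ w.L) (hr' : r' < 2 ^ w.L)
    (h : w.node d r = w.node d r') : w.gpos d r < w.gpos d r' ↔ w.key r < w.key r' := by
  constructor
  · intro h1
    rcases lt_trichotomy (w.key r) (w.key r') with h3 | h3 | h3
    · exact h3
    · rw [hw.key_inj r hr r' hr' h3] at h1; omega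
    · have := w.gpos_lt_gpos hr' h.symm h3; omega
  · exact w.gpos_lt_gpos hr h

theorem gpos_inj (hw : w.Valid) {d r r' : ℕ} (hr : r < 2 ^ w.L) (hr' : r' < 2 ^ w.L)
    (h : w.node d r = w.node d r') (hg : w.gpos d r = w.gpos d r') : r = r' := by
  apply hw.key_inj r hr r' hr'
  rcases lt_trichotomy (w.key r) (w.key r') with h3 | h3 | h3
  · have := w.gpos_lt_gpos hr h h3; omega
  · exact h3
  · have := w.gpos_lt_gpos hr' h.symm h3; omega

end World

/-! ### Self-delimiting codes of pieces -/

/-- Accuracy `j` records a piece of depth `D` unless the accuracy `j - 1` already was exact. -/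
def Included (j D : ℕ) : Prop := j = 0 ∨ 2 ^ j < 2 * D

instance (j D : ℕ) : Decidable (Included j D) := by unfold Included; infer_instance

/-- The number of hash bits recorded at accuracy `j`, beyond those that give the cell. -/
def lowLen (j D : ℕ) : ℕ := min (2 ^ j) D

/-- The `e` lowest bits of `v`, the most significant one first. -/
def msbBits : ℕ → ℕ → List Bool
  | 0, _ => []
  | e + 1, v => v.testBit e :: msbBits e v

@[simp] theorem length_msbBits (e v : ℕ) : (msbBits e v).length = e := by
  induction e with
  | zero => rfl
  | succ e ih => simp [msbBits, ih]

/-- The code of an element of a cell: its low hash bits between two marks. -/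
def elemCode (e v : ℕ) : List Bool := true :: (msbBits e v ++ [true])

/-- The code of a cell, the elements of which have the numbers in the list as low hash bits. -/
def cellCode (e : ℕ) (vs : List ℕ) : List Bool := vs.flatMap (elemCode e) ++ [false]

namespace World

variable (w : World)

/-- The low hash bits of the elements in cell `q` of the piece of size `2 ^ k` that starts at `r`;
the cell of an element is given by its `k` highest hash bits. -/
def cellVals (r k e q : ℕ) : List ℕ :=
  ((List.range' r (2 ^ k)).filter fun x => w.key x / 2 ^ (w.L - k) = q).map
    fun x => w.key x / 2 ^ (w.L - k - e)

open Classical in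
/-- The code at accuracy `j` of the piece that starts at `r`, empty if no piece starts there: the
size in unary, and the cells, if the piece is included at this accuracy. -/
noncomputable def pieceCode (g j r : ℕ) : List Bool :=
  if w.IsStart g r then
    List.replicate (w.kap g r) true ++ false ::
      if Included j (w.L - w.kap g r) then
        (List.range (2 ^ w.kap g r)).flatMap fun q =>
          cellCode (lowLen j (w.L - w.kap g r))
            (w.cellVals r (w.kap g r) (lowLen j (w.L - w.kap g r)) q)
      else []
  else []

end World

theorem sum_length_filter_le (xs : List ℕ) (f : ℕ → ℕ) (c : ℕ) :
    ((List.range c).map fun q => (xs.filter fun x => f x = q).length).sum ≤ xs.length := by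
  induction xs with
  | nil => simp
  | cons x xs ih =>
    have h : ∀ c, ((List.range c).map fun q => ((x :: xs).filter fun x => f x = q).length).sum =
        ((List.range c).map fun q => (xs.filter fun x => f x = q).length).sum +
          if f x < c then 1 else 0 := by
      intro c
      induction c with
      | zero => simp
      | succ c ihc =>
        rw [List.range_succ, List.map_append, List.map_append, List.sum_append, List.sum_append,
          ihc]
        simp only [List.map_cons, List.map_nil, List.sum_cons, List.sum_nil, add_zero,
          List.filter_cons]
        by_cases h1 : f x = c
        · simp [h1]; omega
        · by_cases h2 : f x < c
          · simp [h1, h2, show f x < c + 1 by omega]; omega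
          · simp [h1, h2, show ¬ f x < c + 1 by omega]
    rw [h]
    split_ifs <;> simp <;> omega

theorem length_cellCode (e : ℕ) (vs : List ℕ) :
    (cellCode e vs).length = vs.length * (e + 2) + 1 := by
  simp [cellCode, List.length_flatMap, elemCode]

namespace World

variable (w : World)

theorem length_cells_le (r k e : ℕ) :
    ((List.range (2 ^ k)).flatMap fun q => cellCode e (w.cellVals r k e q)).length ≤
      2 ^ k * (e + 3) := by
  have h := sum_length_filter_le (List.range' r (2 ^ k)) (fun x => w.key x / 2 ^ (w.L - k)) (2 ^ k)
  rw [List.length_range'] at h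
  have e1 : ∀ (l : List ℕ) (f : ℕ → ℕ), (l.map fun q => f q * (e + 2) + 1).sum =
      (l.map f).sum * (e + 2) + l.length := by
    intro l f
    induction l with
    | nil => simp
    | cons a l ih => simp [ih]; ring
  simp only [List.length_flatMap, length_cellCode, cellVals, List.length_map]
  rw [e1, List.length_range]
  nlinarith

theorem length_pieceCode_le (g j r : ℕ) :
    (w.pieceCode g j r).length ≤ (w.kap g r + 1) +
      if Included j (w.L - w.kap g r) then
        2 ^ w.kap g r * (lowLen j (w.L - w.kap g r) + 3) else 0 := by
  rw [pieceCode]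
  split_ifs with h1 h2
  · have := w.length_cells_le r (w.kap g r) (lowLen j (w.L - w.kap g r))
    simp only [List.length_append, List.length_replicate, List.length_cons]
    omega
  · simp
  · simp
  · simp

end World

/-! ### Decoding -/

/-- The state of the decoder of piece codes: reading the size of the next piece (`mode = 0`),
between two elements (`mode = 1`) or inside an element (`mode = 2`). The other components are the
rank at which the current piece starts, the exponent of its size, the current cell, and the number
and the value of the low bits read so far. -/
@[ext] structure Decoder where
  mode : ℕ
  rk : ℕ
  kp : ℕ
  q : ℕ
  got : ℕ
  acc : ℕ

namespace Decoder

/-- The decoder at the start of a piece. -/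
def atStart (r : ℕ) : Decoder := ⟨0, r, 0, 0, 0, 0⟩

/-- The scan ends when a piece starts at rank `r₁`, or later. -/
def AtEnd (r₁ : ℕ) (s : Decoder) : Prop := s.mode = 0 ∧ r₁ ≤ s.rk

instance (r₁ : ℕ) (s : Decoder) : Decidable (AtEnd r₁ s) := by unfold AtEnd; infer_instance

variable {n : ℕ} (hash : Fin n → ℕ) (L j jj : ℕ)

/-- The positions that agree with the element that has just been decoded. They are generated only
at the top accuracy `jj`, or if accuracy `j` is exact. -/
def emit (s : Decoder) : Finset (Fin n) :=
  if j = jj ∨ L - s.kp ≤ 2 ^ j then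
    Finset.univ.filter fun i => hash i / 2 ^ (L - s.kp - lowLen j (L - s.kp)) =
      s.q * 2 ^ lowLen j (L - s.kp) + s.acc
  else ∅

/-- The start of the next piece. The minimum only serves to keep the state bounded on arbitrary
input. -/
def nextPiece (s : Decoder) : Decoder := atStart (min (s.rk + 2 ^ s.kp) (2 ^ L))

/-- One step of the decoder. -/
def step (s : Decoder) (bit : Bool) : Decoder × Finset (Fin n) :=
  if s.mode = 0 then
    if bit then ({ s with kp := min (s.kp + 1) L }, ∅)
    else if Included j (L - s.kp) then (⟨1, s.rk, s.kp, 0, 0, 0⟩, ∅)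
    else (s.nextPiece L, ∅)
  else if s.mode = 1 then
    if bit then (⟨2, s.rk, s.kp, s.q, 0, 0⟩, ∅)
    else if s.q + 1 < 2 ^ s.kp then (⟨1, s.rk, s.kp, s.q + 1, 0, 0⟩, ∅)
    else (s.nextPiece L, ∅)
  else if s.got < lowLen j (L - s.kp) then
    ({ s with got := s.got + 1, acc := 2 * s.acc + bit.toNat }, ∅)
  else (⟨1, s.rk, s.kp, s.q, 0, 0⟩, s.emit hash L j jj)

/-- A bound on the state that no input can violate. -/
def Bounded (s : Decoder) : Prop :=
  s.mode ≤ 2 ∧ s.rk ≤ 2 ^ L ∧ s.kp ≤ L ∧ s.q < 2 ^ s.kp ∧ s.got ≤ L ∧ s.acc < 2 ^ s.got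

theorem bounded_step {s : Decoder} (h : s.Bounded L) (bit : Bool) :
    (step hash L j jj s bit).1.Bounded L := by
  obtain ⟨h1, h2, h3, h4, h5, h6⟩ := h
  have hl : lowLen j (L - s.kp) ≤ L := (min_le_right _ _).trans (Nat.sub_le _ _)
  unfold step
  split_ifs with a1 a2 a3 b1 b2 b3 c1
  · refine ⟨h1, h2, min_le_right _ _, lt_of_lt_of_le h4 ?_, h5, h6⟩
    exact Nat.pow_le_pow_right (by norm_num) (le_min (by omega) h3)
  · exact ⟨by norm_num, h2, h3, Nat.two_pow_pos _, by simp, by simp⟩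
  · exact ⟨by simp [nextPiece, atStart], min_le_right _ _, by simp [nextPiece, atStart],
      by simp [nextPiece, atStart], by simp [nextPiece, atStart], by simp [nextPiece, atStart]⟩
  · exact ⟨by norm_num, h2, h3, h4, by simp, by simp⟩
  · exact ⟨by norm_num, h2, h3, b3, by simp, by simp⟩
  · exact ⟨by simp [nextPiece, atStart], min_le_right _ _, by simp [nextPiece, atStart],
      by simp [nextPiece, atStart], by simp [nextPiece, atStart], by simp [nextPiece, atStart]⟩
  · refine ⟨h1, h2, h3, h4, show s.got + 1 ≤ L by omega, ?_⟩
    have : bit.toNat ≤ 1 := Bool.toNat_le bit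
    show 2 * s.acc + bit.toNat < 2 ^ (s.got + 1)
    rw [pow_succ]; omega
  · exact ⟨by norm_num, h2, h3, h4, by simp, by simp⟩

/-- The decoder goes from one state to another by reading a list of bits, does not come to the end
`r₁` of the scan before the last bit, and generates a set on the way. -/
inductive Path (r₁ : ℕ) : Decoder → List Bool → Finset (Fin n) → Decoder → Prop
  | nil (s : Decoder) : Path r₁ s [] ∅ s
  | cons {s s' : Decoder} {bit : Bool} {l : List Bool} {E : Finset (Fin n)} (h : ¬ AtEnd r₁ s)
      (h' : Path r₁ (step hash L j jj s bit).1 l E s') :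
      Path r₁ s (bit :: l) ((step hash L j jj s bit).2 ∪ E) s'

variable {hash L j jj} {r₁ : ℕ}

theorem Path.trans {s s' s'' : Decoder} {l l' : List Bool} {E E' : Finset (Fin n)}
    (h : Path hash L j jj r₁ s l E s') (h' : Path hash L j jj r₁ s' l' E' s'') :
    Path hash L j jj r₁ s (l ++ l') (E ∪ E') s'' := by
  induction h with
  | nil => simpa using h'
  | cons h1 _ ih => rw [Finset.union_assoc]; exact .cons h1 (ih h')

theorem Path.step_empty {s s' s'' : Decoder} {bit : Bool} {l : List Bool} {E : Finset (Fin n)}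
    (h : ¬ AtEnd r₁ s) (hs : step hash L j jj s bit = (s', ∅))
    (h' : Path hash L j jj r₁ s' l E s'') : Path hash L j jj r₁ s (bit :: l) E s'' := by
  rw [← Finset.empty_union E]
  have := Path.cons (hash := hash) (L := L) (j := j) (jj := jj) (bit := bit) h
    (by rw [hs]; exact h')
  rwa [hs] at this

theorem path_header {r k : ℕ} (hr : r < r₁) (c : ℕ) (hk : k + c ≤ L) :
    Path hash L j jj r₁ ⟨0, r, k, 0, 0, 0⟩ (List.replicate c true) ∅ ⟨0, r, k + c, 0, 0, 0⟩ := by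
  induction c generalizing k with
  | zero => exact .nil _
  | succ c ih =>
    rw [List.replicate_succ]
    refine .step_empty (s' := ⟨0, r, k + 1, 0, 0, 0⟩) (by simp [AtEnd, hr]) ?_ ?_
    · simp [step, show k + 1 ≤ L by omega]
    · have := ih (k := k + 1) (by omega)
      rwa [show k + 1 + c = k + (c + 1) by ring] at this

theorem mod_two_pow_succ' (v e : ℕ) : v % 2 ^ (e + 1) = 2 ^ e * (v.testBit e).toNat + v % 2 ^ e := by
  rw [pow_succ, Nat.mod_mul, ← Nat.toNat_testBit, add_comm]

theorem path_msb {r k q : ℕ} (v e got acc : ℕ) (he : got + e = lowLen j (L - k)) :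
    Path hash L j jj r₁ ⟨2, r, k, q, got, acc⟩ (msbBits e v) ∅
      ⟨2, r, k, q, got + e, acc * 2 ^ e + v % 2 ^ e⟩ := by
  induction e generalizing got acc with
  | zero => simpa [msbBits, Nat.mod_one] using Path.nil _
  | succ e ih =>
    refine .step_empty (s' := ⟨2, r, k, q, got + 1, 2 * acc + (v.testBit e).toNat⟩)
      (by simp [AtEnd]) ?_ ?_
    · simp [step, show got < lowLen j (L - k) by omega]
    · have := ih (got + 1) (2 * acc + (v.testBit e).toNat) (by omega)
      rw [show got + 1 + e = got + (e + 1) by ring] at this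
      rw [mod_two_pow_succ']
      rwa [show acc * 2 ^ (e + 1) + (2 ^ e * (v.testBit e).toNat + v % 2 ^ e) =
        (2 * acc + (v.testBit e).toNat) * 2 ^ e + v % 2 ^ e by ring]

theorem path_elem {r k q : ℕ} (v : ℕ) :
    Path hash L j jj r₁ ⟨1, r, k, q, 0, 0⟩ (elemCode (lowLen j (L - k)) v)
      (emit hash L j jj ⟨2, r, k, q, lowLen j (L - k), v % 2 ^ lowLen j (L - k)⟩)
      ⟨1, r, k, q, 0, 0⟩ := by
  refine .step_empty (s' := ⟨2, r, k, q, 0, 0⟩) (by simp [AtEnd]) (by simp [step]) ?_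
  rw [← Finset.empty_union (emit _ _ _ _ _)]
  refine (path_msb v (lowLen j (L - k)) 0 0 (by simp)).trans ?_
  rw [← Finset.union_empty (emit _ _ _ _ _)]
  have e : step hash L j jj ⟨2, r, k, q, 0 + lowLen j (L - k), 0 * 2 ^ lowLen j (L - k) +
      v % 2 ^ lowLen j (L - k)⟩ true = (⟨1, r, k, q, 0, 0⟩,
      emit hash L j jj ⟨2, r, k, q, lowLen j (L - k), v % 2 ^ lowLen j (L - k)⟩) := by
    simp [step]
  have := Path.cons (hash := hash) (L := L) (j := j) (jj := jj) (r₁ := r₁) (bit := true) (l := [])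
    (E := ∅) (s := ⟨2, r, k, q, 0 + lowLen j (L - k), 0 * 2 ^ lowLen j (L - k) +
      v % 2 ^ lowLen j (L - k)⟩) (s' := ⟨1, r, k, q, 0, 0⟩) (by simp [AtEnd])
      (by rw [e]; exact .nil _)
  rwa [e] at this

theorem path_elems {r k q : ℕ} (vs : List ℕ) :
    ∃ E : Finset (Fin n), Path hash L j jj r₁ ⟨1, r, k, q, 0, 0⟩
      (vs.flatMap (elemCode (lowLen j (L - k)))) E ⟨1, r, k, q, 0, 0⟩ ∧
      ∀ i, i ∈ E ↔ (j = jj ∨ L - k ≤ 2 ^ j) ∧ ∃ v ∈ vs,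
        hash i / 2 ^ (L - k - lowLen j (L - k)) =
          q * 2 ^ lowLen j (L - k) + v % 2 ^ lowLen j (L - k) := by
  induction vs with
  | nil => exact ⟨∅, .nil _, by simp⟩
  | cons v vs ih =>
    obtain ⟨E, h1, h2⟩ := ih
    refine ⟨_, (path_elem v).trans h1, fun i => ?_⟩
    rw [Finset.mem_union, h2, emit]
    by_cases h : j = jj ∨ L - k ≤ 2 ^ j
    · rw [if_pos h]
      simp only [Finset.mem_filter, Finset.mem_univ, true_and, h, List.mem_cons, exists_eq_or_imp]
    · rw [if_neg h]
      simp only [Finset.notMem_empty, h, false_and, or_self]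

theorem path_cells {r k : ℕ} (vals : ℕ → List ℕ) (c q : ℕ) (hq : q + c = 2 ^ k) (hc : 0 < c) :
    ∃ E : Finset (Fin n), Path hash L j jj r₁ ⟨1, r, k, q, 0, 0⟩
      ((List.range' q c).flatMap fun q => cellCode (lowLen j (L - k)) (vals q)) E
      (atStart (min (r + 2 ^ k) (2 ^ L))) ∧
      ∀ i, i ∈ E ↔ (j = jj ∨ L - k ≤ 2 ^ j) ∧ ∃ q', q ≤ q' ∧ q' < 2 ^ k ∧ ∃ v ∈ vals q',
        hash i / 2 ^ (L - k - lowLen j (L - k)) =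
          q' * 2 ^ lowLen j (L - k) + v % 2 ^ lowLen j (L - k) := by
  induction c generalizing q with
  | zero => omega
  | succ c ih =>
    obtain ⟨E₁, h1, h2⟩ := path_elems (hash := hash) (L := L) (j := j) (jj := jj) (r₁ := r₁)
      (r := r) (k := k) (q := q) (vals q)
    rw [List.range'_succ, List.flatMap_cons]
    rcases Nat.eq_zero_or_pos c with rfl | hc'
    · refine ⟨E₁ ∪ ∅, ?_, fun i => ?_⟩
      · simp only [List.range'_zero, List.flatMap_nil, List.append_nil]
        refine h1.trans (.step_empty (by simp [AtEnd]) ?_ (.nil _))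
        simp [step, nextPiece, hq]
      · rw [Finset.union_empty, h2]
        refine and_congr_right fun _ => ⟨fun ⟨v, hv⟩ => ⟨q, le_rfl, by omega, v, hv⟩, ?_⟩
        rintro ⟨q', h3, h4, v, hv⟩
        have : q' = q := by omega
        subst this
        exact ⟨v, hv⟩
    · obtain ⟨E₂, h3, h4⟩ := ih (q + 1) (by omega) hc'
      refine ⟨E₁ ∪ E₂, ?_, fun i => ?_⟩
      · rw [cellCode, List.append_assoc]
        refine h1.trans (.step_empty (by simp [AtEnd]) ?_ h3)
        simp [step, show q + 1 < 2 ^ k by omega]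
      · rw [Finset.mem_union, h2, h4, ← and_or_left]
        refine and_congr_right fun _ => ⟨?_, ?_⟩
        · rintro (⟨v, hv⟩ | ⟨q', h5, h6, hv⟩)
          · exact ⟨q, le_rfl, by omega, v, hv⟩
          · exact ⟨q', by omega, h6, hv⟩
        · rintro ⟨q', h5, h6, hv⟩
          rcases h5.eq_or_lt with rfl | h7
          · exact Or.inl hv
          · exact Or.inr ⟨q', h7, h6, hv⟩

end Decoder

namespace World

variable (w : World)

/-- The element of rank `r` is generated by a scan at accuracy `j` as part of a query with top
accuracy `jj`. -/
def Emits (g j jj r : ℕ) : Prop :=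
  Included j (w.L - w.kap g r) ∧ (j = jj ∨ w.L - w.kap g r ≤ 2 ^ j)

/-- The lowest hash bit of the element of rank `r` that is recorded at accuracy `j`. -/
noncomputable def cut (g j r : ℕ) : ℕ := w.L - w.kap g r - lowLen j (w.L - w.kap g r)

variable {w} {n : ℕ} {hash : Fin n → ℕ} {g j jj r₁ : ℕ}

theorem path_piece (hw : w.Valid) (hg : g ≤ w.L) {r : ℕ} (hs : w.IsStart g r)
    (hr : r + 2 ^ w.kap g r ≤ r₁) (hr₁ : r₁ ≤ 2 ^ w.L) :
    ∃ E : Finset (Fin n), Decoder.Path hash w.L j jj r₁ (.atStart r) (w.pieceCode g j r) E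
      (.atStart (r + 2 ^ w.kap g r)) ∧
      ∀ i, i ∈ E ↔ ∃ x, r ≤ x ∧ x < r + 2 ^ w.kap g r ∧ w.Emits g j jj x ∧
        hash i / 2 ^ w.cut g j x = w.key x / 2 ^ w.cut g j x := by
  have hpos := Nat.two_pow_pos (w.kap g r)
  have hkL := w.kap_le hg r
  set k := w.kap g r with hk
  have hx : ∀ x, r ≤ x → x < r + 2 ^ k → w.kap g x = k := fun x h1 h2 => w.kap_eq_of_mem hs h1 h2
  have hhead := Decoder.path_header (hash := hash) (L := w.L) (j := j) (jj := jj) (r₁ := r₁)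
    (r := r) (k := 0) (by omega) k (by omega)
  rw [zero_add] at hhead
  have hmin : min (r + 2 ^ k) (2 ^ w.L) = r + 2 ^ k := min_eq_left (by omega)
  by_cases hinc : Included j (w.L - k)
  · obtain ⟨E, h1, h2⟩ := Decoder.path_cells (hash := hash) (L := w.L) (j := j) (jj := jj)
      (r₁ := r₁) (r := r) (k := k) (w.cellVals r k (lowLen j (w.L - k))) (2 ^ k) 0 (by simp) hpos
    rw [hmin] at h1
    refine ⟨∅ ∪ E, ?_, fun i => ?_⟩
    · rw [pieceCode, if_pos hs, ← hk, if_pos hinc, List.range_eq_range']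
      refine hhead.trans (.step_empty ?_ ?_ h1)
      · simp [Decoder.AtEnd]; omega
      · simp [Decoder.step, hinc]
    · rw [Finset.empty_union, h2]
      set e := lowLen j (w.L - k) with he
      have heD : e ≤ w.L - k := min_le_right _ _
      have hkey : ∀ x, w.key x / 2 ^ (w.L - k) * 2 ^ e + w.key x / 2 ^ (w.L - k - e) % 2 ^ e =
          w.key x / 2 ^ (w.L - k - e) := by
        intro x
        have h3 : w.key x / 2 ^ (w.L - k) = w.key x / 2 ^ (w.L - k - e) / 2 ^ e := by
          rw [Nat.div_div_eq_div_mul, ← pow_add, Nat.sub_add_cancel heD]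
        rw [h3]
        exact Nat.div_add_mod' _ _
      constructor
      · rintro ⟨h3, q, -, -, v, hv, h4⟩
        simp only [cellVals, List.mem_map, List.mem_filter, List.mem_range'_1,
          decide_eq_true_eq] at hv
        obtain ⟨x, ⟨⟨h5, h6⟩, h7⟩, rfl⟩ := hv
        refine ⟨x, h5, h6, ?_, ?_⟩
        · rw [Emits, hx x h5 h6]; exact ⟨hinc, h3⟩
        · rw [cut, hx x h5 h6, ← he, h4, ← h7, hkey]
      · rintro ⟨x, h5, h6, h3, h4⟩
        rw [Emits, hx x h5 h6] at h3
        rw [cut, hx x h5 h6, ← he] at h4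
        refine ⟨h3.2, w.key x / 2 ^ (w.L - k), Nat.zero_le _, ?_, w.key x / 2 ^ (w.L - k - e), ?_,
          by rw [hkey]; exact h4⟩
        · rw [Nat.div_lt_iff_lt_mul (Nat.two_pow_pos _), ← pow_add, Nat.add_sub_cancel' hkL]
          exact hw.key_lt x (by omega)
        · simp only [cellVals, List.mem_map, List.mem_filter, List.mem_range'_1,
            decide_eq_true_eq]
          exact ⟨x, ⟨⟨h5, h6⟩, rfl⟩, rfl⟩
  · refine ⟨∅ ∪ ∅, ?_, fun i => ?_⟩
    · rw [pieceCode, if_pos hs, ← hk, if_neg hinc]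
      refine hhead.trans (.step_empty ?_ ?_ (.nil _))
      · simp [Decoder.AtEnd]; omega
      · simp [Decoder.step, hinc, Decoder.nextPiece, hmin]
    · simp only [Finset.union_empty, Finset.notMem_empty, false_iff, not_exists]
      rintro x ⟨h5, h6, h3, -⟩
      rw [Emits, hx x h5 h6] at h3
      exact hinc h3.1

theorem flatMap_range'_eq_nil (c : ℕ → List Bool) (r l : ℕ)
    (h : ∀ x, r ≤ x → x < r + l → c x = []) : (List.range' r l).flatMap c = [] := by
  rw [List.flatMap_eq_nil_iff]
  intro x hx
  rw [List.mem_range'_1] at hx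
  exact h x hx.1 hx.2

/-- The codes of a piece, and of the ranks inside it, at which no piece starts. -/
theorem flatMap_piece (r : ℕ) (hs : w.IsStart g r) :
    (List.range' r (2 ^ w.kap g r)).flatMap (w.pieceCode g j) = w.pieceCode g j r := by
  obtain ⟨c, hc⟩ : ∃ c, 2 ^ w.kap g r = c + 1 :=
    ⟨2 ^ w.kap g r - 1, by have := Nat.two_pow_pos (w.kap g r); omega⟩
  rw [hc, List.range'_succ, List.flatMap_cons, flatMap_range'_eq_nil, List.append_nil]
  intro x h1 h2
  rw [pieceCode, if_neg (w.not_isStart hs (by omega) (by omega))]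

/-- A scan from `r₀` to `r₁` generates what the elements of these ranks ask for. -/
theorem path_scan (hw : w.Valid) (hg : g ≤ w.L) (hr₁ : r₁ ≤ 2 ^ w.L) {r₀ : ℕ}
    (h0 : w.IsStart g r₀) (h : r₀ ≤ r₁)
    (hend : ∀ r, r₀ ≤ r → w.IsStart g r → r < r₁ → r + 2 ^ w.kap g r ≤ r₁) :
    ∃ E : Finset (Fin n), Decoder.Path hash w.L j jj r₁ (.atStart r₀)
      ((List.range' r₀ (r₁ - r₀)).flatMap (w.pieceCode g j)) E (.atStart r₁) ∧
      ∀ i, i ∈ E ↔ ∃ x, r₀ ≤ x ∧ x < r₁ ∧ w.Emits g j jj x ∧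
        hash i / 2 ^ w.cut g j x = w.key x / 2 ^ w.cut g j x := by
  obtain ⟨d, hd⟩ := Nat.exists_eq_add_of_le h
  induction d using Nat.strong_induction_on generalizing r₀ with
  | _ d ih =>
    rcases Nat.eq_zero_or_pos d with rfl | hpos
    · rw [add_zero] at hd
      subst hd
      refine ⟨∅, ?_, fun i => ?_⟩
      · simpa using Decoder.Path.nil _
      · simp; intros; omega
    · have h1 := hend r₀ le_rfl h0 (by omega)
      have h2 := Nat.two_pow_pos (w.kap g r₀)
      obtain ⟨E₁, h3, h4⟩ := path_piece (hash := hash) (j := j) (jj := jj) hw hg h0 h1 hr₁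
      obtain ⟨E₂, h5, h6⟩ := ih (d - 2 ^ w.kap g r₀) (by omega) (w.isStart_next h0) h1
        (fun r hr => hend r (by omega)) (by omega)
      refine ⟨E₁ ∪ E₂, ?_, fun i => ?_⟩
      · have e : List.range' r₀ (r₁ - r₀) = List.range' r₀ (2 ^ w.kap g r₀) ++
            List.range' (r₀ + 2 ^ w.kap g r₀) (r₁ - (r₀ + 2 ^ w.kap g r₀)) := by
          rw [List.range'_append_1]; congr 1; omega
        rw [e, List.flatMap_append, flatMap_piece r₀ h0]
        exact h3.trans h5
      · rw [Finset.mem_union, h4, h6]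
        constructor
        · rintro (⟨x, h7, h8, h9⟩ | ⟨x, h7, h8, h9⟩)
          · exact ⟨x, h7, by omega, h9⟩
          · exact ⟨x, by omega, h8, h9⟩
        · rintro ⟨x, h7, h8, h9⟩
          by_cases hx : x < r₀ + 2 ^ w.kap g r₀
          · exact Or.inl ⟨x, h7, hx, h9⟩
          · exact Or.inr ⟨x, by omega, h8, h9⟩

/-- The length of the codes between two ranks, when each piece is charged to its ranks. -/
theorem length_scan_le {r₀ : ℕ} (F : ℕ → ℕ)
    (hF : ∀ r, (w.pieceCode g j r).length ≤ 2 ^ w.kap g r * F (w.kap g r))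
    (h0 : w.IsStart g r₀) (h : r₀ ≤ r₁)
    (hend : ∀ r, r₀ ≤ r → w.IsStart g r → r < r₁ → r + 2 ^ w.kap g r ≤ r₁) :
    ((List.range' r₀ (r₁ - r₀)).flatMap (w.pieceCode g j)).length ≤
      ∑ x ∈ Finset.Ico r₀ r₁, F (w.kap g x) := by
  obtain ⟨d, hd⟩ := Nat.exists_eq_add_of_le h
  induction d using Nat.strong_induction_on generalizing r₀ with
  | _ d ih =>
    rcases Nat.eq_zero_or_pos d with rfl | hpos
    · rw [add_zero] at hd
      subst hd
      simp
    · have h1 := hend r₀ le_rfl h0 (by omega)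
      have h2 := Nat.two_pow_pos (w.kap g r₀)
      have h5 := ih (d - 2 ^ w.kap g r₀) (by omega) (w.isStart_next h0) h1
        (fun r hr => hend r (by omega)) (by omega)
      have e : List.range' r₀ (r₁ - r₀) = List.range' r₀ (2 ^ w.kap g r₀) ++
          List.range' (r₀ + 2 ^ w.kap g r₀) (r₁ - (r₀ + 2 ^ w.kap g r₀)) := by
        rw [List.range'_append_1]; congr 1; omega
      rw [e, List.flatMap_append, flatMap_piece r₀ h0, List.length_append,
        ← Finset.sum_Ico_consecutive _ (show r₀ ≤ r₀ + 2 ^ w.kap g r₀ by omega) h1]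
      refine Nat.add_le_add ((hF r₀).trans ?_) h5
      rw [Finset.sum_congr rfl (g := fun _ => F (w.kap g r₀))]
      · simp
      · intro x hx
        rw [Finset.mem_Ico] at hx
        rw [w.kap_eq_of_mem h0 hx.1 hx.2]

end World

/-! ### Scanning the disk -/

/-- The state within a task: not yet started; a scan that has come to a bit address, with the state
of its decoder; or a pass through a node that has come to a certain chunk, with one pointer into
each node below it. -/
inductive Inner
  | fresh
  | scan (addr : ℕ) (st : Decoder)
  | node (c : ℕ) (ptr : ℕ → ℕ)

/-- The states within a task for which there is room in memory: numbers have `W` bits, and there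
are `X` pointers. -/
def Inner.Good (L W X : ℕ) : Inner → Prop
  | .fresh => True
  | .scan addr st => addr < 2 ^ W ∧ st.Bounded L
  | .node c ptr => c < 2 ^ W ∧ ∀ x, ptr x < 2 ^ W ∧ (X ≤ x → ptr x = 0)

section Scan

variable {n B : ℕ} (hash : Fin n → ℕ) (L j jj r₁ : ℕ)

/-- Decode at most the given number of bits, but stop at the end of the scan. -/
def decodeBits (bit : ℕ → Bool) : ℕ → ℕ → Decoder → Decoder × Finset (Fin n)
  | 0, _, s => (s, ∅)
  | f + 1, a, s =>
    if s.AtEnd r₁ then (s, ∅)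
    else ((decodeBits bit f (a + 1) (s.step hash L j jj (bit a)).1).1,
      (s.step hash L j jj (bit a)).2 ∪ (decodeBits bit f (a + 1) (s.step hash L j jj (bit a)).1).2)

/-- One round of a scan: decode the rest of the current block. The scan starts at rank `r₀`, and
its address on the disk is the number with index `fld` in the table. -/
noncomputable def scanStep (W fld r₀ : ℕ) : Inner → Tree B (Finset (Fin n) × Option Inner)
  | .fresh => (readNum B W fld).bind fun a => .ret (∅, some (.scan a (.atStart r₀)))
  | .scan a s => .read (a / B) fun blk =>
      .ret ((decodeBits hash L j jj r₁ (bitOf blk) (B - a % B) (a % B) s).2,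
        if (decodeBits hash L j jj r₁ (bitOf blk) (B - a % B) (a % B) s).1.AtEnd r₁ then none
        else some (.scan ((a / B + 1) * B)
          (decodeBits hash L j jj r₁ (bitOf blk) (B - a % B) (a % B) s).1))
  | .node _ _ => .ret (∅, none)

variable {hash L j jj r₁}

theorem decodeBits_of_atEnd {bit : ℕ → Bool} {s : Decoder} (h : s.AtEnd r₁) (f a : ℕ) :
    decodeBits hash L j jj r₁ bit f a s = (s, ∅) := by
  cases f <;> simp [decodeBits, h]

theorem decodeBits_end {bit : ℕ → Bool} {s s' : Decoder} {l : List Bool} {E : Finset (Fin n)}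
    (h : Decoder.Path hash L j jj r₁ s l E s') (hs' : s'.AtEnd r₁) {f a : ℕ} (hf : l.length ≤ f)
    (hbit : ∀ i, (hi : i < l.length) → bit (a + i) = l[i]) :
    decodeBits hash L j jj r₁ bit f a s = (s', E) := by
  induction h generalizing f a with
  | nil s => exact decodeBits_of_atEnd hs' _ _
  | @cons s s' b l E h1 h2 ih =>
    obtain ⟨f, rfl⟩ : ∃ f', f = f' + 1 := ⟨f - 1, by simp at hf; omega⟩
    have h3 : bit a = b := hbit 0 (by simp)
    rw [decodeBits, if_neg h1, h3, ih hs' (by simpa using hf)]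
    intro i hi
    have := hbit (i + 1) (by simpa using hi)
    rw [show a + 1 + i = a + (i + 1) by ring, this]
    simp

theorem decodeBits_part {bit : ℕ → Bool} {s s' : Decoder} {l : List Bool} {E : Finset (Fin n)}
    (h : Decoder.Path hash L j jj r₁ s l E s') {f a : ℕ} (hf : f < l.length)
    (hbit : ∀ i, (hi : i < l.length) → bit (a + i) = l[i] ∨ f ≤ i) (hs : s.Bounded L) :
    ∃ (t : Decoder) (E₁ E₂ : Finset (Fin n)), decodeBits hash L j jj r₁ bit f a s = (t, E₁) ∧
      E = E₁ ∪ E₂ ∧ ¬ t.AtEnd r₁ ∧ t.Bounded L ∧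
      Decoder.Path hash L j jj r₁ t (l.drop f) E₂ s' := by
  induction h generalizing f a with
  | nil s => simp at hf
  | @cons s s' b l E h1 h2 ih =>
    rcases f with _ | f
    · exact ⟨s, ∅, _, rfl, (Finset.empty_union _).symm, h1, hs, .cons h1 h2⟩
    · have h3 : bit a = b := (hbit 0 (by simp)).resolve_right (by omega)
      obtain ⟨t, E₁, E₂, h4, h5, h6, h7, h8⟩ := ih (f := f) (a := a + 1) (by simpa using hf) (by
        intro i hi
        have := hbit (i + 1) (by simpa using hi)
        rw [show a + 1 + i = a + (i + 1) by ring]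
        simpa using this) (Decoder.bounded_step _ _ _ _ hs _)
      refine ⟨t, (Decoder.step hash L j jj s b).2 ∪ E₁, E₂, ?_, ?_, h6, h7, by simpa using h8⟩
      · rw [decodeBits, if_neg h1, h3, h4]
      · rw [h5, Finset.union_assoc]

/-- A scan over a list of bits on the disk. -/
theorem taskRun_scan {D : Disk B} {T₀ W X fld r₀ : ℕ} (hB : 0 < B) (hT₀ : 1 ≤ T₀)
    {s s' : Decoder} {l : List Bool} {E : Finset (Fin n)} {a : ℕ}
    (h : Decoder.Path hash L j jj r₁ s l E s') (hs' : s'.AtEnd r₁) (hs : s.Bounded L)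
    (hbit : ∀ i, (hi : i < l.length) → diskBit D (a + i) = l[i]) (ha : a + l.length < 2 ^ W) :
    TaskRun (scanStep hash L j jj r₁ W fld r₀) (Inner.Good L W X) T₀ D (.scan a s) E
      (2 * ((a % B + l.length) / B + 1)) := by
  induction hlen : l.length using Nat.strong_induction_on generalizing s l E a with
  | _ len ih =>
    subst hlen
    obtain ⟨u, hu⟩ : ∃ u, a % B = u := ⟨_, rfl⟩
    obtain ⟨f, hfu⟩ : ∃ f, B - u = f := ⟨_, rfl⟩
    have hmod : u < B := hu ▸ Nat.mod_lt a hB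
    have hdiv : B * (a / B) + u = a := hu ▸ Nat.div_add_mod a B
    rw [hu]
    have hbit' : ∀ i, (hi : i < l.length) → i < f → bitOf (D (a / B)) (u + i) = l[i] := by
      intro i hi hi'
      rw [← hbit i hi, diskBit]
      have h1 : a + i = B * (a / B) + (u + i) := by omega
      have hlt : u + i < B := by omega
      have h2 : (a + i) / B = a / B := by
        rw [h1, Nat.mul_add_div hB, Nat.div_eq_of_lt hlt, add_zero]
      have h3 : (a + i) % B = u + i := by
        rw [h1, Nat.mul_add_mod, Nat.mod_eq_of_lt hlt]
      rw [h2, h3]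
    by_cases hf : l.length ≤ f
    · have hd := decodeBits_end h hs' (bit := bitOf (D (a / B))) (a := u) hf
        (fun i hi => hbit' i hi (lt_of_lt_of_le hi hf))
      refine .last ?_ ?_ ?_
      · simpa [scanStep] using hT₀
      · simp [scanStep, hu, hfu, hd, hs']
      · simp only [scanStep, Tree.cost_read, Tree.cost_ret]
        generalize (u + l.length) / B = y
        omega
    · obtain ⟨t, E₁, E₂, h4, rfl, h6, h7, h8⟩ := decodeBits_part h
        (bit := bitOf (D (a / B))) (f := f) (a := u) (by omega)
        (fun i hi => by
          by_cases hi' : i < f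
          · exact Or.inl (hbit' i hi hi')
          · exact Or.inr (by omega)) hs
      have ha' : (a / B + 1) * B = a + f := by
        rw [add_mul, one_mul, mul_comm]; omega
      have hl' : (l.drop f).length = l.length - f := List.length_drop
      have := ih (l.drop f).length (by omega) (a := a + f) h8 h7 (by
        intro i hi
        rw [List.getElem_drop, ← hbit _ (by omega)]
        congr 1; ring) (by omega) rfl
      have hgood : Inner.Good L W X (.scan (a + f) t) := ⟨by omega, h7⟩
      refine .next (x' := .scan (a + f) t) ?_ ?_ hgood this ?_
      · simpa [scanStep] using hT₀
      · simp [scanStep, hu, hfu, h4, h6, ha']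
      · simp only [scanStep, Tree.cost_read, Tree.cost_ret]
        have e : (a + f) % B = 0 := by rw [← ha']; simp
        rw [e, hl']
        have e2 : u + l.length = (0 + (l.length - f)) + B := by omega
        rw [e2, Nat.add_div_right _ hB]
        omega

theorem Decoder.bounded_atStart {L r : ℕ} (h : r ≤ 2 ^ L) : (atStart r).Bounded L := by
  refine ⟨?_, h, ?_, ?_, ?_, ?_⟩ <;> simp [atStart]

/-- A scan task, from the moment when its address has to be read from the table. -/
theorem taskRun_scan_fresh {D : Disk B} {T₀ W X fld r₀ c : ℕ} (hB : 0 < B) (hW : W ≤ c * B)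
    (hT₀ : c + 2 ≤ T₀) {l : List Bool} {E : Finset (Fin n)} {a : ℕ}
    (h : Decoder.Path hash L j jj r₁ (.atStart r₀) l E (.atStart r₁)) (hr₀ : r₀ ≤ 2 ^ L)
    (hbit : ∀ i, (hi : i < l.length) → diskBit D (a + i) = l[i]) (ha : a + l.length < 2 ^ W)
    (hfld : ∀ i < W, diskBit D (W * fld + i) = a.testBit i) :
    TaskRun (scanStep hash L j jj r₁ W fld r₀) (Inner.Good L W X) T₀ D .fresh E
      (c + 7 + 2 * (l.length / B)) := by
  have hrun : (readNum B W fld).run D = a := run_readNum D W fld a (by omega) hfld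
  have hcost := cost_readNum D fld hB hW
  have hb := Decoder.bounded_atStart hr₀
  have hscan := taskRun_scan (X := X) (fld := fld) (r₀ := r₀) (T₀ := T₀) hB (by omega) h
    (by simp [Decoder.AtEnd, Decoder.atStart]) hb hbit ha
  rw [← Finset.empty_union E]
  have hgood : Inner.Good L W X (.scan a (.atStart r₀)) := ⟨by omega, hb⟩
  refine .next (x' := .scan a (.atStart r₀)) ?_ ?_ hgood hscan ?_
  · simp only [scanStep, Tree.cost_bind, Tree.cost_ret]; omega
  · simp [scanStep, hrun]
  · simp only [scanStep, Tree.cost_bind, Tree.cost_ret]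
    have h1 : (a % B + l.length) / B ≤ l.length / B + 1 := by
      rw [← Nat.add_div_right _ hB]
      exact Nat.div_le_div_right (by have := Nat.mod_lt a hB; omega)
    omega

end Scan

/-! ### Reading the elements of a node -/

/-- Read `c` consecutive numbers of the table. -/
noncomputable def readNums (B W i : ℕ) : ℕ → Tree B (ℕ → ℕ)
  | 0 => .ret fun _ => 0
  | c + 1 => (readNums B W i c).bind fun f => (readNum B W (i + c)).bind fun v =>
      .ret fun k => if k = c then v else f k

theorem run_readNums {B : ℕ} (D : Disk B) (W i : ℕ) (v : ℕ → ℕ) (c : ℕ)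
    (hv : ∀ k < c, v k < 2 ^ W)
    (h : ∀ k < c, ∀ j < W, diskBit D (W * (i + k) + j) = (v k).testBit j) :
    ∀ k < c, (readNums B W i c).run D k = v k := by
  induction c with
  | zero => intro k hk; omega
  | succ c ih =>
    intro k hk
    simp only [readNums, Tree.run_bind, Tree.run_ret]
    split_ifs with h1
    · rw [h1]
      exact run_readNum D W _ _ (hv c (by omega)) (h c (by omega))
    · exact ih (fun k hk => hv k (by omega)) (fun k hk => h k (by omega)) k (by omega)

theorem cost_readNums {B W c' : ℕ} (D : Disk B) (i : ℕ) (hB : 0 < B) (hW : W ≤ c' * B) (c : ℕ) :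
    (readNums B W i c).cost D ≤ c * (c' + 2) := by
  induction c with
  | zero => simp [readNums]
  | succ c ih =>
    simp only [readNums, Tree.cost_bind, Tree.cost_ret]
    have := cost_readNum D (i + c) hB hW
    rw [add_mul, one_mul]
    omega

section Node

variable {n : ℕ} (B : ℕ) (hash : Fin n → ℕ) (d j e β : ℕ)

/-- The address of the slot of the element that is the `p`-th of its chunk, at level `k` below the
node: `nd` gives the heap indices of the nodes at this level in which the elements lie, and `O` is
the set of the elements of the chunk. -/
def slotAddr (a : ℕ) (ptr : ℕ → ℕ) (O : Finset ℕ) (k : ℕ) (nd : ℕ → ℕ) (p : ℕ) : ℕ :=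
  a + 4 * ((nd p - 2 ^ k) * 2 ^ j / 2 ^ k + ptr (nd p) +
    (O.filter fun p' => p' < p ∧ nd p' = nd p).card)

/-- Follow the elements of a chunk down `k` levels. The result gives, for each of them, the heap
index of the node reached, and the fresh hash bits met on the way. -/
noncomputable def levels (a ptr : ℕ → ℕ) (O : Finset ℕ) : ℕ → Tree B ((ℕ → ℕ) × (ℕ → ℕ → Bool))
  | 0 => .ret (fun _ => 1, fun _ _ => false)
  | k + 1 => (levels a ptr O k).bind fun σ =>
      (readAt B (O.image (fun p => slotAddr j (a k) ptr O k σ.1 p + 2) ∪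
        O.image (fun p => slotAddr j (a k) ptr O k σ.1 p + 3))).bind fun g =>
      .ret (fun p => 2 * σ.1 p + (g (slotAddr j (a k) ptr O k σ.1 p + 2)).toNat,
        fun p k' => if k' = k then g (slotAddr j (a k) ptr O k σ.1 p + 3) else σ.2 p k')

/-- The address of bit `p` of the bitmap of a node. -/
def bitmapAddr (a p : ℕ) : ℕ := a + 4 * (p / 2) + p % 2

/-- The positions of the bitmap that form chunk `c`. -/
def chunk (c : ℕ) : Finset ℕ :=
  Finset.Ico (c * 2 ^ (e + β)) (min ((c + 1) * 2 ^ (e + β)) (2 ^ (j + 1)))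

/-- The positions whose hash values agree with an element of the chunk on the `L - d` highest bits,
as given by the bitmap, and on the fresh bits. -/
def chunkEmit (ptr : ℕ → ℕ) (O : Finset ℕ) (fr : ℕ → ℕ → Bool) : Finset (Fin n) :=
  Finset.univ.filter fun i => ∃ p ∈ O,
    hash i / 2 ^ d = p - (ptr 1 + (O.filter fun p' => p' < p).card) ∧
      ∀ k < e, (hash i).testBit (freshBit (d + k)) = fr p k

/-- The pointers after a chunk. -/
def advance (ptr : ℕ → ℕ) (O : Finset ℕ) (nd : ℕ → ℕ) (x : ℕ) : ℕ :=
  ptr x + (O.filter fun p => nd p / 2 ^ (e - Nat.log 2 x) = x ∧ 0 < x ∧ x < 2 ^ (e + 1)).card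

/-- Process one chunk of a node. -/
noncomputable def chunkTree (W fld off c : ℕ) (ptr : ℕ → ℕ) :
    Tree B (Finset (Fin n) × Option Inner) :=
  (readNums B W fld (e + 1)).bind fun a =>
    (readAt B ((chunk j e β c).image (bitmapAddr (a 0 + 4 * off)))).bind fun g =>
      let O := (chunk j e β c).filter fun p => g (bitmapAddr (a 0 + 4 * off) p) = true
      (levels B j (fun k => a k + 4 * off) ptr O e).bind fun σ =>
        .ret (chunkEmit hash d e ptr O σ.2,
          if (c + 1) * 2 ^ (e + β) < 2 ^ (j + 1) then some (.node (c + 1) (advance e ptr O σ.1))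
          else none)

/-- One round of the pass through a node of size `2 ^ j` with accuracy `e`, the levels of which
start `off` slots after the addresses in the table. -/
noncomputable def nodeStep (W fld off : ℕ) : Inner → Tree B (Finset (Fin n) × Option Inner)
  | .fresh => chunkTree B hash d j e β W fld off 0 fun _ => 0
  | .scan _ _ => .ret (∅, none)
  | .node c ptr => chunkTree B hash d j e β W fld off c ptr

end Node

namespace World

variable (w : World)

theorem node_add (d k r : ℕ) : w.node (d + k) r / 2 ^ k = w.node d r := by
  induction k with
  | zero => simp
  | succ k ih =>
    rw [pow_succ', ← Nat.div_div_eq_div_mul, ← add_assoc, node_succ, ih]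

/-- The index of the node of level `d + k` that contains `r`, in the heap order of the tree below
the node of level `d`. -/
def heapIdx (d k r : ℕ) : ℕ := 2 ^ k + w.node (d + k) r % 2 ^ k

theorem heapIdx_zero (d r : ℕ) : w.heapIdx d 0 r = 1 := by simp [heapIdx, Nat.mod_one]

theorem heapIdx_succ (d k r : ℕ) :
    w.heapIdx d (k + 1) r = 2 * w.heapIdx d k r + w.node (d + k + 1) r % 2 := by
  rw [heapIdx, heapIdx, pow_succ', Nat.mod_mul, ← w.node_succ (d + k) r, Nat.add_assoc d k 1]
  ring

theorem le_heapIdx (d k r : ℕ) : 2 ^ k ≤ w.heapIdx d k r := Nat.le_add_right _ _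

theorem heapIdx_lt (d k r : ℕ) : w.heapIdx d k r < 2 ^ (k + 1) := by
  have := Nat.mod_lt (w.node (d + k) r) (Nat.two_pow_pos k)
  rw [heapIdx, pow_succ]; omega

theorem heapIdx_div (d r : ℕ) {k e : ℕ} (h : k ≤ e) :
    w.heapIdx d e r / 2 ^ (e - k) = w.heapIdx d k r := by
  obtain ⟨c, rfl⟩ := Nat.exists_eq_add_of_le h
  rw [Nat.add_sub_cancel_left]
  induction c with
  | zero => simp
  | succ c ih =>
    rw [← add_assoc, heapIdx_succ, pow_succ', ← Nat.div_div_eq_div_mul, ← ih (by omega)]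
    congr 1
    omega

theorem heapIdx_eq_iff {d k r r' : ℕ} (h : w.node d r = w.node d r') :
    w.heapIdx d k r = w.heapIdx d k r' ↔ w.node (d + k) r = w.node (d + k) r' := by
  rw [heapIdx, heapIdx, Nat.add_left_cancel_iff]
  constructor
  · intro h1
    rw [← Nat.div_add_mod (w.node (d + k) r) (2 ^ k), ← Nat.div_add_mod (w.node (d + k) r') (2 ^ k),
      node_add, node_add, h, h1]
  · intro h1; rw [h1]

variable {w} {v₀ j : ℕ}

theorem node_of_mem (hj : j ≤ w.L) (hv : 2 ^ j ∣ v₀) {r : ℕ} (h1 : v₀ ≤ r) (h2 : r < v₀ + 2 ^ j) :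
    w.node (w.L - j) r = v₀ / 2 ^ j := by
  rw [w.node_eq_div (Nat.sub_le _ _), Nat.sub_sub_self hj]
  obtain ⟨x, rfl⟩ := hv
  rw [Nat.mul_div_cancel_left _ (Nat.two_pow_pos j)]
  exact Nat.div_eq_of_lt_le (by rw [mul_comm]; exact h1) (by rw [add_mul, mul_comm, one_mul]; exact h2)

theorem node_eq_iff_mem (hj : j ≤ w.L) (hv : 2 ^ j ∣ v₀) {r : ℕ} :
    w.node (w.L - j) r = v₀ / 2 ^ j ↔ v₀ ≤ r ∧ r < v₀ + 2 ^ j := by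
  refine ⟨fun h => ?_, fun h => node_of_mem hj hv h.1 h.2⟩
  rw [w.node_eq_div (Nat.sub_le _ _), Nat.sub_sub_self hj] at h
  have h1 := Nat.div_mul_le_self r (2 ^ j)
  have h2 := Nat.lt_div_mul_add (a := r) (Nat.two_pow_pos j)
  rw [h, Nat.div_mul_cancel hv] at h1 h2
  exact ⟨h1, h2⟩

theorem nodeStart_add (hj : j ≤ w.L) (hv : 2 ^ j ∣ v₀) {r : ℕ} (h1 : v₀ ≤ r) (h2 : r < v₀ + 2 ^ j)
    (k : ℕ) : w.nodeStart (w.L - j + k) r =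
      v₀ + (w.heapIdx (w.L - j) k r - 2 ^ k) * 2 ^ j / 2 ^ k := by
  have h3 := node_of_mem hj hv h1 h2
  obtain ⟨x, rfl⟩ := hv
  rw [Nat.mul_div_cancel_left _ (Nat.two_pow_pos j), ← w.node_add _ k] at h3
  have h4 := Nat.div_add_mod (w.node (w.L - j + k) r) (2 ^ k)
  rw [h3] at h4
  rw [nodeStart, heapIdx, Nat.add_sub_cancel_left, ← h4, Nat.mul_add_mod, Nat.mod_mod]
  have e1 : 2 ^ w.L = 2 ^ (w.L - j) * 2 ^ j := by rw [← pow_add]; congr 1; omega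
  rw [e1, pow_add, show ∀ y, (2 ^ k * x + y) * (2 ^ (w.L - j) * 2 ^ j) =
    2 ^ (w.L - j) * ((2 ^ k * x + y) * 2 ^ j) by intro y; ring, Nat.mul_div_mul_left _ _
    (Nat.two_pow_pos _), show ∀ y, (2 ^ k * x + y) * 2 ^ j = y * 2 ^ j + 2 ^ k * (2 ^ j * x) by
      intro y; ring, Nat.add_mul_div_left _ _ (Nat.two_pow_pos k), add_comm]

/-- The rank of `r` by hash value in its node of level `d + k`, counted along the bitmap of its
node of level `d`. -/
theorem idx_add (hw : w.Valid) (hj : j ≤ w.L) (hv : 2 ^ j ∣ v₀) (hvL : v₀ + 2 ^ j ≤ 2 ^ w.L)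
    {r : ℕ} (h1 : v₀ ≤ r) (h2 : r < v₀ + 2 ^ j) (k : ℕ) :
    w.idx (w.L - j + k) r = ((Finset.Ico v₀ (v₀ + 2 ^ j)).filter fun x =>
      w.gpos (w.L - j) x < w.gpos (w.L - j) r ∧
        w.heapIdx (w.L - j) k x = w.heapIdx (w.L - j) k r).card := by
  have h3 := node_of_mem hj hv h1 h2
  rw [idx, nodeSet, Finset.filter_filter]
  congr 1
  ext x
  simp only [Finset.mem_filter, Finset.mem_range, Finset.mem_Ico]
  constructor
  · rintro ⟨h4, h5, h6⟩
    have h7 : w.node (w.L - j) x = w.node (w.L - j) r := by rw [← w.node_add _ k, h5, w.node_add]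
    exact ⟨(node_eq_iff_mem hj hv).1 (h7.trans h3),
      w.gpos_lt_gpos h4 h7 h6, (w.heapIdx_eq_iff h7).2 h5⟩
  · rintro ⟨h4, h5, h6⟩
    have h7 := (node_of_mem hj hv h4.1 h4.2).trans h3.symm
    have h8 : x < 2 ^ w.L := by omega
    exact ⟨h8, (w.heapIdx_eq_iff h7).1 h6, (w.gpos_lt_iff hw h8 (by omega) h7).1 h5⟩

end World

/-- The blocks met at one level: for each node of the level, the slots that are read form an
interval. -/
theorem card_blocks_level_le {B : ℕ} (O T : Finset ℕ) (nd adr a : ℕ → ℕ)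
    (hT : ∀ p ∈ O, nd p ∈ T)
    (hadr : ∀ p ∈ O, adr p = a (nd p) + 4 * (O.filter fun p' => p' < p ∧ nd p' = nd p).card) :
    (((O.image fun p => adr p + 2) ∪ O.image fun p => adr p + 3).image (· / B)).card * B ≤
      4 * O.card + 2 * B * T.card := by
  have h1 : ((O.image fun p => adr p + 2) ∪ O.image fun p => adr p + 3) ⊆ T.biUnion fun x =>
      ((O.filter fun p => nd p = x).image fun p => adr p + 2) ∪
        (O.filter fun p => nd p = x).image fun p => adr p + 3 := by
    intro y hy
    simp only [Finset.mem_union, Finset.mem_image, Finset.mem_biUnion, Finset.mem_filter] at hy ⊢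
    rcases hy with ⟨p, hp, rfl⟩ | ⟨p, hp, rfl⟩
    · exact ⟨nd p, hT p hp, Or.inl ⟨p, ⟨hp, rfl⟩, rfl⟩⟩
    · exact ⟨nd p, hT p hp, Or.inr ⟨p, ⟨hp, rfl⟩, rfl⟩⟩
  have h2 := (Finset.card_le_card (Finset.image_subset_image (f := (· / B)) h1))
  rw [Finset.biUnion_image] at h2
  have h3 := h2.trans Finset.card_biUnion_le
  refine (Nat.mul_le_mul_right B h3).trans ?_
  rw [Finset.card_eq_sum_card_fiberwise (f := nd) (t := T) hT, Finset.sum_mul, Finset.mul_sum,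
    Finset.card_eq_sum_ones T, Finset.mul_sum, ← Finset.sum_add_distrib]
  refine Finset.sum_le_sum fun x _ => ?_
  rw [mul_one]
  refine card_blocks_mul_le _ (a x) _ fun y hy => ?_
  have key : ∀ p ∈ O, nd p = x → a x ≤ adr p ∧
      adr p + 4 ≤ a x + 4 * (O.filter fun p => nd p = x).card := by
    intro p hp hx
    have h4 := hadr p hp
    have h5 : (O.filter fun p' => p' < p ∧ nd p' = nd p).card <
        (O.filter fun p => nd p = x).card := by
      refine Finset.card_lt_card (Finset.ssubset_iff_of_subset ?_ |>.2 ⟨p, by simp [hp, hx],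
        by simp⟩)
      intro y hy
      simp only [Finset.mem_filter] at hy ⊢
      exact ⟨hy.1, hy.2.2.trans hx⟩
    rw [hx] at h4 h5
    omega
  simp only [Finset.mem_union, Finset.mem_image, Finset.mem_filter] at hy
  rcases hy with ⟨p, ⟨hp, hx⟩, rfl⟩ | ⟨p, ⟨hp, hx⟩, rfl⟩
  · have := key p hp hx; omega
  · have := key p hp hx; omega

/-- What the disk holds for a node of size `2 ^ j` that starts at `v₀`: the bitmap of the node, and
at `e` levels the branching and the fresh bits of its elements. -/
structure NodeData {B : ℕ} (w : World) (D : Disk B) (v₀ j e : ℕ) (a : ℕ → ℕ) : Prop where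
  bitmap : ∀ p < 2 ^ (j + 1), diskBit D (bitmapAddr (a 0) p) = true ↔
    ∃ r, v₀ ≤ r ∧ r < v₀ + 2 ^ j ∧ w.gpos (w.L - j) r = p
  child : ∀ k < e, ∀ r, v₀ ≤ r → r < v₀ + 2 ^ j →
    diskBit D (a k + 4 * (w.slot (w.L - j + k) r - v₀) + 2) =
      decide (w.node (w.L - j + k + 1) r % 2 = 1)
  fresh : ∀ k < e, ∀ r, v₀ ≤ r → r < v₀ + 2 ^ j →
    diskBit D (a k + 4 * (w.slot (w.L - j + k) r - v₀) + 3) =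
      (w.key r).testBit (freshBit (w.L - j + k))

section NodeCorrect

variable {n B : ℕ} {hash : Fin n → ℕ} {w : World} {D : Disk B} {v₀ j e β : ℕ} {a : ℕ → ℕ}

/-- The number of the elements of a node that precede position `P` of the bitmap and lie in the
node below it with heap index `x`. -/
def ptrVal (w : World) (v₀ j e P x : ℕ) : ℕ :=
  ((Finset.Ico v₀ (v₀ + 2 ^ j)).filter fun r =>
    w.gpos (w.L - j) r < P ∧ w.heapIdx (w.L - j) (Nat.log 2 x) r = x ∧ x < 2 ^ (e + 1)).card

theorem ptrVal_le (w : World) (v₀ j e P x : ℕ) : ptrVal w v₀ j e P x ≤ 2 ^ j := by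
  refine (Finset.card_filter_le _ _).trans (by simp)

theorem ptrVal_of_le (w : World) (v₀ j e P : ℕ) {x : ℕ} (hx : 2 ^ (e + 1) ≤ x) :
    ptrVal w v₀ j e P x = 0 := by
  rw [ptrVal, Finset.card_eq_zero, Finset.filter_eq_empty_iff]
  rintro r - ⟨-, -, h⟩
  omega

/-- The elements of a node whose positions in the bitmap lie in an interval. -/
def members (w : World) (v₀ j P P' : ℕ) : Finset ℕ :=
  (Finset.Ico v₀ (v₀ + 2 ^ j)).filter fun r => P ≤ w.gpos (w.L - j) r ∧ w.gpos (w.L - j) r < P'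

theorem mem_members {P P' r : ℕ} : r ∈ members w v₀ j P P' ↔
    v₀ ≤ r ∧ r < v₀ + 2 ^ j ∧ P ≤ w.gpos (w.L - j) r ∧ w.gpos (w.L - j) r < P' := by
  simp [members, and_assoc]

theorem gpos_injOn (hw : w.Valid) (hj : j ≤ w.L) (hv : 2 ^ j ∣ v₀) (hvL : v₀ + 2 ^ j ≤ 2 ^ w.L) :
    Set.InjOn (w.gpos (w.L - j)) (Set.Ico v₀ (v₀ + 2 ^ j)) := by
  intro r hr r' hr' h
  refine w.gpos_inj hw (by have := hr.2; omega) (by have := hr'.2; omega) ?_ h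
  rw [World.node_of_mem hj hv hr.1 hr.2, World.node_of_mem hj hv hr'.1 hr'.2]

/-- Counting in a chunk of the bitmap is counting elements. -/
theorem card_filter_image (hw : w.Valid) (hj : j ≤ w.L) (hv : 2 ^ j ∣ v₀)
    (hvL : v₀ + 2 ^ j ≤ 2 ^ w.L) {P P' : ℕ} (q : ℕ → Prop) [DecidablePred q] :
    (((members w v₀ j P P').image (w.gpos (w.L - j))).filter q).card =
      ((members w v₀ j P P').filter fun r => q (w.gpos (w.L - j) r)).card := by
  rw [Finset.filter_image, Finset.card_image_of_injOn]
  intro r hr r' hr'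
  simp only [Finset.coe_filter, Set.mem_ofPred_eq, mem_members] at hr hr'
  exact gpos_injOn hw hj hv hvL ⟨hr.1.1, hr.1.2.1⟩ ⟨hr'.1.1, hr'.1.2.1⟩

/-- The slot of an element of a chunk, relative to the start of the node. -/
theorem slot_eq (hw : w.Valid) (hj : j ≤ w.L) (hv : 2 ^ j ∣ v₀) (hvL : v₀ + 2 ^ j ≤ 2 ^ w.L)
    {P P' k : ℕ} (hk : k ≤ e) (nd : ℕ → ℕ)
    (hnd : ∀ r ∈ members w v₀ j P P', nd (w.gpos (w.L - j) r) = w.heapIdx (w.L - j) k r)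
    {r : ℕ} (hr : r ∈ members w v₀ j P P') (A : ℕ) :
    slotAddr j A (ptrVal w v₀ j e P) ((members w v₀ j P P').image (w.gpos (w.L - j))) k nd
      (w.gpos (w.L - j) r) = A + 4 * (w.slot (w.L - j + k) r - v₀) := by
  have hr' := mem_members.1 hr
  rw [slotAddr, card_filter_image hw hj hv hvL, hnd r hr, World.slot,
    World.nodeStart_add hj hv hr'.1 hr'.2.1, World.idx_add hw hj hv hvL hr'.1 hr'.2.1, ptrVal,
    show ∀ x y z : ℕ, x + y + z - x = y + z by intros; omega, add_assoc ((_ : ℕ) / _)]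
  congr 3
  have hlog : Nat.log 2 (w.heapIdx (w.L - j) k r) = k :=
    Nat.log_eq_of_pow_le_of_lt_pow (w.le_heapIdx _ _ _) (w.heapIdx_lt _ _ _)
  have hlt : w.heapIdx (w.L - j) k r < 2 ^ (e + 1) :=
    (w.heapIdx_lt _ _ _).trans_le (Nat.pow_le_pow_right (by norm_num) (by omega))
  rw [hlog, ← Finset.card_union_of_disjoint]
  · congr 1
    ext x
    simp only [Finset.mem_union, Finset.mem_filter, Finset.mem_Ico, mem_members]
    constructor
    · rintro (⟨h1, h2, h3, h4⟩ | ⟨h1, h2, h3⟩)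
      · exact ⟨h1, by omega, h3⟩
      · rw [hnd x (mem_members.2 h1)] at h3
        exact ⟨⟨h1.1, h1.2.1⟩, h2, h3⟩
    · rintro ⟨h1, h2, h3⟩
      by_cases h4 : w.gpos (w.L - j) x < P
      · exact Or.inl ⟨h1, h4, h3, hlt⟩
      · have h5 : v₀ ≤ x ∧ x < v₀ + 2 ^ j ∧ P ≤ w.gpos (w.L - j) x ∧ w.gpos (w.L - j) x < P' :=
          ⟨h1.1, h1.2, by omega, by omega⟩
        exact Or.inr ⟨h5, h2, by rw [hnd x (mem_members.2 h5), h3]⟩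
  · rw [Finset.disjoint_left]
    intro x hx hx'
    simp only [Finset.mem_filter, mem_members] at hx hx'
    omega

theorem run_levels (hw : w.Valid) (hj : j ≤ w.L) (hv : 2 ^ j ∣ v₀) (hvL : v₀ + 2 ^ j ≤ 2 ^ w.L)
    (hD : NodeData w D v₀ j e a) {P P' k : ℕ} (hk : k ≤ e) :
    ∀ r ∈ members w v₀ j P P',
      ((levels B j a (ptrVal w v₀ j e P) ((members w v₀ j P P').image (w.gpos (w.L - j))) k).run
        D).1 (w.gpos (w.L - j) r) = w.heapIdx (w.L - j) k r ∧
      ∀ k' < k,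
      ((levels B j a (ptrVal w v₀ j e P) ((members w v₀ j P P').image (w.gpos (w.L - j))) k).run
        D).2 (w.gpos (w.L - j) r) k' = (w.key r).testBit (freshBit (w.L - j + k')) := by
  induction k with
  | zero => intro r _; simp [levels, World.heapIdx_zero]
  | succ k ih =>
    intro r hr
    have ih := ih (by omega)
    set O := (members w v₀ j P P').image (w.gpos (w.L - j)) with hO
    have hmem : w.gpos (w.L - j) r ∈ O := Finset.mem_image_of_mem _ hr
    have hr' := mem_members.1 hr
    have hs := slot_eq hw hj hv hvL (e := e) (k := k) (by omega) _ (fun r hr => (ih r hr).1) hr (a k)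
    simp only [levels, Tree.run_bind, Tree.run_ret]
    rw [run_readAt _ _ _ (Finset.mem_union_left _ (Finset.mem_image_of_mem _ hmem)),
      run_readAt _ _ _ (Finset.mem_union_right _ (Finset.mem_image_of_mem _ hmem)), hs,
      hD.child k (by omega) r hr'.1 hr'.2.1, hD.fresh k (by omega) r hr'.1 hr'.2.1, (ih r hr).1,
      World.heapIdx_succ]
    refine ⟨?_, fun k' hk' => ?_⟩
    · rcases Nat.mod_two_eq_zero_or_one (w.node (w.L - j + k + 1) r) with h | h <;> simp [h]
    · split_ifs with h
      · rw [h]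
      · exact (ih r hr).2 k' (by omega)

theorem slot_lt (hj : j ≤ w.L) (hv : 2 ^ j ∣ v₀) (hvL : v₀ + 2 ^ j ≤ 2 ^ w.L) {r : ℕ}
    (h1 : v₀ ≤ r) (h2 : r < v₀ + 2 ^ j) (k : ℕ) :
    v₀ ≤ w.slot (w.L - j + k) r ∧ w.slot (w.L - j + k) r < v₀ + 2 ^ j := by
  rw [← World.node_eq_iff_mem hj hv, ← w.node_add _ k, w.node_slot (by omega), w.node_add]
  exact World.node_of_mem hj hv h1 h2

theorem cost_levels (hw : w.Valid) (hj : j ≤ w.L) (hv : 2 ^ j ∣ v₀) (hvL : v₀ + 2 ^ j ≤ 2 ^ w.L)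
    (hD : NodeData w D v₀ j e a) {P P' k : ℕ} (hk : k ≤ e) :
    ((levels B j a (ptrVal w v₀ j e P) ((members w v₀ j P P').image (w.gpos (w.L - j))) k).cost
        D) * B ≤ k * (4 * (members w v₀ j P P').card + 2 * B * 2 ^ e) ∧
    ((levels B j a (ptrVal w v₀ j e P) ((members w v₀ j P P').image (w.gpos (w.L - j))) k).cost
        D) * B ≤ k * (4 * 2 ^ j + 2 * B) := by
  induction k with
  | zero => simp [levels]
  | succ k ih =>
    have ih := ih (by omega)
    have hrun := run_levels hw hj hv hvL hD (P := P) (P' := P') (k := k) (by omega)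
    have hcard : ((members w v₀ j P P').image (w.gpos (w.L - j))).card ≤
      (members w v₀ j P P').card := Finset.card_image_le
    set O := (members w v₀ j P P').image (w.gpos (w.L - j)) with hO
    simp only [levels, Tree.cost_bind, Tree.cost_ret, cost_readAt]
    set σ := (levels B j a (ptrVal w v₀ j e P) O k).run D with hσ
    rw [add_zero, add_mul, add_mul, add_mul, one_mul, one_mul]
    constructor
    · refine Nat.add_le_add ih.1 ?_
      have h := card_blocks_level_le (B := B) O (Finset.Ico (2 ^ k) (2 ^ (k + 1))) σ.1
        (slotAddr j (a k) (ptrVal w v₀ j e P) O k σ.1)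
        (fun x => a k + 4 * ((x - 2 ^ k) * 2 ^ j / 2 ^ k + ptrVal w v₀ j e P x))
        (by
          intro p hp
          obtain ⟨r, hr, rfl⟩ := Finset.mem_image.1 hp
          rw [(hrun r hr).1, Finset.mem_Ico]
          exact ⟨w.le_heapIdx _ _ _, w.heapIdx_lt _ _ _⟩)
        (by intro p _; rw [slotAddr]; ring)
      refine h.trans (Nat.add_le_add (by omega) (Nat.mul_le_mul_left _ ?_))
      rw [Nat.card_Ico, pow_succ]
      have := Nat.pow_le_pow_right (n := 2) (by norm_num) (show k ≤ e by omega)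
      omega
    · refine Nat.add_le_add ih.2 ?_
      refine card_blocks_mul_le _ (a k) _ fun y hy => ?_
      have key : ∀ p ∈ O, a k ≤ slotAddr j (a k) (ptrVal w v₀ j e P) O k σ.1 p ∧
          slotAddr j (a k) (ptrVal w v₀ j e P) O k σ.1 p + 4 ≤ a k + 4 * 2 ^ j := by
        intro p hp
        obtain ⟨r, hr, rfl⟩ := Finset.mem_image.1 hp
        have hr' := mem_members.1 hr
        rw [slot_eq hw hj hv hvL (e := e) (k := k) (by omega) _ (fun r hr => (hrun r hr).1) hr (a k)]
        have := slot_lt hj hv hvL hr'.1 hr'.2.1 k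
        omega
      simp only [Finset.mem_union, Finset.mem_image] at hy
      rcases hy with ⟨p, hp, rfl⟩ | ⟨p, hp, rfl⟩
      · have := key p hp; omega
      · have := key p hp; omega

/-- The condition under which an element of a node is generated on account of the element `r`. -/
def NodeMatch (w : World) (j e h r : ℕ) : Prop :=
  h / 2 ^ (w.L - j) = w.key r / 2 ^ (w.L - j) ∧
    ∀ k < e, h.testBit (freshBit (w.L - j + k)) = (w.key r).testBit (freshBit (w.L - j + k))

theorem mem_chunkEmit (hw : w.Valid) (hj : j ≤ w.L) (hv : 2 ^ j ∣ v₀)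
    (hvL : v₀ + 2 ^ j ≤ 2 ^ w.L) {P P' : ℕ} (fr : ℕ → ℕ → Bool)
    (hfr : ∀ r ∈ members w v₀ j P P', ∀ k < e,
      fr (w.gpos (w.L - j) r) k = (w.key r).testBit (freshBit (w.L - j + k))) (i : Fin n) :
    i ∈ chunkEmit hash (w.L - j) e (ptrVal w v₀ j e P)
      ((members w v₀ j P P').image (w.gpos (w.L - j))) fr ↔
      ∃ r ∈ members w v₀ j P P', NodeMatch w j e (hash i) r := by
  rw [chunkEmit]
  simp only [Finset.mem_filter, Finset.mem_univ, true_and, Finset.exists_mem_image]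
  refine exists_congr fun r => and_congr_right fun hr => ?_
  have hr' := mem_members.1 hr
  have hs := slot_eq hw hj hv hvL (e := e) (k := 0) (by omega) (fun _ => 1)
    (fun r _ => (w.heapIdx_zero _ r).symm) hr 0
  have h1 := World.nodeStart_add hj hv hr'.1 hr'.2.1 0
  rw [World.heapIdx_zero] at h1
  rw [slotAddr, World.slot, h1] at hs
  simp only [pow_zero, Nat.sub_self, zero_mul, Nat.zero_div, zero_add, add_zero, and_true,
    Nat.add_sub_cancel_left] at hs
  have h2 : w.gpos (w.L - j) r - (ptrVal w v₀ j e P 1 +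
      (((members w v₀ j P P').image (w.gpos (w.L - j))).filter fun p' =>
        p' < w.gpos (w.L - j) r).card) = w.key r / 2 ^ (w.L - j) := by
    rw [Nat.eq_of_mul_eq_mul_left (by norm_num) hs]
    conv_lhs => rw [World.gpos]
    generalize w.key r / 2 ^ (w.L - j) = y
    exact Nat.add_sub_cancel _ _
  rw [h2, NodeMatch]
  refine and_congr_right fun _ => forall₂_congr fun k hk => ?_
  rw [hfr r hr k hk]

theorem advance_eq (hw : w.Valid) (hj : j ≤ w.L) (hv : 2 ^ j ∣ v₀)
    (hvL : v₀ + 2 ^ j ≤ 2 ^ w.L) {P P' : ℕ} (hP : P ≤ P') (nd : ℕ → ℕ)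
    (hnd : ∀ r ∈ members w v₀ j P P', nd (w.gpos (w.L - j) r) = w.heapIdx (w.L - j) e r) :
    advance e (ptrVal w v₀ j e P) ((members w v₀ j P P').image (w.gpos (w.L - j))) nd =
      ptrVal w v₀ j e P' := by
  funext x
  rw [advance, card_filter_image hw hj hv hvL, ptrVal, ptrVal, ← Finset.card_union_of_disjoint]
  · congr 1
    ext r
    have key : ∀ r, r ∈ members w v₀ j P P' → 0 < x ∧ x < 2 ^ (e + 1) →
        (nd (w.gpos (w.L - j) r) / 2 ^ (e - Nat.log 2 x) = x ↔
        w.heapIdx (w.L - j) (Nat.log 2 x) r = x) := by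
      intro r hr hx
      rw [hnd r hr, World.heapIdx_div]
      have := Nat.log_lt_of_lt_pow (b := 2) hx.1.ne' hx.2
      omega
    have hpos : ∀ r, w.heapIdx (w.L - j) (Nat.log 2 x) r = x → 0 < x := fun r h => by
      rw [← h]; exact (Nat.two_pow_pos _).trans_le (w.le_heapIdx _ _ _)
    simp only [Finset.mem_union, Finset.mem_filter, Finset.mem_Ico]
    constructor
    · rintro (⟨h1, h2, h3⟩ | ⟨h1, h2, h3⟩)
      · exact ⟨h1, by omega, h3⟩
      · have h4 := mem_members.1 h1
        exact ⟨⟨h4.1, h4.2.1⟩, h4.2.2.2, (key r h1 h3).1 h2, h3.2⟩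
    · rintro ⟨h1, h2, h3, h4⟩
      by_cases h5 : w.gpos (w.L - j) r < P
      · exact Or.inl ⟨h1, h5, h3, h4⟩
      · have h6 : r ∈ members w v₀ j P P' := mem_members.2 ⟨h1.1, h1.2, by omega, h2⟩
        exact Or.inr ⟨h6, (key r h6 ⟨hpos r h3, h4⟩).2 h3, hpos r h3, h4⟩
  · rw [Finset.disjoint_left]
    intro r hr hr'
    simp only [Finset.mem_filter, mem_members] at hr hr'
    omega

/-- The set bits of a chunk of the bitmap stand for its elements. -/
theorem filter_chunk (hw : w.Valid) (hj : j ≤ w.L) (hvL : v₀ + 2 ^ j ≤ 2 ^ w.L)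
    (hD : NodeData w D v₀ j e a) (c : ℕ) (g : ℕ → Bool)
    (hg : ∀ p ∈ chunk j e β c, g (bitmapAddr (a 0) p) = diskBit D (bitmapAddr (a 0) p)) :
    ((chunk j e β c).filter fun p => g (bitmapAddr (a 0) p) = true) =
      (members w v₀ j (c * 2 ^ (e + β)) ((c + 1) * 2 ^ (e + β))).image (w.gpos (w.L - j)) := by
  ext p
  simp only [Finset.mem_filter, Finset.mem_image, mem_members]
  constructor
  · rintro ⟨h1, h2⟩
    rw [hg p h1] at h2
    rw [chunk, Finset.mem_Ico] at h1
    obtain ⟨r, h3, h4, rfl⟩ := (hD.bitmap p (by omega)).1 h2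
    exact ⟨r, ⟨h3, h4, by omega, by omega⟩, rfl⟩
  · rintro ⟨r, ⟨h3, h4, h5, h6⟩, rfl⟩
    have h7 := w.gpos_lt hw (Nat.sub_le w.L j) (show r < 2 ^ w.L by omega)
    rw [Nat.sub_sub_self hj, ← pow_succ'] at h7
    have h8 : w.gpos (w.L - j) r ∈ chunk j e β c := by
      rw [chunk, Finset.mem_Ico]; omega
    exact ⟨h8, by rw [hg _ h8]; exact (hD.bitmap _ h7).2 ⟨r, h3, h4, rfl⟩⟩

/-- The result and the cost of processing a chunk. -/
theorem chunkTree_spec (hw : w.Valid) (hj : j ≤ w.L) (hv : 2 ^ j ∣ v₀)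
    (hvL : v₀ + 2 ^ j ≤ 2 ^ w.L) {A : ℕ → ℕ} {W fld off c : ℕ}
    (hD : NodeData w D v₀ j e fun k => A k + 4 * off) (hB : 0 < B) (hW : W ≤ 8 * B)
    (hA : ∀ k < e + 1, A k < 2 ^ W)
    (hfld : ∀ k < e + 1, ∀ i < W, diskBit D (W * (fld + k) + i) = (A k).testBit i)
    (hjB : B ≤ 2 ^ j) (hβ : B ≤ 2 ^ β) :
    (∃ E : Finset (Fin n),
      (chunkTree B hash (w.L - j) j e β W fld off c (ptrVal w v₀ j e (c * 2 ^ (e + β)))).run D =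
        (E, if (c + 1) * 2 ^ (e + β) < 2 ^ (j + 1) then
          some (.node (c + 1) (ptrVal w v₀ j e ((c + 1) * 2 ^ (e + β)))) else none) ∧
      ∀ i, i ∈ E ↔ ∃ r ∈ members w v₀ j (c * 2 ^ (e + β)) ((c + 1) * 2 ^ (e + β)),
        NodeMatch w j e (hash i) r) ∧
    ((chunkTree B hash (w.L - j) j e β W fld off c (ptrVal w v₀ j e (c * 2 ^ (e + β)))).cost D + 1)
      * B ≤ 19 * (e + 1) * min (2 ^ (e + β)) (2 ^ (j + 1)) := by
  obtain ⟨a, ha⟩ : ∃ a, a = (readNums B W fld (e + 1)).run D := ⟨_, rfl⟩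
  have haA : ∀ k < e + 1, a k = A k := fun k hk => by
    rw [ha]; exact run_readNums D W fld A (e + 1) hA hfld k hk
  have hcostA := cost_readNums D fld hB hW (e + 1)
  have hD : NodeData w D v₀ j e fun k => a k + 4 * off :=
    ⟨by simpa only [haA 0 (by omega)] using hD.bitmap,
      fun k hk => by simpa only [haA k (by omega)] using hD.child k hk,
      fun k hk => by simpa only [haA k (by omega)] using hD.fresh k hk⟩
  obtain ⟨g, hg⟩ : ∃ g, g =
    (readAt B ((chunk j e β c).image (bitmapAddr (a 0 + 4 * off)))).run D := ⟨_, rfl⟩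
  have hgD : ∀ p ∈ chunk j e β c,
      g (bitmapAddr (a 0 + 4 * off) p) = diskBit D (bitmapAddr (a 0 + 4 * off) p) := fun p hp => by
    rw [hg, run_readAt _ _ _ (Finset.mem_image_of_mem _ hp)]
  have hO := filter_chunk (β := β) hw hj hvL hD c g hgD
  have hpp : c * 2 ^ (e + β) ≤ (c + 1) * 2 ^ (e + β) := Nat.mul_le_mul_right _ (by omega)
  have hrun := run_levels hw hj hv hvL hD (P := c * 2 ^ (e + β)) (P' := (c + 1) * 2 ^ (e + β))
    (k := e) le_rfl
  have hcost := cost_levels hw hj hv hvL hD (P := c * 2 ^ (e + β)) (P' := (c + 1) * 2 ^ (e + β))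
    (k := e) le_rfl
  have hmem : (members w v₀ j (c * 2 ^ (e + β)) ((c + 1) * 2 ^ (e + β))).card ≤ 2 ^ (e + β) := by
    have h1 : (members w v₀ j (c * 2 ^ (e + β)) ((c + 1) * 2 ^ (e + β))).card ≤
        (Finset.Ico (c * 2 ^ (e + β)) ((c + 1) * 2 ^ (e + β))).card := by
      refine Finset.card_le_card_of_injOn (w.gpos (w.L - j)) (fun r hr => ?_) fun r hr r' hr' h => ?_
      · have := mem_members.1 hr
        exact Finset.mem_coe.2 (Finset.mem_Ico.2 this.2.2)
      · have h1 := mem_members.1 hr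
        have h2 := mem_members.1 hr'
        exact gpos_injOn hw hj hv hvL ⟨h1.1, h1.2.1⟩ ⟨h2.1, h2.2.1⟩ h
    rwa [Nat.card_Ico, ← Nat.sub_mul, Nat.add_sub_cancel_left, one_mul] at h1
  have hcostG : (((chunk j e β c).image (bitmapAddr (a 0 + 4 * off))).image (· / B)).card * B ≤
      2 * min (2 ^ (e + β)) (2 ^ (j + 1)) + 1 + 2 * B := by
    refine card_blocks_mul_le _ (a 0 + 4 * off + 2 * (c * 2 ^ (e + β)) - 1) _ fun y hy => ?_
    obtain ⟨p, hp, rfl⟩ := Finset.mem_image.1 hy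
    rw [chunk, Finset.mem_Ico, add_mul, one_mul] at hp
    rw [bitmapAddr]
    omega
  constructor
  · refine ⟨_, ?_, mem_chunkEmit hw hj hv hvL _ fun r hr k hk => (hrun r hr).2 k hk⟩
    simp only [chunkTree, Tree.run_bind, Tree.run_ret, ← ha, ← hg, hO]
    rw [advance_eq hw hj hv hvL hpp _ fun r hr => (hrun r hr).1]
  · simp only [chunkTree, Tree.cost_bind, Tree.cost_ret, cost_readAt, ← ha, ← hg, hO]
    set x := ((levels B j (fun k => a k + 4 * off) (ptrVal w v₀ j e (c * 2 ^ (e + β)))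
      ((members w v₀ j (c * 2 ^ (e + β)) ((c + 1) * 2 ^ (e + β))).image (w.gpos (w.L - j)))
      e).cost D) with hx
    set y := (((chunk j e β c).image (bitmapAddr (a 0 + 4 * off))).image (· / B)).card with hy
    set z := (readNums B W fld (e + 1)).cost D with hz
    have hz' : z * B ≤ (e + 1) * 10 * B := Nat.mul_le_mul_right _ hcostA
    have hexp : (z + (y + (x + 0)) + 1) * B = z * B + y * B + x * B + B := by ring
    rw [hexp]
    rcases le_total (2 ^ (e + β)) (2 ^ (j + 1)) with hm | hm
    · rw [min_eq_left hm] at hcostG ⊢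
      have h1 : 2 ^ e * B ≤ 2 ^ (e + β) := by rw [pow_add]; exact Nat.mul_le_mul_left _ hβ
      have h2 : B ≤ 2 ^ (e + β) := (Nat.le_mul_of_pos_left B (Nat.two_pow_pos e)).trans h1
      have h3 : x * B ≤ e * (6 * 2 ^ (e + β)) := hcost.1.trans (Nat.mul_le_mul_left _ (by
        have : 2 * B * 2 ^ e = 2 * (2 ^ e * B) := by ring
        omega))
      have h4 : (e + 1) * 10 * B ≤ (e + 1) * 10 * 2 ^ (e + β) := Nat.mul_le_mul_left _ h2
      nlinarith
    · rw [min_eq_right hm] at hcostG ⊢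
      have h1 : 2 ^ (j + 1) = 2 * 2 ^ j := pow_succ' _ _
      have h3 : x * B ≤ e * (3 * 2 ^ (j + 1)) := hcost.2.trans (Nat.mul_le_mul_left _ (by omega))
      have h4 : (e + 1) * 10 * B ≤ (e + 1) * 10 * 2 ^ (j + 1) :=
        Nat.mul_le_mul_left _ (by omega)
      nlinarith

/-- The pass through a node from a chunk on, where `t` chunks are left. -/
theorem taskRun_chunks (hw : w.Valid) (hj : j ≤ w.L) (hv : 2 ^ j ∣ v₀)
    (hvL : v₀ + 2 ^ j ≤ 2 ^ w.L) {A : ℕ → ℕ} {W X T₀ fld off : ℕ}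
    (hD : NodeData w D v₀ j e fun k => A k + 4 * off) (hB : 0 < B) (hW : W ≤ 8 * B)
    (hLW : w.L + 1 < W) (hA : ∀ k < e + 1, A k < 2 ^ W)
    (hfld : ∀ k < e + 1, ∀ i < W, diskBit D (W * (fld + k) + i) = (A k).testBit i)
    (hjB : B ≤ 2 ^ j) (hβ : B ≤ 2 ^ β) (hX : 2 ^ (e + 1) ≤ X)
    {q : ℕ} (hq : 19 * (e + 1) * min (2 ^ (e + β)) (2 ^ (j + 1)) / B ≤ q) (hT : q ≤ T₀)
    (t c : ℕ) (ht : 2 ^ (j + 1) ≤ (c + t) * 2 ^ (e + β)) (hc : c * 2 ^ (e + β) < 2 ^ (j + 1))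
    {x : Inner} (hx : nodeStep B hash (w.L - j) j e β W fld off x =
      chunkTree B hash (w.L - j) j e β W fld off c (ptrVal w v₀ j e (c * 2 ^ (e + β)))) :
    ∃ E : Finset (Fin n),
      TaskRun (nodeStep B hash (w.L - j) j e β W fld off) (Inner.Good w.L W X) T₀ D x E (t * q) ∧
      ∀ i, i ∈ E ↔ ∃ r ∈ members w v₀ j (c * 2 ^ (e + β)) (2 ^ (j + 1)),
        NodeMatch w j e (hash i) r := by
  induction t generalizing c x with
  | zero => rw [add_zero] at ht; omega
  | succ t ih =>
    obtain ⟨⟨E, h1, h2⟩, h3⟩ := chunkTree_spec (hash := hash) hw hj hv hvL hD hB hW hA hfld hjB hβ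
    have h4 := ((Nat.le_div_iff_mul_le hB).2 h3).trans hq
    rw [← hx] at h1 h4
    by_cases h5 : (c + 1) * 2 ^ (e + β) < 2 ^ (j + 1)
    · rw [if_pos h5] at h1
      obtain ⟨F, h6, h7⟩ := ih (c + 1) (by rwa [show c + 1 + t = c + (t + 1) by ring]) h5
        (x := .node (c + 1) (ptrVal w v₀ j e ((c + 1) * 2 ^ (e + β)))) rfl
      have hjW : 2 ^ (j + 1) < 2 ^ W := Nat.pow_lt_pow_right (by norm_num) (by omega)
      have hgood : Inner.Good w.L W X (.node (c + 1) (ptrVal w v₀ j e ((c + 1) * 2 ^ (e + β)))) := by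
        refine ⟨?_, fun y => ⟨?_, fun hy => ptrVal_of_le _ _ _ _ _ (hX.trans hy)⟩⟩
        · have := Nat.le_mul_of_pos_right (c + 1) (Nat.two_pow_pos (e + β))
          omega
        · have := ptrVal_le w v₀ j e ((c + 1) * 2 ^ (e + β)) y
          rw [pow_succ] at hjW
          omega
      refine ⟨E ∪ F, .next (by omega) h1 hgood h6 (by rw [add_mul, one_mul]; omega), fun i => ?_⟩
      rw [Finset.mem_union, h2, h7]
      simp only [mem_members]
      have h8 : c * 2 ^ (e + β) ≤ (c + 1) * 2 ^ (e + β) := Nat.mul_le_mul_right _ (by omega)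
      constructor
      · rintro (⟨r, h, h'⟩ | ⟨r, h, h'⟩)
        · exact ⟨r, by omega, h'⟩
        · exact ⟨r, by omega, h'⟩
      · rintro ⟨r, h, h'⟩
        by_cases h9 : w.gpos (w.L - j) r < (c + 1) * 2 ^ (e + β)
        · exact Or.inl ⟨r, by omega, h'⟩
        · exact Or.inr ⟨r, by omega, h'⟩
    · rw [if_neg h5] at h1
      refine ⟨E, .last (by omega) h1 (by rw [add_mul, one_mul]; omega), fun i => ?_⟩
      rw [h2]
      simp only [mem_members]
      constructor
      · rintro ⟨r, h, h'⟩
        have h7 := w.gpos_lt hw (Nat.sub_le w.L j) (show r < 2 ^ w.L by omega)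
        rw [Nat.sub_sub_self hj, ← pow_succ'] at h7
        exact ⟨r, by omega, h'⟩
      · rintro ⟨r, h, h'⟩
        exact ⟨r, by omega, h'⟩

/-- A node task: the whole node, from the start. -/
theorem taskRun_node (hw : w.Valid) (hj : j ≤ w.L) (hv : 2 ^ j ∣ v₀)
    (hvL : v₀ + 2 ^ j ≤ 2 ^ w.L) {A : ℕ → ℕ} {W X T₀ fld off : ℕ}
    (hD : NodeData w D v₀ j e fun k => A k + 4 * off) (hB : 0 < B) (hW : W ≤ 8 * B)
    (hLW : w.L + 1 < W) (hA : ∀ k < e + 1, A k < 2 ^ W)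
    (hfld : ∀ k < e + 1, ∀ i < W, diskBit D (W * (fld + k) + i) = (A k).testBit i)
    (hjB : B ≤ 2 ^ j) (hβ : B ≤ 2 ^ β) (hβ' : 2 ^ β ≤ 2 * B) (hX : 2 ^ (e + 1) ≤ X)
    (hT : 38 * (e + 1) * 2 ^ e ≤ T₀) :
    ∃ E : Finset (Fin n),
      TaskRun (nodeStep B hash (w.L - j) j e β W fld off) (Inner.Good w.L W X) T₀ D .fresh E
        (38 * (e + 1) * 2 ^ j / B) ∧
      ∀ i, i ∈ E ↔ ∃ r, v₀ ≤ r ∧ r < v₀ + 2 ^ j ∧ NodeMatch w j e (hash i) r := by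
  have hmin : ∃ t, 2 ^ (j + 1) ≤ (0 + t) * 2 ^ (e + β) ∧
      t * min (2 ^ (e + β)) (2 ^ (j + 1)) = 2 ^ (j + 1) := by
    rcases le_total (e + β) (j + 1) with h | h
    · have e1 : 2 ^ (j + 1 - (e + β)) * 2 ^ (e + β) = 2 ^ (j + 1) := by
        rw [← pow_add]; congr 1; omega
      refine ⟨2 ^ (j + 1 - (e + β)), ?_, ?_⟩
      · rw [zero_add, e1]
      · rw [min_eq_left (Nat.pow_le_pow_right (by norm_num) h), e1]
    · have := Nat.pow_le_pow_right (n := 2) (by norm_num) h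
      exact ⟨1, by omega, by rw [min_eq_right this, one_mul]⟩
  obtain ⟨t, h1, h2⟩ := hmin
  set K := min (2 ^ (e + β)) (2 ^ (j + 1)) with hK
  have hKB : K ≤ 2 ^ e * (2 * B) := by
    refine (min_le_left _ _).trans ?_
    rw [pow_add]
    exact Nat.mul_le_mul_left _ hβ'
  have hq : 19 * (e + 1) * K / B ≤ T₀ := by
    refine le_trans (Nat.div_le_of_le_mul ?_) hT
    calc 19 * (e + 1) * K ≤ 19 * (e + 1) * (2 ^ e * (2 * B)) := Nat.mul_le_mul_left _ hKB
      _ = B * (38 * (e + 1) * 2 ^ e) := by ring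
  have hptr : ptrVal w v₀ j e (0 * 2 ^ (e + β)) = fun _ => 0 := by
    funext x
    simp [ptrVal]
  obtain ⟨E, h3, h4⟩ := taskRun_chunks (hash := hash) hw hj hv hvL hD hB hW hLW hA hfld hjB hβ hX
    le_rfl hq t 0 h1 (by rw [zero_mul]; exact Nat.two_pow_pos _) (x := .fresh)
    (by rw [nodeStep, hptr])
  refine ⟨E, h3.mono ?_, fun i => ?_⟩
  · rw [Nat.le_div_iff_mul_le hB]
    calc t * (19 * (e + 1) * K / B) * B ≤ t * (19 * (e + 1) * K) := by
          rw [mul_assoc]; exact Nat.mul_le_mul_left _ (Nat.div_mul_le_self _ _)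
      _ = 19 * (e + 1) * (t * K) := by ring
      _ = 38 * (e + 1) * 2 ^ j := by rw [h2, pow_succ]; ring
  · rw [h4]
    simp only [mem_members]
    refine exists_congr fun r => ?_
    constructor
    · rintro ⟨⟨h5, h6, -⟩, h7⟩; exact ⟨h5, h6, h7⟩
    · rintro ⟨h5, h6, h7⟩
      have h8 := w.gpos_lt hw (Nat.sub_le w.L j) (show r < 2 ^ w.L by omega)
      rw [Nat.sub_sub_self hj, ← pow_succ'] at h8
      exact ⟨⟨h5, h6, by omega, h8⟩, h7⟩

end NodeCorrect

/-! ### Lists of bits on the disk -/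

/-- The list of bits stands on the disk from a bit address on. -/
def ListAt {B : ℕ} (D : Disk B) (a : ℕ) (l : List Bool) : Prop :=
  ∀ i, (hi : i < l.length) → diskBit D (a + i) = l[i]

theorem ListAt.left {B : ℕ} {D : Disk B} {a : ℕ} {l l' : List Bool} (h : ListAt D a (l ++ l')) :
    ListAt D a l := by
  intro i hi
  rw [h i (by rw [List.length_append]; omega), List.getElem_append_left hi]

theorem ListAt.right {B : ℕ} {D : Disk B} {a : ℕ} {l l' : List Bool} (h : ListAt D a (l ++ l')) :
    ListAt D (a + l.length) l' := by
  intro i hi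
  rw [add_assoc, h _ (by rw [List.length_append]; omega)]
  simp

theorem listAt_ofBits {B : ℕ} (hB : 0 < B) (l l' l'' : List Bool) :
    ListAt (Disk.ofBits B (l ++ l' ++ l'')) l.length l' := by
  intro i hi
  rw [diskBit_ofBits hB, List.getD_eq_getElem?_getD, List.append_assoc,
    List.getElem?_append_right (by omega), Nat.add_sub_cancel_left,
    List.getElem?_append_left hi, List.getElem?_eq_getElem hi]
  rfl

theorem listAt_flatMap {B : ℕ} {D : Disk B} {a s l : ℕ} (f : ℕ → List Bool)
    (h : ListAt D a ((List.range' s l).flatMap f)) (c : ℕ)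
    (hf : ∀ r, s ≤ r → r < s + l → (f r).length = c) {r : ℕ} (h1 : s ≤ r) (h2 : r < s + l) :
    ListAt D (a + c * (r - s)) (f r) := by
  obtain ⟨k, rfl⟩ := Nat.exists_eq_add_of_le h1
  obtain ⟨l', hl⟩ : ∃ l', l = k + (1 + l') := ⟨l - k - 1, by omega⟩
  rw [hl, ← List.range'_append_1, List.flatMap_append, ← List.range'_append_1, List.flatMap_append]
    at h
  have h3 := h.right.left
  have h4 : ∀ k' ≤ k, ((List.range' s k').flatMap f).length = c * k' := by
    intro k' hk'
    induction k' with
    | zero => simp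
    | succ k' ih =>
      rw [List.range'_1_concat, List.flatMap_append, List.length_append, ih (by omega)]
      simp [hf (s + k') (by omega) (by omega)]
      ring
  rw [h4 k le_rfl] at h3
  simpa using h3

/-! ### The levels -/

namespace World

variable (w : World)

open Classical in
/-- What is recorded for a slot at level `d`, if the slot is deep enough: two bits of the bitmaps
of this level, and the next branching and the fresh hash bit of the element in the slot. -/
noncomputable def levelCode (d r : ℕ) : List Bool :=
  if d ≤ 2 * w.dep r then
    [decide (∃ x < 2 ^ w.L, 2 * w.nodeStart d x + w.gpos d x = 2 * r),
      decide (∃ x < 2 ^ w.L, 2 * w.nodeStart d x + w.gpos d x = 2 * r + 1),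
      decide (∃ x < 2 ^ w.L, w.slot d x = r ∧ w.node (d + 1) x % 2 = 1),
      decide (∃ x < 2 ^ w.L, w.slot d x = r ∧ (w.key x).testBit (freshBit d) = true)]
  else []

theorem length_levelCode (d r : ℕ) :
    (w.levelCode d r).length = if d ≤ 2 * w.dep r then 4 else 0 := by
  rw [levelCode]; split_ifs <;> rfl

end World

theorem nodeData_of_levels {B : ℕ} {w : World} {D : Disk B} {v₀ j e s : ℕ} {A : ℕ → ℕ}
    (hw : w.Valid) (hj : j ≤ w.L) (hv : 2 ^ j ∣ v₀) (hvL : v₀ + 2 ^ j ≤ 2 ^ w.L) (hs : s ≤ v₀)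
    (he : e ≤ w.L - j) (hdep : ∀ r, s ≤ r → r < v₀ + 2 ^ j → w.L - j ≤ w.dep r)
    (hA : ∀ k < e + 1,
      ListAt D (A k) ((List.range' s (v₀ + 2 ^ j - s)).flatMap (w.levelCode (w.L - j + k)))) :
    NodeData w D v₀ j e fun k => A k + 4 * (v₀ - s) := by
  classical
  have hbits : ∀ k < e + 1, ∀ r, s ≤ r → r < v₀ + 2 ^ j →
      ListAt D (A k + 4 * (r - s)) (w.levelCode (w.L - j + k) r) := by
    intro k hk r h1 h2
    refine listAt_flatMap _ (hA k hk) 4 (fun r h1 h2 => ?_) h1 (by omega)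
    have := hdep r h1 (by omega)
    rw [w.length_levelCode, if_pos (by omega)]
  have hcode : ∀ k < e + 1, ∀ r, s ≤ r → r < v₀ + 2 ^ j → w.L - j + k ≤ 2 * w.dep r := by
    intro k hk r h1 h2
    have := hdep r h1 h2
    omega
  have hslot : ∀ r, v₀ ≤ r → r < v₀ + 2 ^ j → ∀ k, v₀ ≤ w.slot (w.L - j + k) r ∧
      w.slot (w.L - j + k) r < v₀ + 2 ^ j := fun r h1 h2 k => slot_lt hj hv hvL h1 h2 k
  have hpos := Nat.two_pow_pos j
  constructor
  · intro p hp
    rw [pow_succ] at hp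
    have h1 := hbits 0 (by omega) (v₀ + p / 2) (by omega) (by omega)
    have h2 := hcode 0 (by omega) (v₀ + p / 2) (by omega) (by omega)
    rw [World.levelCode, if_pos h2] at h1
    have key : diskBit D (bitmapAddr (A 0 + 4 * (v₀ - s)) p) =
        decide (∃ x < 2 ^ w.L, 2 * w.nodeStart (w.L - j) x + w.gpos (w.L - j) x = 2 * v₀ + p) := by
      rcases Nat.mod_two_eq_zero_or_one p with h3 | h3
      · have h4 := h1 0 (by simp)
        rw [show bitmapAddr (A 0 + 4 * (v₀ - s)) p = A 0 + 4 * (v₀ + p / 2 - s) + 0 by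
          rw [bitmapAddr]; omega, h4]
        simp only [List.getElem_cons_zero, add_zero]
        rw [show 2 * (v₀ + p / 2) = 2 * v₀ + p by omega]
      · have h4 := h1 1 (by simp)
        rw [show bitmapAddr (A 0 + 4 * (v₀ - s)) p = A 0 + 4 * (v₀ + p / 2 - s) + 1 by
          rw [bitmapAddr]; omega, h4]
        simp only [List.getElem_cons_succ, List.getElem_cons_zero, add_zero]
        rw [show 2 * (v₀ + p / 2) + 1 = 2 * v₀ + p by omega]
    rw [key, decide_eq_true_eq]
    constructor
    · rintro ⟨x, hx, h3⟩
      have h4 := w.gpos_lt hw (Nat.sub_le w.L j) hx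
      rw [Nat.sub_sub_self hj] at h4
      have h5 : w.nodeStart (w.L - j) x = v₀ := by
        have h6 : 2 ^ j ∣ w.nodeStart (w.L - j) x := by
          rw [w.nodeStart_eq (Nat.sub_le _ _), Nat.sub_sub_self hj]
          exact Dvd.intro_left _ rfl
        rcases le_total (w.nodeStart (w.L - j) x) v₀ with h7 | h7
        · exact eq_of_dvd_of_lt h6 hv h7 (by omega)
        · exact (eq_of_dvd_of_lt hv h6 h7 (by omega)).symm
      have h6 : w.node (w.L - j) x = v₀ / 2 ^ j := by
        rw [← h5, w.nodeStart_eq (Nat.sub_le _ _), w.node_eq_div (Nat.sub_le _ _),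
          Nat.sub_sub_self hj, Nat.mul_div_cancel _ hpos]
      have h7 := (World.node_eq_iff_mem hj hv).1 h6
      exact ⟨x, h7.1, h7.2, by omega⟩
    · rintro ⟨r, h3, h4, rfl⟩
      refine ⟨r, by omega, ?_⟩
      have h5 := World.nodeStart_add hj hv h3 h4 0
      rw [World.heapIdx_zero] at h5
      simp only [pow_zero, Nat.sub_self, zero_mul, Nat.zero_div, add_zero] at h5
      rw [h5]
  · intro k hk r h1 h2
    have h3 := hslot r h1 h2 k
    have h4 := hbits k (by omega) _ (hs.trans h3.1) h3.2
    rw [World.levelCode, if_pos (hcode k (by omega) _ (hs.trans h3.1) h3.2)] at h4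
    have h5 := h4 2 (by simp)
    rw [show A k + 4 * (v₀ - s) + 4 * (w.slot (w.L - j + k) r - v₀) + 2 =
      A k + 4 * (w.slot (w.L - j + k) r - s) + 2 by omega, h5]
    simp only [List.getElem_cons_succ, List.getElem_cons_zero, decide_eq_decide]
    constructor
    · rintro ⟨x, hx, h6, h7⟩
      rwa [w.slot_inj hw hx (by omega) h6] at h7
    · intro h6
      exact ⟨r, by omega, rfl, h6⟩
  · intro k hk r h1 h2
    have h3 := hslot r h1 h2 k
    have h4 := hbits k (by omega) _ (hs.trans h3.1) h3.2
    rw [World.levelCode, if_pos (hcode k (by omega) _ (hs.trans h3.1) h3.2)] at h4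
    have h5 := h4 3 (by simp)
    rw [show A k + 4 * (v₀ - s) + 4 * (w.slot (w.L - j + k) r - v₀) + 3 =
      A k + 4 * (w.slot (w.L - j + k) r - s) + 3 by omega, h5]
    simp only [List.getElem_cons_succ, List.getElem_cons_zero]
    rw [Bool.eq_iff_iff, decide_eq_true_eq]
    constructor
    · rintro ⟨x, hx, h6, h7⟩
      rwa [w.slot_inj hw hx (by omega) h6] at h7
    · intro h6
      exact ⟨r, by omega, rfl, h6⟩

/-! ### Groups of scans -/

section Group

variable {n B : ℕ} {hash : Fin n → ℕ} {w : World} {D : Disk B}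

theorem length_pieceCode_le_mul (w : World) (g j r : ℕ) :
    (w.pieceCode g j r).length ≤ 2 ^ w.kap g r * (2 ^ j + 4) := by
  refine (w.length_pieceCode_le g j r).trans ?_
  have h1 : w.kap g r + 1 ≤ 2 ^ w.kap g r := Nat.lt_two_pow_self
  have h2 : 2 ^ w.kap g r * (lowLen j (w.L - w.kap g r) + 3) ≤ 2 ^ w.kap g r * (2 ^ j + 3) :=
    Nat.mul_le_mul_left _ (by have := min_le_left (2 ^ j) (w.L - w.kap g r); rw [lowLen]; omega)
  have h3 : 2 ^ w.kap g r * (2 ^ j + 4) = 2 ^ w.kap g r * (2 ^ j + 3) + 2 ^ w.kap g r := by ring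
  split_ifs <;> omega

/-- The lowest hash bit that a query with top accuracy `jj` sees of the element of rank `r`. -/
noncomputable def groupCut (w : World) (g jj r : ℕ) : ℕ := w.L - w.kap g r - 2 ^ jj

theorem exists_emits (w : World) (g jj r : ℕ) :
    ∃ j ≤ jj, w.Emits g j jj r ∧ w.cut g j r = groupCut w g jj r := by
  set d := w.L - w.kap g r with hd
  by_cases h : d ≤ 2 ^ jj
  · have hex : ∃ j, d ≤ 2 ^ j := ⟨jj, h⟩
    classical
    refine ⟨Nat.find hex, Nat.find_min' hex h, ⟨?_, Or.inr (Nat.find_spec hex)⟩, ?_⟩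
    · rcases Nat.eq_zero_or_pos (Nat.find hex) with h0 | h0
      · exact Or.inl h0
      · right
        have := Nat.find_min hex (Nat.sub_lt h0 one_pos)
        rw [← hd]
        obtain ⟨y, hy⟩ : ∃ y, Nat.find hex = y + 1 := ⟨Nat.find hex - 1, by omega⟩
        rw [hy, Nat.add_sub_cancel] at this
        rw [hy, pow_succ]
        omega
    · have := Nat.find_spec hex
      rw [World.cut, groupCut, ← hd, lowLen, min_eq_right this]
      omega
  · refine ⟨jj, le_rfl, ⟨Or.inr (by omega), Or.inl rfl⟩, ?_⟩
    rw [World.cut, groupCut, ← hd, lowLen, min_eq_left (by omega)]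

theorem cut_eq_groupCut {w : World} {g j jj r : ℕ} (hj : j ≤ jj) (h : w.Emits g j jj r) :
    w.cut g j r = groupCut w g jj r := by
  rw [World.cut, groupCut, lowLen]
  rcases h.2 with rfl | h2
  · omega
  · have := Nat.pow_le_pow_right (n := 2) (by norm_num) hj
    omega

/-- A scan task over the pieces between `ceilPow g s` and a later end of a piece. -/
theorem exists_taskRun_array (hw : w.Valid) {g j jj r₁ i W X T₀ fld a : ℕ} (hg : g ≤ w.L)
    (hi : i ≤ w.m) (hr₁ : r₁ ≤ 2 ^ w.L) (h : ceilPow g (w.b i) ≤ r₁)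
    (hend : ∀ r, ceilPow g (w.b i) ≤ r → w.IsStart g r → r < r₁ → r + 2 ^ w.kap g r ≤ r₁)
    (hB : 0 < B) (hW : W ≤ 8 * B) (hT₀ : 10 ≤ T₀)
    (hat : ListAt D a ((List.range' (w.b i) (r₁ - w.b i)).flatMap (w.pieceCode g j)))
    (ha : a + ((List.range' (w.b i) (r₁ - w.b i)).flatMap (w.pieceCode g j)).length < 2 ^ W)
    (hfld : ∀ i < W, diskBit D (W * fld + i) = a.testBit i) :
    ∃ E : Finset (Fin n),
      TaskRun (scanStep hash w.L j jj r₁ W fld (ceilPow g (w.b i))) (Inner.Good w.L W X) T₀ D .fresh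
        E (15 + 2 * ((r₁ - ceilPow g (w.b i)) * (2 ^ j + 4) / B)) ∧
      ∀ y, y ∈ E ↔ ∃ x, ceilPow g (w.b i) ≤ x ∧ x < r₁ ∧ w.Emits g j jj x ∧
        hash y / 2 ^ w.cut g j x = w.key x / 2 ^ w.cut g j x := by
  have hstart : w.IsStart g (ceilPow g (w.b i)) := w.isStart_ceilPow hi
  have hle := le_ceilPow g (w.b i)
  obtain ⟨E, h1, h2⟩ := World.path_scan (hash := hash) (jj := jj) (j := j) hw hg hr₁ hstart h hend
  have hlen := World.length_scan_le (w := w) (g := g) (j := j) (r₁ := r₁) (fun _ => 2 ^ j + 4)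
    (length_pieceCode_le_mul w g j) hstart h hend
  rw [Finset.sum_const, smul_eq_mul, Nat.card_Ico] at hlen
  have hsplit : (List.range' (w.b i) (r₁ - w.b i)).flatMap (w.pieceCode g j) =
      (List.range' (ceilPow g (w.b i)) (r₁ - ceilPow g (w.b i))).flatMap (w.pieceCode g j) := by
    have e : List.range' (w.b i) (r₁ - w.b i) =
        List.range' (w.b i) (ceilPow g (w.b i) - w.b i) ++
          List.range' (ceilPow g (w.b i)) (r₁ - ceilPow g (w.b i)) := by
      have := List.range'_append_1 (s := w.b i) (m := ceilPow g (w.b i) - w.b i)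
        (n := r₁ - ceilPow g (w.b i))
      rw [show w.b i + (ceilPow g (w.b i) - w.b i) = ceilPow g (w.b i) by omega] at this
      rw [this]
      congr 1
      omega
    rw [e, List.flatMap_append, World.flatMap_range'_eq_nil, List.nil_append]
    intro x hx1 hx2
    rw [World.pieceCode, if_neg]
    intro hx
    -- a start of a piece is a multiple of `2 ^ g`
    have h3 : 2 ^ g ∣ x := (pow_dvd_pow 2 (le_max_left _ _)).trans hx
    have := ceilPow_le hx1 h3
    omega
  rw [hsplit] at hat ha
  refine ⟨E, (taskRun_scan_fresh (c := 8) hB hW hT₀ h1 (by omega) hat ha hfld).mono ?_, h2⟩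
  have := Nat.div_le_div_right (c := B) hlen
  omega

end Group

/-! ### The tasks of one half of a query -/

/-- The parameters of the machine: the exponent of the number of ranks, the block size, the largest
accuracy for which a node is processed, the logarithm of the number of pieces, and the length of
the numbers in the table. -/
structure Params where
  L : ℕ
  B : ℕ
  E₀ : ℕ
  ν : ℕ
  W : ℕ

namespace Params

variable (pr : Params)

/-- The exponent of the block size. -/
def β : ℕ := Nat.clog 2 pr.B

/-- The exponent of the number of hash values of `L` bits that fit into a block. -/
def g : ℕ := min (Nat.log 2 (pr.B / pr.L)) pr.L

/-- The top accuracy of the scans: it is exact. -/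
def Jm : ℕ := Nat.clog 2 pr.L

/-- The top accuracy of a group of scans that is to distinguish hash values on `e` bits. -/
def grpExp (e : ℕ) : ℕ := min (Nat.clog 2 e) pr.Jm

/-- Below this exponent, a query with `z` results and accuracy `e` scans pieces, and from it on it
processes nodes: these have at least the size of a block, and an accuracy of at most `E₀`. -/
def cutExp (z e : ℕ) : ℕ :=
  min (Nat.log 2 z + 1) (max pr.β (Nat.log 2 z + 1 + 1 + e - pr.E₀))

/-- The accuracy for the node of size `2 ^ j`: the smaller nodes together have a share of the error
probability that decreases geometrically with their size. -/
def nodeAcc (z e j : ℕ) : ℕ := min (e + 2 + (Nat.log 2 z - j)) (pr.L - j)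

end Params

/-- A task: the scan of an array of piece codes of minimal piece size `2 ^ g` at accuracy `j`, or
the pass through a node. -/
inductive Task
  | scan (fld g j jj r₀ r₁ : ℕ)
  | node (fld off j e : ℕ)

namespace Params

variable (pr : Params)

/-- The scans, of all accuracies up to the one needed, over an interval of ranks. -/
def groupTasks (fld g r₀ r₁ e : ℕ) : List Task :=
  (List.range (pr.grpExp e + 1)).map fun j => .scan (fld + j) g j (pr.grpExp e) r₀ r₁

/-- The nodes of a query: the dyadic intervals between the roundings of `s`, where not empty. -/
def nodeTasks (base s z e : ℕ) : List Task :=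
  ((List.range' (pr.cutExp z e) (Nat.log 2 z + 1 - pr.cutExp z e)).filter fun j =>
    ceilPow j s < ceilPow (j + 1) s).map fun j =>
      .node (base + 1 + (pr.L - j)) (ceilPow j s - s) j (pr.nodeAcc z e j)

/-- The scans of a query. If nodes of at least the size of a block have to be replaced with scans,
the accuracy is increased by `ν`, so that the error is small even when it is summed over all pieces.
Otherwise the pieces are scanned at the minimal size `2 ^ g`, and only the fewer
than `2 ^ g` ranks before the first of them at size `1`. -/
def scanTasks (base s z e : ℕ) : List Task :=
  if pr.β < pr.cutExp z e then
    pr.groupTasks (base + (2 * pr.L + 2)) 0 (ceilPow 0 s) (ceilPow (pr.cutExp z e) s) (e + 2 + pr.ν)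
  else
    (if pr.g < pr.cutExp z e then
      pr.groupTasks (base + (3 * pr.L + 3)) pr.g (ceilPow pr.g s) (ceilPow (pr.cutExp z e) s)
        (e + 2 + (pr.β - pr.g))
    else []) ++
    pr.groupTasks (base + (2 * pr.L + 2)) 0 (ceilPow 0 s) (ceilPow (min pr.g (pr.cutExp z e)) s)
      (e + 2 + pr.g)

/-- The tasks for the ranks `s, …, s + z - 1`; the table has the addresses that belong to the
boundary `s` from the index `base` on. -/
def sideTasks (base s z e : ℕ) : List Task :=
  if z = 0 then [] else pr.nodeTasks base s z e ++ pr.scanTasks base s z e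

/-- The exponent of the node of the query to which the rank `ρ` belongs. -/
def nodeExp (s z ρ : ℕ) : ℕ := Nat.findGreatest (fun j => ceilPow j s ≤ ρ) (Nat.log 2 z)

/-- The bits on which the hash value of a position has to agree with that of the element of rank
`ρ`, in order that the position is generated. -/
noncomputable def sideBits (w : World) (s z e ρ : ℕ) : Finset ℕ :=
  if ρ < ceilPow (pr.cutExp z e) s then
    if pr.β < pr.cutExp z e then topBits pr.L (groupCut w 0 (pr.grpExp (e + 2 + pr.ν)) ρ)
    else if ρ < ceilPow (min pr.g (pr.cutExp z e)) s then
      topBits pr.L (groupCut w 0 (pr.grpExp (e + 2 + pr.g)) ρ)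
    else topBits pr.L (groupCut w pr.g (pr.grpExp (e + 2 + (pr.β - pr.g))) ρ)
  else nodeBits pr.L (pr.L - nodeExp s z ρ) (pr.nodeAcc z e (nodeExp s z ρ))

/-- One round of a task. -/
noncomputable def taskStep {n : ℕ} (hash : Fin n → ℕ) :
    Task → Inner → Tree pr.B (Finset (Fin n) × Option Inner)
  | .scan fld _ j jj r₀ r₁ => scanStep hash pr.L j jj r₁ pr.W fld r₀
  | .node fld off j e => nodeStep pr.B hash (pr.L - j) j e pr.β pr.W fld off

/-- A task generates the positions with this hash value. -/
def Hits (w : World) (s h : ℕ) : Task → Prop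
  | .scan _ g j jj r₀ r₁ => ∃ x, r₀ ≤ x ∧ x < r₁ ∧ w.Emits g j jj x ∧
      h / 2 ^ w.cut g j x = w.key x / 2 ^ w.cut g j x
  | .node _ off j e => ∃ r, s + off ≤ r ∧ r < s + off + 2 ^ j ∧ NodeMatch w j e h r

/-- The number of I/Os of a task. -/
def taskCost (B : ℕ) : Task → ℕ
  | .scan _ _ j _ r₀ r₁ => 15 + 2 * ((r₁ - r₀) * (2 ^ j + 4) / B)
  | .node _ _ j e => 38 * (e + 1) * 2 ^ j / B

/-- What the disk holds, for the rank `r`, in the section for field `f`: the levels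
`0, …, 2 L`, and the piece codes for two minimal sizes and accuracies up to `L`. Field `0` has no
section. -/
noncomputable def fieldCode (w : World) (f r : ℕ) : List Bool :=
  if f = 0 then []
  else if f < 2 * pr.L + 2 then w.levelCode (f - 1) r
  else if f < 3 * pr.L + 3 then w.pieceCode 0 (f - (2 * pr.L + 2)) r
  else w.pieceCode pr.g (f - (3 * pr.L + 3)) r

/-- The number of fields. -/
def F : ℕ := 4 * pr.L + 4

/-- The disk holds the data of a world for the boundary `s`: the sections, at addresses that are
given in the table. -/
structure SideData {B : ℕ} (w : World) (D : Disk B) (base s : ℕ) (A : ℕ → ℕ) : Prop where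
  num : ∀ f < pr.F, ∀ t < pr.W, diskBit D (pr.W * (base + f) + t) = (A f).testBit t
  at_ : ∀ f < pr.F, ListAt D (A f) ((List.range' s (2 ^ pr.L - s)).flatMap (pr.fieldCode w f))
  lt : ∀ f < pr.F,
    A f + ((List.range' s (2 ^ pr.L - s)).flatMap (pr.fieldCode w f)).length < 2 ^ pr.W

/-- The parameters are consistent. -/
structure Valid : Prop where
  L_pos : 0 < pr.L
  B_pos : 0 < pr.B
  W_le : pr.W ≤ 8 * pr.B
  L_lt : pr.L + 1 < pr.W

variable {pr}

theorem Valid.le_two_pow_β (_ : pr.Valid) : pr.B ≤ 2 ^ pr.β := Nat.le_pow_clog (by norm_num) _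

theorem Valid.two_pow_β_le (h : pr.Valid) : 2 ^ pr.β ≤ 2 * pr.B := by
  rcases Nat.lt_or_ge 1 pr.B with h1 | h1
  · have := Nat.pow_pred_clog_lt_self (b := 2) (by norm_num) h1
    have h2 := Nat.clog_pos (b := 2) (by norm_num) h1
    rw [β, ← Nat.succ_pred_eq_of_pos h2, pow_succ]
    omega
  · have := h.B_pos
    rw [β, Nat.clog_of_right_le_one h1]; omega

theorem g_le : pr.g ≤ pr.L := min_le_right _ _

theorem Jm_le : pr.Jm ≤ pr.L := Nat.clog_le_of_le_pow Nat.lt_two_pow_self.le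

theorem L_le_two_pow_Jm : pr.L ≤ 2 ^ pr.Jm := Nat.le_pow_clog (by norm_num) _

theorem nodeAcc_le {z e j : ℕ} (h1 : pr.cutExp z e ≤ j) (h2 : j < Nat.log 2 z + 1) :
    pr.nodeAcc z e j ≤ pr.E₀ := by
  have h3 : max pr.β (Nat.log 2 z + 1 + 1 + e - pr.E₀) ≤ j := by
    rcases min_le_iff.1 h1 with h | h
    · omega
    · exact h
  have h4 := (max_le_iff.1 h3).2
  exact (min_le_left _ _).trans (by omega)

theorem β_le_of_cutExp_le {z e j : ℕ} (h1 : pr.cutExp z e ≤ j) (h2 : j < Nat.log 2 z + 1) :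
    pr.β ≤ j := by
  rcases min_le_iff.1 h1 with h | h
  · omega
  · exact (le_max_left _ _).trans h

theorem flatMap_range'_split (f : ℕ → List Bool) {s r N : ℕ} (h1 : s ≤ r) (h2 : r ≤ N) :
    (List.range' s (N - s)).flatMap f =
      (List.range' s (r - s)).flatMap f ++ (List.range' r (N - r)).flatMap f := by
  rw [← List.flatMap_append]
  congr 1
  have := List.range'_append_1 (s := s) (m := r - s) (n := N - r)
  rw [show s + (r - s) = r by omega] at this
  rw [this]
  congr 1
  omega

section Run

variable {n : ℕ} {hash : Fin n → ℕ} {w : World} {D : Disk pr.B} {base i X T₀ : ℕ} {A : ℕ → ℕ}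

theorem exists_taskRun_group (hp : pr.Valid) (hL : w.L = pr.L) (hw : w.Valid) (hi : i ≤ w.m)
    (hT₁ : 10 ≤ T₀)
    (hD : pr.SideData w D base (w.b i) A) {g k e f : ℕ} (hg : g ≤ k) (hgL : g ≤ pr.L)
    (hk : ceilPow k (w.b i) ≤ 2 ^ pr.L)
    (hf : ∀ j ≤ pr.L, f + j < pr.F ∧ ∀ r, pr.fieldCode w (f + j) r = w.pieceCode g j r)
    {τ : Task} (hτ : τ ∈ pr.groupTasks (base + f) g (ceilPow g (w.b i)) (ceilPow k (w.b i)) e) :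
    ∃ E : Finset (Fin n), TaskRun (pr.taskStep hash τ) (Inner.Good pr.L pr.W X) T₀ D .fresh E
        (taskCost pr.B τ) ∧ ∀ y, y ∈ E ↔ Hits w (w.b i) (hash y) τ := by
  obtain ⟨j, hj, rfl⟩ := List.mem_map.1 hτ
  have hjL : j ≤ pr.L := by
    have h1 : pr.grpExp e ≤ pr.Jm := min_le_right _ _
    have := List.mem_range.1 hj
    have := Jm_le (pr := pr)
    omega
  obtain ⟨h1, h2⟩ := hf j hjL
  have h3 := hD.at_ _ h1
  have h4 := hD.lt _ h1
  have h5 := hD.num _ h1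
  have h6 : pr.fieldCode w (f + j) = w.pieceCode g j := funext h2
  rw [h6] at h3 h4
  rw [flatMap_range'_split _ (le_ceilPow k _) hk] at h3 h4
  rw [List.length_append] at h4
  rw [taskStep, taskCost, add_assoc base]
  rw [← hL] at hgL hk ⊢
  exact exists_taskRun_array hw hgL hi hk (ceilPow_mono hg _)
    (fun r hr1 hr2 hr3 => w.piece_le_ceilPow hr2 ((le_ceilPow _ _).trans hr1) hr3)
    hp.B_pos hp.W_le hT₁ h3.left (by omega) h5

theorem exists_taskRun (hp : pr.Valid) (hL : w.L = pr.L) (hw : w.Valid) (hi : i ≤ w.m)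
    (hT₁ : 10 ≤ T₀) (hT₂ : 38 * (pr.E₀ + 1) * 2 ^ pr.E₀ ≤ T₀) (hX : 2 ^ (pr.E₀ + 1) ≤ X)
    (hD : pr.SideData w D base (w.b i) A) {z e : ℕ}
    (hz : ceilPow (Nat.log 2 z + 1) (w.b i) ≤ 2 ^ pr.L) (hzL : Nat.log 2 z + 1 ≤ pr.L)
    {τ : Task} (hτ : τ ∈ pr.sideTasks base (w.b i) z e) :
    ∃ E : Finset (Fin n), TaskRun (pr.taskStep hash τ) (Inner.Good pr.L pr.W X) T₀ D .fresh E
        (taskCost pr.B τ) ∧ ∀ y, y ∈ E ↔ Hits w (w.b i) (hash y) τ := by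
  have hcut : pr.cutExp z e ≤ Nat.log 2 z + 1 := min_le_left _ _
  have hf0 : ∀ j ≤ pr.L, 2 * pr.L + 2 + j < pr.F ∧
      ∀ r, pr.fieldCode w (2 * pr.L + 2 + j) r = w.pieceCode 0 j r := by
    intro j hj
    refine ⟨by rw [F]; omega, fun r => ?_⟩
    rw [fieldCode, if_neg (by omega), if_neg (by omega), if_pos (by omega),
      Nat.add_sub_cancel_left]
  have hfg : ∀ j ≤ pr.L, 3 * pr.L + 3 + j < pr.F ∧
      ∀ r, pr.fieldCode w (3 * pr.L + 3 + j) r = w.pieceCode pr.g j r := by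
    intro j hj
    refine ⟨by rw [F]; omega, fun r => ?_⟩
    rw [fieldCode, if_neg (by omega), if_neg (by omega), if_neg (by omega),
      Nat.add_sub_cancel_left]
  rw [sideTasks] at hτ
  split_ifs at hτ with hz0
  · simp at hτ
  rcases List.mem_append.1 hτ with h | h
  · obtain ⟨j, hj, rfl⟩ := List.mem_map.1 h
    rw [List.mem_filter, List.mem_range'_1, decide_eq_true_eq] at hj
    obtain ⟨⟨h1, h2⟩, h3⟩ := hj
    have h2 : j < Nat.log 2 z + 1 := by omega
    have hacc := nodeAcc_le h1 h2
    have hβj := β_le_of_cutExp_le h1 h2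
    have hpow := Nat.pow_le_pow_right (n := 2) (by norm_num) hacc
    have hv : ceilPow (j + 1) (w.b i) = ceilPow j (w.b i) + 2 ^ j := by
      rcases ceilPow_succ j (w.b i) with h | h <;> omega
    have hvL : ceilPow j (w.b i) + 2 ^ j ≤ 2 ^ pr.L := by
      rw [← hv]; exact (ceilPow_mono (by omega) _).trans hz
    have hs := le_ceilPow j (w.b i)
    have hle : pr.nodeAcc z e j ≤ pr.L - j := min_le_right _ _
    have hfield : ∀ k < pr.nodeAcc z e j + 1, 1 + (pr.L - j) + k < pr.F ∧
        pr.fieldCode w (1 + (pr.L - j) + k) = w.levelCode (w.L - j + k) := by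
      intro k hk
      refine ⟨by rw [F]; omega, funext fun r => ?_⟩
      rw [fieldCode, if_neg (by omega), if_pos (by omega), hL]
      congr 1
      omega
    have hdep : ∀ r, w.b i ≤ r → r < ceilPow j (w.b i) + 2 ^ j → w.L - j ≤ w.dep r := by
      intro r hr1 hr2
      have := w.kmono_lt (w.not_mono_of_mem hi hr1 (k := j + 1) (by omega))
      rw [World.dep]
      omega
    have hdata := nodeData_of_levels (D := D) (e := pr.nodeAcc z e j) (A := fun k => A (1 + (pr.L - j) + k)) hw (by omega)
      (dvd_ceilPow j (w.b i)) (by rw [hL]; exact hvL) hs (by rw [hL]; exact hle) hdep (by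
        intro k hk
        have h4 := hD.at_ _ (hfield k hk).1
        rw [(hfield k hk).2, flatMap_range'_split _ (hs.trans (Nat.le_add_right _ (2 ^ j))) hvL]
          at h4
        exact h4.left)
    have hlt : ∀ k < pr.nodeAcc z e j + 1, A (1 + (pr.L - j) + k) < 2 ^ pr.W := fun k hk => by
      have := hD.lt _ (hfield k hk).1
      omega
    obtain ⟨E, h5, h6⟩ := taskRun_node (hash := hash) (T₀ := T₀) (X := X) hw (by omega)
      (dvd_ceilPow j (w.b i)) (by rw [hL]; exact hvL) hdata hp.B_pos hp.W_le
      (by rw [hL]; exact hp.L_lt) hlt (fld := base + 1 + (pr.L - j)) (by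
        intro k hk t ht
        rw [← hD.num _ (hfield k hk).1 t ht]
        congr 2
        ring) (hp.le_two_pow_β.trans (Nat.pow_le_pow_right (by norm_num) hβj)) hp.le_two_pow_β
      hp.two_pow_β_le (le_trans (Nat.pow_le_pow_right (by norm_num) (by omega)) hX)
      (le_trans (Nat.mul_le_mul (by omega) hpow) hT₂)
    refine ⟨E, ?_, fun y => ?_⟩
    · rw [taskStep, taskCost, ← hL]
      rwa [← hL] at h5
    · rw [h6, Hits, Nat.add_sub_cancel' hs]
  · rw [scanTasks] at h
    split_ifs at h with h1 h2
    · exact exists_taskRun_group hp hL hw hi hT₁ hD (Nat.zero_le _) (Nat.zero_le _)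
        ((ceilPow_mono hcut _).trans hz) hf0 h
    · rcases List.mem_append.1 h with h | h
      · exact exists_taskRun_group hp hL hw hi hT₁ hD h2.le g_le
          ((ceilPow_mono hcut _).trans hz) hfg h
      · exact exists_taskRun_group hp hL hw hi hT₁ hD (Nat.zero_le _) (Nat.zero_le _)
          ((ceilPow_mono ((min_le_right _ _).trans hcut) _).trans hz) hf0 h
    · rw [List.nil_append] at h
      exact exists_taskRun_group hp hL hw hi hT₁ hD (Nat.zero_le _) (Nat.zero_le _)
        ((ceilPow_mono ((min_le_right _ _).trans hcut) _).trans hz) hf0 h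

end Run

end Params

namespace Params

/-! ### What one half of a query generates -/

variable {pr : Params} {w : World}

theorem group_hits_iff {fld g r₀ r₁ e s h : ℕ} :
    (∃ τ ∈ pr.groupTasks fld g r₀ r₁ e, Hits w s h τ) ↔ ∃ x, r₀ ≤ x ∧ x < r₁ ∧
      h / 2 ^ groupCut w g (pr.grpExp e) x = w.key x / 2 ^ groupCut w g (pr.grpExp e) x := by
  constructor
  · rintro ⟨τ, hτ, hh⟩
    obtain ⟨j, hj, rfl⟩ := List.mem_map.1 hτ
    obtain ⟨x, h1, h2, h3, h4⟩ := hh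
    rw [cut_eq_groupCut (by have := List.mem_range.1 hj; omega) h3] at h4
    exact ⟨x, h1, h2, h4⟩
  · rintro ⟨x, h1, h2, h3⟩
    obtain ⟨j, hj, h4, h5⟩ := exists_emits w g (pr.grpExp e) x
    refine ⟨_, List.mem_map.2 ⟨j, List.mem_range.2 (by omega), rfl⟩, x, h1, h2, h4, ?_⟩
    rw [h5]
    exact h3

theorem nodeExp_eq {s z ρ j : ℕ} (hj : j ≤ Nat.log 2 z) (h1 : ceilPow j s ≤ ρ)
    (h2 : ρ < ceilPow (j + 1) s) : nodeExp s z ρ = j := by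
  rw [nodeExp, Nat.findGreatest_eq_iff]
  refine ⟨hj, fun _ => h1, fun k hk _ h => ?_⟩
  have := ceilPow_mono (show j + 1 ≤ k by omega) s
  omega

theorem nodeExp_spec {s z ρ j : ℕ} (hj : j ≤ Nat.log 2 z) (h1 : ceilPow j s ≤ ρ)
    (h2 : ρ < ceilPow (Nat.log 2 z + 1) s) : j ≤ nodeExp s z ρ ∧ nodeExp s z ρ ≤ Nat.log 2 z ∧
      ceilPow (nodeExp s z ρ) s ≤ ρ ∧ ρ < ceilPow (nodeExp s z ρ + 1) s := by
  refine ⟨Nat.le_findGreatest hj h1, Nat.findGreatest_le _,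
    Nat.findGreatest_spec (P := fun j => ceilPow j s ≤ ρ) hj h1, ?_⟩
  rcases (Nat.findGreatest_le (P := fun j => ceilPow j s ≤ ρ) (Nat.log 2 z)).eq_or_lt with h | h
  · rw [nodeExp, h]; exact h2
  · by_contra h3
    push Not at h3
    exact Nat.findGreatest_is_greatest (P := fun j => ceilPow j s ≤ ρ) (Nat.lt_succ_self _) h h3

theorem node_hits_iff {base s z e h : ℕ} :
    (∃ τ ∈ pr.nodeTasks base s z e, Hits w s h τ) ↔
      ∃ ρ, ceilPow (pr.cutExp z e) s ≤ ρ ∧ ρ < ceilPow (Nat.log 2 z + 1) s ∧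
        NodeMatch w (nodeExp s z ρ) (pr.nodeAcc z e (nodeExp s z ρ)) h ρ := by
  constructor
  · rintro ⟨τ, hτ, hh⟩
    obtain ⟨j, hj, rfl⟩ := List.mem_map.1 hτ
    rw [List.mem_filter, List.mem_range'_1, decide_eq_true_eq] at hj
    obtain ⟨⟨h1, h2⟩, h3⟩ := hj
    have hv : ceilPow (j + 1) s = ceilPow j s + 2 ^ j := by
      rcases ceilPow_succ j s with h | h <;> omega
    obtain ⟨ρ, h4, h5, h6⟩ := hh
    rw [Nat.add_sub_cancel' (le_ceilPow j s)] at h4 h5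
    rw [← hv] at h5
    have h7 := nodeExp_eq (z := z) (by omega) h4 h5
    refine ⟨ρ, (ceilPow_mono h1 s).trans h4, h5.trans_le (ceilPow_mono (by omega) s), ?_⟩
    rw [h7]
    exact h6
  · rintro ⟨ρ, h1, h2, h3⟩
    have hle : pr.cutExp z e ≤ Nat.log 2 z := by
      have h4 : pr.cutExp z e ≤ Nat.log 2 z + 1 := min_le_left _ _
      rcases h4.eq_or_lt with h | h
      · rw [h] at h1; omega
      · omega
    obtain ⟨h4, h5, h6, h7⟩ := nodeExp_spec hle h1 h2
    have hv : ceilPow (nodeExp s z ρ + 1) s = ceilPow (nodeExp s z ρ) s + 2 ^ nodeExp s z ρ := by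
      rcases ceilPow_succ (nodeExp s z ρ) s with h | h <;> omega
    refine ⟨_, List.mem_map.2 ⟨nodeExp s z ρ, ?_, rfl⟩, ρ, ?_, ?_, h3⟩
    · rw [List.mem_filter, List.mem_range'_1, decide_eq_true_eq]
      have := Nat.two_pow_pos (nodeExp s z ρ)
      exact ⟨⟨h4, by omega⟩, by omega⟩
    · rw [Nat.add_sub_cancel' (le_ceilPow _ s)]; exact h6
    · rw [Nat.add_sub_cancel' (le_ceilPow _ s), ← hv]; exact h7

theorem exists_mem_append {α : Type*} {l l' : List α} {p : α → Prop} :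
    (∃ x ∈ l ++ l', p x) ↔ (∃ x ∈ l, p x) ∨ ∃ x ∈ l', p x := by
  simp only [List.mem_append, or_and_right, exists_or]

/-- The tasks of one half of a query generate what agrees with one of its elements on the bits
chosen for the element. -/
theorem side_hits_iff (hL : w.L = pr.L) (hw : w.Valid) {base s z e h : ℕ}
    (hz : z ≠ 0 → ceilPow (Nat.log 2 z + 1) s = s + z) (hzN : s + z ≤ 2 ^ pr.L) (hh : h < 2 ^ pr.L) :
    (∃ τ ∈ pr.sideTasks base s z e, Hits w s h τ) ↔
      ∃ ρ, s ≤ ρ ∧ ρ < s + z ∧ Agree (pr.sideBits w s z e ρ) h (w.key ρ) := by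
  rw [sideTasks]
  split_ifs with hz0
  · simp [hz0]
    intros; omega
  have hz := hz hz0
  have hcut : ceilPow (pr.cutExp z e) s ≤ s + z := by
    rw [← hz]; exact ceilPow_mono (min_le_left _ _) s
  have hscut := le_ceilPow (pr.cutExp z e) s
  have hkey : ∀ ρ < s + z, w.key ρ < 2 ^ pr.L := fun ρ hρ => by
    rw [← hL]; exact hw.key_lt ρ (by rw [hL]; omega)
  have htop : ∀ ρ < s + z, ∀ t, Agree (topBits pr.L t) h (w.key ρ) ↔
      h / 2 ^ t = w.key ρ / 2 ^ t := fun ρ hρ t => agree_topBits hh (hkey ρ hρ)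
  have hscan : (∃ τ ∈ pr.scanTasks base s z e, Hits w s h τ) ↔
      ∃ ρ, s ≤ ρ ∧ ρ < ceilPow (pr.cutExp z e) s ∧
        Agree (pr.sideBits w s z e ρ) h (w.key ρ) := by
    rw [scanTasks]
    split_ifs with h1 h2
    · rw [group_hits_iff, ceilPow_zero]
      refine exists_congr fun ρ => and_congr_right fun h3 => and_congr_right fun h4 => ?_
      rw [sideBits, if_pos h4, if_pos h1, htop ρ (by omega)]
    · rw [exists_mem_append, group_hits_iff, group_hits_iff, ceilPow_zero, min_eq_left h2.le]
      have h5 := ceilPow_mono h2.le s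
      have h6 := le_ceilPow pr.g s
      constructor
      · rintro (⟨ρ, h3, h4, h7⟩ | ⟨ρ, h3, h4, h7⟩)
        · refine ⟨ρ, by omega, h4, ?_⟩
          rw [sideBits, if_pos h4, if_neg h1, min_eq_left h2.le, if_neg (by omega),
            htop ρ (by omega)]
          exact h7
        · refine ⟨ρ, by omega, by omega, ?_⟩
          rw [sideBits, if_pos (by omega), if_neg h1, min_eq_left h2.le, if_pos h4,
            htop ρ (by omega)]
          exact h7
      · rintro ⟨ρ, h3, h4, h7⟩
        rw [sideBits, if_pos h4, if_neg h1, min_eq_left h2.le] at h7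
        split_ifs at h7 with h8
        · exact Or.inr ⟨ρ, h3, h8, (htop ρ (by omega) _).1 h7⟩
        · exact Or.inl ⟨ρ, by omega, h4, (htop ρ (by omega) _).1 h7⟩
    · rw [List.nil_append, group_hits_iff, ceilPow_zero, min_eq_right (by omega)]
      refine exists_congr fun ρ => and_congr_right fun h3 => and_congr_right fun h4 => ?_
      rw [sideBits, if_pos h4, if_neg h1, min_eq_right (by omega), if_pos h4, htop ρ (by omega)]
  rw [exists_mem_append, hscan, node_hits_iff, hz]
  have hnode : ∀ ρ, ceilPow (pr.cutExp z e) s ≤ ρ → ρ < s + z →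
      (NodeMatch w (nodeExp s z ρ) (pr.nodeAcc z e (nodeExp s z ρ)) h ρ ↔
        Agree (pr.sideBits w s z e ρ) h (w.key ρ)) := by
    intro ρ h1 h2
    rw [sideBits, if_neg (by omega), agree_nodeBits hh (hkey ρ h2), NodeMatch, hL]
  constructor
  · rintro (⟨ρ, h1, h2, h3⟩ | ⟨ρ, h1, h2, h3⟩)
    · exact ⟨ρ, by omega, h2, (hnode ρ h1 h2).1 h3⟩
    · exact ⟨ρ, h1, by omega, h3⟩
  · rintro ⟨ρ, h1, h2, h3⟩
    rcases Nat.lt_or_ge ρ (ceilPow (pr.cutExp z e) s) with h4 | h4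
    · exact Or.inr ⟨ρ, h1, h4, h3⟩
    · exact Or.inl ⟨ρ, h4, h2, (hnode ρ h4 h2).2 h3⟩

/-! ### The error probability -/

/-- The probability that two different random hash values of `L` bits agree on a set of bits: they
never agree on all of them. -/
noncomputable def weight (L : ℕ) (P : Finset ℕ) : ℝ := if P.card = L then 0 else (1 / 2) ^ P.card

theorem weight_topBits_le (hL : w.L = pr.L) {g e ρ : ℕ} (hg : g ≤ pr.L) :
    weight pr.L (topBits pr.L (groupCut w g (pr.grpExp e) ρ)) ≤ (1 / 2) ^ (w.kap g ρ + e) ∧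
      (pr.L ≤ e → (topBits pr.L (groupCut w g (pr.grpExp e) ρ)).card = pr.L) := by
  have hk : w.kap g ρ ≤ pr.L := hL ▸ w.kap_le (hL ▸ hg) ρ
  have h1 : e ≤ 2 ^ pr.grpExp e ∨ pr.L ≤ 2 ^ pr.grpExp e := by
    rcases min_choice (Nat.clog 2 e) pr.Jm with h | h
    · left; rw [grpExp, h]; exact Nat.le_pow_clog (by norm_num) _
    · right; rw [grpExp, h]; exact L_le_two_pow_Jm
  rw [weight, card_topBits, groupCut, hL]
  constructor
  · split_ifs with h
    · positivity
    · exact pow_le_pow_of_le_one (by norm_num) (by norm_num) (by omega)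
  · intro h; omega

theorem card_sideBits (hL : w.L = pr.L) {s z e ρ : ℕ} (hzL : Nat.log 2 z + 1 ≤ pr.L)
    (he : pr.L ≤ e) : (pr.sideBits w s z e ρ).card = pr.L := by
  rw [sideBits]
  have hexp : nodeExp s z ρ ≤ Nat.log 2 z := Nat.findGreatest_le _
  split_ifs
  · exact (weight_topBits_le hL (Nat.zero_le _)).2 (by omega)
  · exact (weight_topBits_le hL (Nat.zero_le _)).2 (by omega)
  · exact (weight_topBits_le hL g_le).2 (by omega)
  · rw [card_nodeBits (show pr.nodeAcc z e (nodeExp s z ρ) ≤ pr.L - nodeExp s z ρ from min_le_right _ _), nodeAcc, min_eq_right (by omega)]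
    omega

theorem sideBits_subset {s z e ρ : ℕ} : pr.sideBits w s z e ρ ⊆ Finset.range pr.L := by
  rw [sideBits]
  split_ifs
  · exact Finset.filter_subset _ _
  · exact Finset.filter_subset _ _
  · exact Finset.filter_subset _ _
  · exact nodeBits_subset (min_le_right _ _) (Nat.sub_le _ _)

theorem sum_const_le {s t e k : ℕ} (h : t < s + 2 ^ k) :
    ∑ _ρ ∈ Finset.Ico s t, (1 / 2 : ℝ) ^ (e + k) ≤ (1 / 2) ^ e := by
  rw [Finset.sum_const, nsmul_eq_mul, Nat.card_Ico, pow_add]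
  have h1 : ((t - s : ℕ) : ℝ) ≤ 2 ^ k := by exact_mod_cast tsub_le_iff_left.2 h.le
  calc ((t - s : ℕ) : ℝ) * ((1 / 2) ^ e * (1 / 2) ^ k) ≤ 2 ^ k * ((1 / 2) ^ e * (1 / 2) ^ k) := by
        gcongr
    _ = (1 / 2) ^ e * (2 * (1 / 2)) ^ k := by rw [mul_pow]; ring
    _ = (1 / 2) ^ e := by norm_num

/-- The shares of all elements of a half of a query in the error probability. -/
theorem sum_weight_le (hL : w.L = pr.L) {s z e : ℕ}
    (hz : ceilPow (Nat.log 2 z + 1) s = s + z) (hzN : s + z ≤ 2 ^ pr.L)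
    (hzL : Nat.log 2 z + 1 ≤ pr.L) (hν : 2 * (w.m + 1) * pr.L + 1 ≤ 2 ^ pr.ν) :
    ∑ ρ ∈ Finset.Ico s (s + z), weight pr.L (pr.sideBits w s z e ρ) ≤ (1 / 2) ^ e := by
  have hcut : ceilPow (pr.cutExp z e) s ≤ s + z := by
    rw [← hz]; exact ceilPow_mono (min_le_left _ _) s
  have hscut := le_ceilPow (pr.cutExp z e) s
  rw [← Finset.sum_Ico_consecutive _ hscut hcut]
  have hnode : ∑ ρ ∈ Finset.Ico (ceilPow (pr.cutExp z e) s) (s + z),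
      weight pr.L (pr.sideBits w s z e ρ) ≤ (1 / 2) ^ (e + 1) := by
    refine le_trans (Finset.sum_le_sum (g := fun _ => (1 / 2 : ℝ) ^ (e + 1 + (Nat.log 2 z + 1)))
      fun ρ hρ => ?_) ?_
    · rw [Finset.mem_Ico] at hρ
      rw [sideBits, if_neg (by omega), weight, card_nodeBits (show pr.nodeAcc z e (nodeExp s z ρ) ≤ pr.L - nodeExp s z ρ from min_le_right _ _)]
      have hexp : nodeExp s z ρ ≤ Nat.log 2 z := Nat.findGreatest_le _
      split_ifs with h
      · positivity
      · refine pow_le_pow_of_le_one (by norm_num) (by norm_num) ?_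
        rw [nodeAcc] at h ⊢
        omega
    · have h1 := Nat.lt_pow_succ_log_self (b := 2) (by norm_num) z
      exact sum_const_le (by omega)
  have hsmall : ∑ ρ ∈ Finset.Ico s (ceilPow (pr.cutExp z e) s),
      weight pr.L (pr.sideBits w s z e ρ) ≤ (1 / 2) ^ (e + 2) + (1 / 2) ^ (e + 2) := by
    by_cases h1 : pr.β < pr.cutExp z e
    · have h2 : ∑ ρ ∈ Finset.Ico s (ceilPow (pr.cutExp z e) s),
          weight pr.L (pr.sideBits w s z e ρ) ≤
          ∑ ρ ∈ Finset.range (2 ^ w.L), (1 / 2 : ℝ) ^ (e + 2 + pr.ν) * (1 / 2) ^ w.kmono ρ := by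
        refine (Finset.sum_le_sum fun ρ hρ => ?_).trans
          (Finset.sum_le_sum_of_subset_of_nonneg ?_ fun _ _ _ => by positivity)
        · rw [Finset.mem_Ico] at hρ
          rw [sideBits, if_pos hρ.2, if_pos h1]
          refine (weight_topBits_le hL (Nat.zero_le _)).1.trans (le_of_eq ?_)
          rw [World.kap, Nat.zero_max, ← pow_add, add_comm]
        · intro ρ hρ
          rw [Finset.mem_Ico] at hρ
          rw [Finset.mem_range, hL]
          omega
      rw [← Finset.mul_sum] at h2
      have h3 := w.sum_half_pow_kmono_le
      have h4 : (2 * (w.m + 1) * w.L + 1 : ℝ) ≤ 2 ^ pr.ν := by rw [hL]; exact_mod_cast hν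
      calc _ ≤ (1 / 2 : ℝ) ^ (e + 2 + pr.ν) * 2 ^ pr.ν := h2.trans (by gcongr; exact h3.trans h4)
        _ = (1 / 2) ^ (e + 2) * (1 / 2 * 2) ^ pr.ν := by rw [pow_add, mul_pow]; ring
        _ ≤ _ := by norm_num
    · have h2 : ceilPow (min pr.g (pr.cutExp z e)) s ≤ ceilPow (pr.cutExp z e) s :=
        ceilPow_mono (min_le_right _ _) s
      have h3 := le_ceilPow (min pr.g (pr.cutExp z e)) s
      rw [← Finset.sum_Ico_consecutive _ h3 h2]
      refine add_le_add ?_ ?_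
      · refine le_trans (Finset.sum_le_sum (g := fun _ => (1 / 2 : ℝ) ^ (e + 2 + pr.g))
          fun ρ hρ => ?_) (sum_const_le ?_)
        · rw [Finset.mem_Ico] at hρ
          rw [sideBits, if_pos (by omega), if_neg h1, if_pos hρ.2]
          exact (weight_topBits_le hL (Nat.zero_le _)).1.trans
            (pow_le_pow_of_le_one (by norm_num) (by norm_num) (by omega))
        · exact (ceilPow_lt _ _).trans_le (Nat.add_le_add_left
            (Nat.pow_le_pow_right (by norm_num) (min_le_left _ _)) _)
      · refine le_trans (Finset.sum_le_sum (g := fun _ => (1 / 2 : ℝ) ^ (e + 2 + pr.β))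
          fun ρ hρ => ?_) (sum_const_le ?_)
        · rw [Finset.mem_Ico] at hρ
          rw [sideBits, if_pos (by omega), if_neg h1, if_neg (by omega)]
          refine (weight_topBits_le hL g_le).1.trans
            (pow_le_pow_of_le_one (by norm_num) (by norm_num) ?_)
          have : pr.g ≤ w.kap pr.g ρ := le_max_left _ _
          omega
        · have h4 := ceilPow_lt (pr.cutExp z e) s
          have h5 := Nat.pow_le_pow_right (n := 2) (by norm_num)
            (show pr.cutExp z e ≤ pr.β by omega)
          omega
  calc _ ≤ (1 / 2 : ℝ) ^ (e + 2) + (1 / 2) ^ (e + 2) + (1 / 2) ^ (e + 1) := add_le_add hsmall hnode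
    _ = (1 / 2) ^ e := by ring

/-! ### The number of I/Os -/

theorem sum_geometric_le (a k : ℕ) :
    ∑ j ∈ Finset.range (k + 1), (a + (k - j)) * 2 ^ j ≤ (a + 1) * 2 ^ (k + 1) := by
  induction k generalizing a with
  | zero => simp; omega
  | succ k ih =>
    rw [Finset.sum_range_succ]
    have h1 : ∑ j ∈ Finset.range (k + 1), (a + (k + 1 - j)) * 2 ^ j =
        ∑ j ∈ Finset.range (k + 1), (a + 1 + (k - j)) * 2 ^ j := by
      refine Finset.sum_congr rfl fun j hj => ?_
      rw [Finset.mem_range] at hj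
      congr 1
      omega
    rw [h1, Nat.sub_self, add_zero]
    have := ih (a + 1)
    calc _ ≤ (a + 1 + 1) * 2 ^ (k + 1) + a * 2 ^ (k + 1) := Nat.add_le_add_right this _
      _ = (a + 1) * 2 ^ (k + 1 + 1) := by ring

theorem sum_map_mul_le {α : Type*} (l : List α) (c f : α → ℕ) (B : ℕ)
    (h : ∀ x ∈ l, c x * B ≤ f x) : (l.map c).sum * B ≤ (l.map f).sum := by
  induction l with
  | nil => simp
  | cons x l ih =>
    have h1 := h x (by simp)
    have h2 := ih fun y hy => h y (by simp [hy])
    simp only [List.map_cons, List.sum_cons, add_mul]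
    omega

theorem group_cost_le {fld g r₀ r₁ e : ℕ} (he : 0 < e) :
    ((pr.groupTasks fld g r₀ r₁ e).map (taskCost pr.B)).sum * pr.B ≤
      15 * (pr.Jm + 1) * pr.B + 24 * ((r₁ - r₀) * e) := by
  obtain ⟨R, hR⟩ : ∃ R, r₁ - r₀ = R := ⟨_, rfl⟩
  rw [hR]
  set q := pr.grpExp e with hq
  have hq1 : q ≤ pr.Jm := min_le_right _ _
  have hq2 : 2 ^ q ≤ 2 * e := by
    refine (Nat.pow_le_pow_right (by norm_num) (min_le_left _ _)).trans ?_
    rcases Nat.lt_or_ge 1 e with h1 | h1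
    · have := Nat.pow_pred_clog_lt_self (b := 2) (by norm_num) h1
      have h2 := Nat.clog_pos (b := 2) (by norm_num) h1
      rw [← Nat.succ_pred_eq_of_pos h2, pow_succ]
      omega
    · rw [Nat.clog_of_right_le_one h1]; omega
  rw [groupTasks, List.map_map]
  refine (sum_map_mul_le _ _ (fun j => 15 * pr.B + 2 * (R * (2 ^ j + 4))) _ fun j _ => ?_).trans ?_
  · simp only [Function.comp, taskCost, hR]
    have := Nat.div_mul_le_self (R * (2 ^ j + 4)) pr.B
    rw [add_mul, mul_assoc]
    omega
  · have h1 : ∀ k, ((List.range (k + 1)).map fun j => 15 * pr.B + 2 * (R * (2 ^ j + 4))).sum ≤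
        (k + 1) * (15 * pr.B) + 2 * (R * (6 * 2 ^ k)) := by
      intro k
      induction k with
      | zero => simp; ring_nf; omega
      | succ k ih =>
        rw [List.range_succ, List.map_append, List.sum_append]
        simp only [List.map_cons, List.map_nil, List.sum_cons, List.sum_nil, add_zero]
        have h2 : (2 : ℕ) ^ (k + 1) = 2 * 2 ^ k := pow_succ' _ _
        have h3 := Nat.two_pow_pos k
        have h4 : R * (2 ^ (k + 1) + 4) ≤ R * (6 * 2 ^ k) := Nat.mul_le_mul_left _ (by omega)
        have h5 : R * (6 * 2 ^ (k + 1)) = R * (6 * 2 ^ k) + R * (6 * 2 ^ k) := by rw [h2]; ring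
        rw [add_mul (k + 1), one_mul]
        omega
    refine (h1 q).trans (Nat.add_le_add ?_ ?_)
    · calc (q + 1) * (15 * pr.B) ≤ (pr.Jm + 1) * (15 * pr.B) := Nat.mul_le_mul_right _ (by omega)
        _ = _ := by ring
    · calc 2 * (R * (6 * 2 ^ q)) = 12 * R * 2 ^ q := by ring
        _ ≤ 12 * R * (2 * e) := Nat.mul_le_mul_left _ hq2
        _ = _ := by ring

theorem node_cost_le {base s z e : ℕ} (hz : z ≠ 0) :
    ((pr.nodeTasks base s z e).map (taskCost pr.B)).sum * pr.B ≤ 76 * (e + 4) * z := by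
  have hlog := Nat.pow_log_le_self 2 hz
  rw [nodeTasks, List.map_map]
  refine (sum_map_mul_le _ _ (fun j => 38 * ((e + 3 + (Nat.log 2 z - j)) * 2 ^ j)) _
    fun j _ => ?_).trans ?_
  · simp only [Function.comp, taskCost]
    refine (Nat.div_mul_le_self _ _).trans ?_
    have : pr.nodeAcc z e j ≤ e + 2 + (Nat.log 2 z - j) := min_le_left _ _
    rw [mul_assoc]
    exact Nat.mul_le_mul_left _ (Nat.mul_le_mul_right _ (by omega))
  · have h1 : ∀ (l : List ℕ), l.Nodup → (∀ j ∈ l, j < Nat.log 2 z + 1) →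
        (l.map fun j => 38 * ((e + 3 + (Nat.log 2 z - j)) * 2 ^ j)).sum ≤
        ∑ j ∈ Finset.range (Nat.log 2 z + 1), 38 * ((e + 3 + (Nat.log 2 z - j)) * 2 ^ j) := by
      intro l hl h
      rw [← List.sum_toFinset _ hl]
      exact Finset.sum_le_sum_of_subset fun j hj => Finset.mem_range.2 (h j (List.mem_toFinset.1 hj))
    refine (h1 _ (List.Nodup.filter _ List.nodup_range') fun j hj => ?_).trans ?_
    · rw [List.mem_filter, List.mem_range'_1] at hj
      omega
    · rw [← Finset.mul_sum]
      calc _ ≤ 38 * ((e + 3 + 1) * 2 ^ (Nat.log 2 z + 1)) :=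
            Nat.mul_le_mul_left _ (sum_geometric_le _ _)
        _ = 76 * (e + 4) * 2 ^ Nat.log 2 z := by ring
        _ ≤ _ := Nat.mul_le_mul_left _ hlog

/-- The I/Os of one half of a query with `z` results. -/
theorem side_cost_le (hp : pr.Valid) {κ base s z e : ℕ} (hν : pr.ν ≤ κ * (pr.E₀ + 1))
    (he : e ≤ 2 * pr.L) (hzL : Nat.log 2 z + 1 ≤ pr.L) :
    ((pr.sideTasks base s z e).map (taskCost pr.B)).sum * pr.B ≤
      (48 * κ + 172) * (e + 4) * z + 200 * (pr.Jm + 1) * pr.B := by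
  rw [sideTasks]
  split_ifs with hz
  · simp
  have hlog := Nat.pow_log_le_self 2 hz
  have hnode := pr.node_cost_le (base := base) (s := s) (e := e) hz
  rw [List.map_append, List.sum_append, add_mul]
  have hcutlog : pr.cutExp z e ≤ Nat.log 2 z + 1 := min_le_left _ _
  have hcutz : 2 ^ pr.cutExp z e ≤ 2 * z :=
    (Nat.pow_le_pow_right (by norm_num) hcutlog).trans (by rw [pow_succ]; omega)
  have hR := ceilPow_lt (pr.cutExp z e) s
  have hscan : ((pr.scanTasks base s z e).map (taskCost pr.B)).sum * pr.B ≤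
      48 * (κ + 1) * ((e + 2) * z) + 48 * ((e + 2) * z) + 200 * (pr.Jm + 1) * pr.B := by
    rw [scanTasks]
    split_ifs with h1 h2
    · refine (group_cost_le (by omega)).trans ?_
      rw [ceilPow_zero]
      have h3 : 2 ^ pr.cutExp z e * (e + 2 + pr.ν) ≤ (κ + 1) * (e + 2) * (2 * z) := by
        rcases Nat.le_total pr.E₀ (e + 1) with h | h
        · calc 2 ^ pr.cutExp z e * (e + 2 + pr.ν) ≤ (2 * z) * (e + 2 + κ * (e + 2)) :=
                Nat.mul_le_mul hcutz (Nat.add_le_add_left (hν.trans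
                  (Nat.mul_le_mul_left _ (by omega))) _)
            _ = _ := by ring
        · obtain ⟨x, hx⟩ := Nat.exists_eq_add_of_le h
          have h4 : pr.cutExp z e ≤ max pr.β (Nat.log 2 z + 1 + 1 + e - pr.E₀) := min_le_right _ _
          have h5 : pr.cutExp z e + x ≤ Nat.log 2 z + 1 := by
            rcases le_max_iff.1 h4 with h6 | h6 <;> omega
          have h6 : 2 ^ pr.cutExp z e * 2 ^ x ≤ 2 * z := by
            rw [← pow_add]
            exact (Nat.pow_le_pow_right (by norm_num) h5).trans (by rw [pow_succ]; omega)
          have h7 : x + 1 ≤ 2 ^ x := Nat.lt_two_pow_self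
          have h8 : e + 2 + pr.ν ≤ (κ + 1) * (e + 2) * 2 ^ x := by
            calc e + 2 + pr.ν ≤ e + 2 + κ * (e + 1 + x + 1) :=
                  Nat.add_le_add_left (hx ▸ hν) _
              _ ≤ (κ + 1) * (e + 2) * (x + 1) := by
                  have : e + 1 + x + 1 ≤ (e + 2) * (x + 1) := by nlinarith
                  nlinarith
              _ ≤ _ := Nat.mul_le_mul_left _ h7
          calc 2 ^ pr.cutExp z e * (e + 2 + pr.ν) ≤
                2 ^ pr.cutExp z e * ((κ + 1) * (e + 2) * 2 ^ x) := Nat.mul_le_mul_left _ h8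
            _ = (κ + 1) * (e + 2) * (2 ^ pr.cutExp z e * 2 ^ x) := by ring
            _ ≤ _ := Nat.mul_le_mul_left _ h6
      have h4 : (ceilPow (pr.cutExp z e) s - s) * (e + 2 + pr.ν) ≤
          2 ^ pr.cutExp z e * (e + 2 + pr.ν) :=
        Nat.mul_le_mul_right _ (tsub_le_iff_left.2 hR.le)
      have h5 : (κ + 1) * (e + 2) * (2 * z) * 24 = 48 * (κ + 1) * ((e + 2) * z) := by ring
      have h6 : 15 * (pr.Jm + 1) * pr.B ≤ 200 * (pr.Jm + 1) * pr.B :=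
        Nat.mul_le_mul_right _ (Nat.mul_le_mul_right _ (by norm_num))
      omega
    all_goals
      have hsmall : ((pr.groupTasks (base + (2 * pr.L + 2)) 0 (ceilPow 0 s)
          (ceilPow (min pr.g (pr.cutExp z e)) s) (e + 2 + pr.g)).map (taskCost pr.B)).sum * pr.B ≤
          15 * (pr.Jm + 1) * pr.B + 120 * pr.B := by
        refine (group_cost_le (by omega)).trans (Nat.add_le_add_left ?_ _)
        rw [ceilPow_zero]
        have h3 : (ceilPow (min pr.g (pr.cutExp z e)) s - s) * (e + 2 + pr.g) ≤ 5 * pr.B := by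
          rcases Nat.eq_zero_or_pos (pr.B / pr.L) with h | h
          · have hg : pr.g = 0 := by simp [g, h]
            rw [hg, Nat.zero_min, ceilPow_zero]
            simp
          · have h4 : 2 ^ pr.g ≤ pr.B / pr.L := (Nat.pow_le_pow_right (by norm_num)
              (min_le_left _ _)).trans (Nat.pow_log_le_self 2 h.ne')
            have h5 := (Nat.le_div_iff_mul_le hp.L_pos).1 h4
            have h6 := ceilPow_lt (min pr.g (pr.cutExp z e)) s
            have h7 := Nat.pow_le_pow_right (n := 2) (by norm_num)
              (min_le_left pr.g (pr.cutExp z e))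
            have h8 := g_le (pr := pr)
            have h9 := hp.L_pos
            calc _ ≤ 2 ^ pr.g * (5 * pr.L) :=
                  Nat.mul_le_mul ((tsub_le_iff_left.2 h6.le).trans h7) (by omega)
              _ = 5 * (2 ^ pr.g * pr.L) := by ring
              _ ≤ _ := Nat.mul_le_mul_left _ h5
        omega
    · rw [List.map_append, List.sum_append, add_mul]
      refine (Nat.add_le_add (group_cost_le (by omega)) hsmall).trans ?_
      have hβg : pr.β ≤ pr.Jm + (pr.g + 1) := by
        have hg : pr.g = Nat.log 2 (pr.B / pr.L) := by
          rcases min_choice (Nat.log 2 (pr.B / pr.L)) pr.L with h | h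
          · exact h
          · have : pr.g = pr.L := h
            omega
        refine Nat.clog_le_of_le_pow ?_
        have h3 := Nat.lt_pow_succ_log_self (b := 2) (by norm_num) (pr.B / pr.L)
        rw [← hg] at h3
        have h4 := (Nat.div_lt_iff_lt_mul hp.L_pos).1 h3
        rw [pow_add]
        calc pr.B ≤ 2 ^ (pr.g + 1) * pr.L := h4.le
          _ ≤ 2 ^ (pr.g + 1) * 2 ^ pr.Jm := Nat.mul_le_mul_left _ L_le_two_pow_Jm
          _ = _ := mul_comm _ _
      have h3 : (ceilPow (pr.cutExp z e) s - ceilPow pr.g s) * (e + 2 + (pr.β - pr.g)) ≤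
          2 * ((e + 2) * z) + 2 * ((pr.Jm + 1) * pr.B) := by
        have h4 := le_ceilPow pr.g s
        have h5 : 2 ^ pr.cutExp z e ≤ 2 * pr.B :=
          (Nat.pow_le_pow_right (by norm_num) (by omega)).trans hp.two_pow_β_le
        calc _ ≤ 2 ^ pr.cutExp z e * (e + 2 + (pr.Jm + 1)) :=
              Nat.mul_le_mul ((Nat.sub_le_sub_left h4 _).trans (tsub_le_iff_left.2 hR.le)) (by omega)
          _ = 2 ^ pr.cutExp z e * (e + 2) + 2 ^ pr.cutExp z e * (pr.Jm + 1) := by ring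
          _ ≤ 2 * z * (e + 2) + 2 * pr.B * (pr.Jm + 1) :=
              Nat.add_le_add (Nat.mul_le_mul_right _ hcutz) (Nat.mul_le_mul_right _ h5)
          _ = _ := by ring
      have h6 : pr.B ≤ (pr.Jm + 1) * pr.B := Nat.le_mul_of_pos_left _ (by omega)
      have h7 : ∀ c, c * (pr.Jm + 1) * pr.B = c * ((pr.Jm + 1) * pr.B) := fun c => mul_assoc _ _ _
      rw [h7, h7]
      generalize (pr.Jm + 1) * pr.B = y at *
      generalize (e + 2) * z = x at *
      omega
    · rw [List.nil_append]
      refine hsmall.trans ?_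
      have h6 : pr.B ≤ (pr.Jm + 1) * pr.B := Nat.le_mul_of_pos_left _ (by omega)
      have h7 : ∀ c, c * (pr.Jm + 1) * pr.B = c * ((pr.Jm + 1) * pr.B) := fun c => mul_assoc _ _ _
      rw [h7, h7]
      generalize (pr.Jm + 1) * pr.B = y at *
      omega
  have h3 : (e + 2) * z ≤ (e + 4) * z := Nat.mul_le_mul_right _ (by omega)
  calc _ ≤ 76 * (e + 4) * z + (48 * (κ + 1) * ((e + 2) * z) + 48 * ((e + 2) * z) +
        200 * (pr.Jm + 1) * pr.B) := Nat.add_le_add hnode hscan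
    _ ≤ 76 * (e + 4) * z + (48 * (κ + 1) * ((e + 4) * z) + 48 * ((e + 4) * z) +
        200 * (pr.Jm + 1) * pr.B) := by gcongr
    _ = _ := by ring

end Params

/-! ### The layout of the disk -/

/-- The number `v` as a list of `W` bits, the least significant one first. -/
def numBits (W v : ℕ) : List Bool := (List.range W).map v.testBit

@[simp] theorem length_numBits (W v : ℕ) : (numBits W v).length = W := by simp [numBits]

theorem length_flatMap_range_eq (f : ℕ → List Bool) (n : ℕ) :
    ((List.range n).flatMap f).length = ∑ k ∈ Finset.range n, (f k).length := by
  induction n with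
  | zero => simp
  | succ n ih =>
    rw [List.range_succ, List.flatMap_append, List.length_append, ih, Finset.sum_range_succ]
    simp

section Sections

variable (N : ℕ) (sec : ℕ → ℕ → List Bool)

/-- The address at which the data for rank `r` in section `k` starts, if the sections, each with
data for `N` ranks, follow each other from address `a` on. -/
def secAddr (a k r : ℕ) : ℕ :=
  a + ((List.range k).flatMap fun k => (List.range N).flatMap (sec k)).length +
    ((List.range r).flatMap (sec k)).length

variable {N sec}

theorem listAt_section {B : ℕ} {D : Disk B} {a K k r : ℕ}
    (h : ListAt D a ((List.range K).flatMap fun k => (List.range N).flatMap (sec k)))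
    (hk : k < K) (hr : r ≤ N) :
    ListAt D (secAddr N sec a k r) ((List.range' r (N - r)).flatMap (sec k)) ∧
      secAddr N sec a k r + ((List.range' r (N - r)).flatMap (sec k)).length ≤
        a + ((List.range K).flatMap fun k => (List.range N).flatMap (sec k)).length := by
  have e1 : (List.range K).flatMap (fun k => (List.range N).flatMap (sec k)) =
      (List.range k).flatMap (fun k => (List.range N).flatMap (sec k)) ++
        ((List.range N).flatMap (sec k) ++
          (List.range' (k + 1) (K - (k + 1))).flatMap fun k => (List.range N).flatMap (sec k)) := by
    have h1 := Params.flatMap_range'_split (fun k => (List.range N).flatMap (sec k))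
      (Nat.zero_le k) hk.le
    have h2 := Params.flatMap_range'_split (fun k => (List.range N).flatMap (sec k))
      (show k ≤ k + 1 by omega) hk
    rw [Nat.sub_zero, ← List.range_eq_range', Nat.sub_zero, ← List.range_eq_range'] at h1
    rw [h1, h2]
    simp
  have e2 : (List.range N).flatMap (sec k) = (List.range r).flatMap (sec k) ++
      (List.range' r (N - r)).flatMap (sec k) := by
    have h1 := Params.flatMap_range'_split (sec k) (Nat.zero_le r) hr
    rwa [Nat.sub_zero, ← List.range_eq_range', Nat.sub_zero, ← List.range_eq_range'] at h1
  rw [e1] at h ⊢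
  have h3 := h.right.left
  rw [e2] at h3
  refine ⟨h3.right, ?_⟩
  rw [secAddr, List.length_append, List.length_append, e2, List.length_append]
  omega

end Sections

namespace Params

variable (pr : Params)

section Data

variable (m : ℕ) (ws : ℕ → World) (seed : ℕ)

/-- The number of entries of the table. -/
def tableSize : ℕ := 1 + 2 * (m + 1) * pr.F

/-- The index of the first entry that belongs to boundary `i` of world `t`. -/
def baseIdx (t i : ℕ) : ℕ := 1 + (t * (m + 1) + i) * pr.F

/-- The sections: those of world `0`, then those of world `1`. -/
noncomputable def sec (k : ℕ) : ℕ → List Bool := pr.fieldCode (ws (k / pr.F)) (k % pr.F)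

/-- The entries of the table: the seed of the hash function, and, for each boundary of each world,
its value and the addresses of the data for it in the sections. -/
noncomputable def entry (idx : ℕ) : ℕ :=
  if idx = 0 then seed
  else if (idx - 1) % pr.F = 0 then
    (ws ((idx - 1) / pr.F / (m + 1))).b ((idx - 1) / pr.F % (m + 1))
  else secAddr (2 ^ pr.L) (pr.sec ws) (pr.W * pr.tableSize m)
    ((idx - 1) / pr.F / (m + 1) * pr.F + (idx - 1) % pr.F)
    ((ws ((idx - 1) / pr.F / (m + 1))).b ((idx - 1) / pr.F % (m + 1)))

/-- The data structure: the table and the sections. -/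
noncomputable def dataBits : List Bool :=
  ((List.range (pr.tableSize m)).flatMap fun idx => numBits pr.W (pr.entry m ws seed idx)) ++
    (List.range (2 * pr.F)).flatMap fun k => (List.range (2 ^ pr.L)).flatMap (pr.sec ws k)

variable {m ws seed} {pr}

theorem F_pos : 0 < pr.F := by rw [F]; omega

theorem length_table : ((List.range (pr.tableSize m)).flatMap fun idx =>
    numBits pr.W (pr.entry m ws seed idx)).length = pr.W * pr.tableSize m := by
  rw [length_flatMap_range_eq]
  simp [mul_comm]

theorem table_bit {B : ℕ} (hB : 0 < B) {idx : ℕ} (h : idx < pr.tableSize m) {t : ℕ}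
    (ht : t < pr.W) :
    diskBit (Disk.ofBits B (pr.dataBits m ws seed)) (pr.W * idx + t) =
      (pr.entry m ws seed idx).testBit t := by
  have h1 := listAt_ofBits hB [] ((List.range (pr.tableSize m)).flatMap fun idx =>
    numBits pr.W (pr.entry m ws seed idx))
    ((List.range (2 * pr.F)).flatMap fun k => (List.range (2 ^ pr.L)).flatMap (pr.sec ws k))
  rw [List.nil_append, List.range_eq_range' (n := pr.tableSize m)] at h1
  have h2 := listAt_flatMap _ h1 pr.W (fun _ _ _ => length_numBits _ _) (Nat.zero_le idx)
    (by omega) t (by simpa using ht)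
  simp only [List.length_nil, Nat.sub_zero, zero_add] at h2
  rw [dataBits, List.range_eq_range' (n := pr.tableSize m), h2]
  simp [numBits]

theorem entry_base {t i : ℕ} (hi : i ≤ m) :
    pr.entry m ws seed (pr.baseIdx m t i + 0) = (ws t).b i := by
  have e1 : (pr.baseIdx m t i + 0 - 1) = (t * (m + 1) + i) * pr.F := by rw [baseIdx]; omega
  have e2 : (t * (m + 1) + i) / (m + 1) = t := by
    rw [add_comm, Nat.add_mul_div_right _ _ (by omega), Nat.div_eq_of_lt (by omega), zero_add]
  have e3 : (t * (m + 1) + i) % (m + 1) = i := by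
    rw [add_comm, Nat.add_mul_mod_self_right, Nat.mod_eq_of_lt (by omega)]
  rw [entry, if_neg (by rw [baseIdx]; omega), e1, if_pos (Nat.mul_mod_left _ _),
    Nat.mul_div_cancel _ F_pos, e2, e3]

theorem entry_addr {t i f : ℕ} (hi : i ≤ m) (hf : f < pr.F) (hf0 : 0 < f) :
    pr.entry m ws seed (pr.baseIdx m t i + f) =
      secAddr (2 ^ pr.L) (pr.sec ws) (pr.W * pr.tableSize m) (t * pr.F + f) ((ws t).b i) := by
  have e1 : (pr.baseIdx m t i + f - 1) = f + (t * (m + 1) + i) * pr.F := by rw [baseIdx]; omega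
  have e2 : (t * (m + 1) + i) / (m + 1) = t := by
    rw [add_comm, Nat.add_mul_div_right _ _ (by omega), Nat.div_eq_of_lt (by omega), zero_add]
  have e3 : (t * (m + 1) + i) % (m + 1) = i := by
    rw [add_comm, Nat.add_mul_mod_self_right, Nat.mod_eq_of_lt (by omega)]
  have e4 : (f + (t * (m + 1) + i) * pr.F) % pr.F = f := by
    rw [Nat.add_mul_mod_self_right, Nat.mod_eq_of_lt hf]
  have e5 : (f + (t * (m + 1) + i) * pr.F) / pr.F = t * (m + 1) + i := by
    rw [Nat.add_mul_div_right _ _ F_pos, Nat.div_eq_of_lt hf, zero_add]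
  rw [entry, if_neg (by rw [baseIdx]; omega), e1, e4, if_neg hf0.ne', e5, e2, e3]

theorem sec_eq {t f : ℕ} (hf : f < pr.F) : pr.sec ws (t * pr.F + f) = pr.fieldCode (ws t) f := by
  rw [sec, add_comm, Nat.add_mul_mod_self_right, Nat.mod_eq_of_lt hf,
    Nat.add_mul_div_right _ _ F_pos, Nat.div_eq_of_lt hf, zero_add]

theorem baseIdx_lt {t i f : ℕ} (ht : t < 2) (hi : i ≤ m) (hf : f < pr.F) :
    pr.baseIdx m t i + f < pr.tableSize m := by
  have h1 : t * (m + 1) + i + 1 ≤ 2 * (m + 1) := by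
    have : t * (m + 1) ≤ 1 * (m + 1) := Nat.mul_le_mul_right _ (by omega)
    omega
  have h2 := Nat.mul_le_mul_right pr.F h1
  rw [baseIdx, tableSize]
  rw [add_mul _ 1, one_mul] at h2
  omega

/-- The data structure holds the data of the two worlds. -/
theorem sideData_dataBits {B : ℕ} (hB : 0 < B) (hb : ∀ t < 2, ∀ i ≤ m, (ws t).b i ≤ 2 ^ pr.L)
    (hW : (pr.dataBits m ws seed).length < 2 ^ pr.W) (hLW : pr.L < pr.W) {t i : ℕ} (ht : t < 2)
    (hi : i ≤ m) :
    pr.SideData (ws t) (Disk.ofBits B (pr.dataBits m ws seed)) (pr.baseIdx m t i) ((ws t).b i)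
      fun f => pr.entry m ws seed (pr.baseIdx m t i + f) := by
  have hbody := listAt_ofBits hB ((List.range (pr.tableSize m)).flatMap fun idx =>
    numBits pr.W (pr.entry m ws seed idx))
    ((List.range (2 * pr.F)).flatMap fun k => (List.range (2 ^ pr.L)).flatMap (pr.sec ws k)) []
  rw [List.append_nil, length_table] at hbody
  have hbi := hb t ht i hi
  have hlen : pr.W * pr.tableSize m + ((List.range (2 * pr.F)).flatMap fun k =>
      (List.range (2 ^ pr.L)).flatMap (pr.sec ws k)).length < 2 ^ pr.W := by
    rw [dataBits, List.length_append, length_table] at hW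
    exact hW
  have hsec : ∀ f < pr.F, t * pr.F + f < 2 * pr.F := fun f hf => by
    have : t * pr.F ≤ 1 * pr.F := Nat.mul_le_mul_right _ (by omega)
    omega
  have hzero : ∀ l : List ℕ, l.flatMap (pr.fieldCode (ws t) 0) = [] := fun l => by
    rw [List.flatMap_eq_nil_iff]
    intro r _
    rw [fieldCode, if_pos rfl]
  refine ⟨fun f hf u hu => table_bit hB (baseIdx_lt ht hi hf) hu, fun f hf => ?_, fun f hf => ?_⟩
  · rcases Nat.eq_zero_or_pos f with rfl | hf0
    · rw [hzero]
      intro u hu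
      simp at hu
    · simp only [entry_addr hi hf hf0]
      have := (listAt_section hbody (hsec f hf) hbi).1
      rwa [sec_eq hf] at this
  · rcases Nat.eq_zero_or_pos f with rfl | hf0
    · rw [hzero, entry_base hi]
      have : 2 ^ pr.L < 2 ^ pr.W := Nat.pow_lt_pow_right (by norm_num) hLW
      simp only [List.length_nil]
      omega
    · simp only [entry_addr hi hf hf0]
      have := (listAt_section hbody (hsec f hf) hbi).2
      rw [sec_eq hf] at this
      omega

end Data

/-! ### The space -/

section Space

variable {pr} {w : World}

/-- A sum over starts of pieces, each of which is charged to the ranks of its piece. -/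
theorem sum_starts_le {g : ℕ} (hg : g ≤ w.L) (G F : ℕ → ℕ) (h0 : ∀ r, ¬ w.IsStart g r → G r = 0)
    (h1 : ∀ r, G r ≤ 2 ^ w.kap g r * F (w.kap g r)) :
    ∑ r ∈ Finset.range (2 ^ w.L), G r ≤ ∑ r ∈ Finset.range (2 ^ w.L), F (w.kap g r) := by
  have key : ∀ d r₀, r₀ + d = 2 ^ w.L → w.IsStart g r₀ →
      ∑ r ∈ Finset.Ico r₀ (2 ^ w.L), G r ≤ ∑ r ∈ Finset.Ico r₀ (2 ^ w.L), F (w.kap g r) := by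
    intro d
    induction d using Nat.strong_induction_on with
    | _ d ih =>
      intro r₀ hd hs
      rcases Nat.eq_zero_or_pos d with rfl | hpos
      · rw [add_zero] at hd; simp [hd]
      · have h2 := Nat.two_pow_pos (w.kap g r₀)
        have h3 : r₀ + 2 ^ w.kap g r₀ ≤ 2 ^ w.L := by
          by_contra h
          push Not at h
          have := eq_of_dvd_of_lt hs (pow_dvd_pow 2 (w.kap_le hg r₀)) (by omega) h
          omega
        rw [← Finset.sum_Ico_consecutive _ (Nat.le_add_right r₀ (2 ^ w.kap g r₀)) h3,
          ← Finset.sum_Ico_consecutive (fun r => F (w.kap g r))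
            (Nat.le_add_right r₀ (2 ^ w.kap g r₀)) h3]
        refine Nat.add_le_add ?_ (ih (d - 2 ^ w.kap g r₀) (by omega) _ (by omega)
          (w.isStart_next hs))
        rw [Finset.sum_eq_single_of_mem r₀ (by simp), Finset.sum_congr rfl
          (g := fun _ => F (w.kap g r₀))]
        · simpa using h1 r₀
        · intro x hx
          rw [Finset.mem_Ico] at hx
          rw [w.kap_eq_of_mem hs hx.1 hx.2]
        · intro x hx hne
          rw [Finset.mem_Ico] at hx
          exact h0 x (w.not_isStart hs (by omega) hx.2)
  have := key (2 ^ w.L) 0 (by simp) (dvd_zero _)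
  rwa [← Finset.range_eq_Ico] at this

theorem sq_le_three_mul_two_pow (k : ℕ) : (k + 1) ^ 2 ≤ 3 * 2 ^ k := by
  induction k with
  | zero => norm_num
  | succ k ih =>
    rcases Nat.lt_or_ge k 2 with h | h
    · interval_cases k <;> norm_num
    · rw [pow_succ 2 k]
      nlinarith

/-- All arrays together spend on a piece an amount that is proportional to its size and its
depth. -/
theorem sum_length_pieceCode_le {g : ℕ} (hg : g ≤ w.L) (r : ℕ) :
    ∑ j ∈ Finset.range (w.L + 1), (w.pieceCode g j r).length ≤
      2 ^ w.kap g r * (19 * (w.L - w.kap g r) + 7) := by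
  have hk := w.kap_le hg r
  obtain ⟨d, hd⟩ : ∃ d, w.L - w.kap g r = d := ⟨_, rfl⟩
  have hlen : ∀ j, (w.pieceCode g j r).length ≤ (w.kap g r + 1) +
      2 ^ w.kap g r * (if Included j d then 4 * 2 ^ j else 0) := by
    intro j
    refine (w.length_pieceCode_le g j r).trans (Nat.add_le_add_left ?_ _)
    rw [hd]
    have h1 : lowLen j d ≤ 2 ^ j := min_le_left _ _
    have h2 := Nat.two_pow_pos j
    split_ifs
    · exact Nat.mul_le_mul_left _ (by omega)
    · simp
  have hsum : ∀ n, (∑ j ∈ Finset.range n, if Included j d then 4 * 2 ^ j else 0) ≤ 4 * (4 * d + 1) := by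
    have aux : ∀ n, (∑ j ∈ Finset.range n, if Included j d then 2 ^ j else 0) + 1 ≤ 2 ^ n := by
      intro n
      induction n with
      | zero => simp
      | succ n ih =>
        rw [Finset.sum_range_succ, pow_succ]
        have : (if Included n d then 2 ^ n else 0) ≤ 2 ^ n := by split_ifs <;> simp
        omega
    have aux2 : ∀ n, (∑ j ∈ Finset.range n, if Included j d then 2 ^ j else 0) ≤ 4 * d + 1 := by
      intro n
      induction n with
      | zero => simp
      | succ n ih =>
        by_cases h : Included n d
        · have h1 := aux (n + 1)
          rcases h with rfl | h
          · simp at h1 ⊢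
            split_ifs <;> omega
          · rw [pow_succ] at h1
            omega
        · rw [Finset.sum_range_succ, if_neg h, add_zero]; exact ih
    intro n
    have := aux2 n
    calc _ = 4 * ∑ j ∈ Finset.range n, (if Included j d then 2 ^ j else 0) := by
          rw [Finset.mul_sum]
          exact Finset.sum_congr rfl fun j _ => by split_ifs <;> simp
      _ ≤ _ := Nat.mul_le_mul_left _ this
  refine (Finset.sum_le_sum fun j _ => hlen j).trans ?_
  rw [Finset.sum_add_distrib, ← Finset.mul_sum, Finset.sum_const, Finset.card_range, smul_eq_mul]
  have h1 := Nat.mul_le_mul_left (2 ^ w.kap g r) (hsum (w.L + 1))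
  have h2 := sq_le_three_mul_two_pow (w.kap g r)
  have h3 : w.L + 1 ≤ (d + 1) * (w.kap g r + 1) := by
    have : w.L = d + w.kap g r := by omega
    rw [this]
    nlinarith
  have h4 : (w.L + 1) * (w.kap g r + 1) ≤ (d + 1) * (3 * 2 ^ w.kap g r) := by
    calc _ ≤ (d + 1) * (w.kap g r + 1) * (w.kap g r + 1) := Nat.mul_le_mul_right _ h3
      _ = (d + 1) * (w.kap g r + 1) ^ 2 := by ring
      _ ≤ _ := Nat.mul_le_mul_left _ h2
  rw [hd]
  calc _ ≤ (d + 1) * (3 * 2 ^ w.kap g r) + 2 ^ w.kap g r * (4 * (4 * d + 1)) := Nat.add_le_add h4 h1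
    _ = _ := by ring

theorem sum_array_le {g : ℕ} (hg : g ≤ w.L) :
    ∑ j ∈ Finset.range (w.L + 1), ∑ r ∈ Finset.range (2 ^ w.L), (w.pieceCode g j r).length ≤
      ∑ r ∈ Finset.range (2 ^ w.L), (19 * w.dep r + 7) := by
  rw [Finset.sum_comm]
  refine (sum_starts_le hg (fun r => ∑ j ∈ Finset.range (w.L + 1), (w.pieceCode g j r).length)
    (fun k => 19 * (w.L - k) + 7) (fun r hr => ?_) (fun r => sum_length_pieceCode_le hg r)).trans ?_
  · refine Finset.sum_eq_zero fun j _ => ?_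
    rw [World.pieceCode, if_neg hr, List.length_nil]
  · refine Finset.sum_le_sum fun r _ => ?_
    have : w.kmono r ≤ w.kap g r := le_max_right _ _
    rw [World.dep]
    omega

theorem sum_levels_le :
    ∑ d ∈ Finset.range (2 * w.L + 1), ∑ r ∈ Finset.range (2 ^ w.L), (w.levelCode d r).length ≤
      ∑ r ∈ Finset.range (2 ^ w.L), (8 * w.dep r + 4) := by
  rw [Finset.sum_comm]
  refine Finset.sum_le_sum fun r _ => ?_
  simp only [w.length_levelCode]
  rw [← Finset.sum_filter, Finset.sum_const, smul_eq_mul]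
  have : ((Finset.range (2 * w.L + 1)).filter fun d => d ≤ 2 * w.dep r).card ≤ 2 * w.dep r + 1 := by
    refine (Finset.card_le_card (t := Finset.range (2 * w.dep r + 1)) fun d hd => ?_).trans (by simp)
    rw [Finset.mem_filter] at hd
    exact Finset.mem_range.2 (by omega)
  omega

/-- The length of all sections of a world. -/
theorem sum_fieldCode_le (hL : w.L = pr.L) :
    ∑ f ∈ Finset.range pr.F, ∑ r ∈ Finset.range (2 ^ pr.L), (pr.fieldCode w f r).length ≤
      46 * (∑ r ∈ Finset.range (2 ^ pr.L), w.dep r) + 18 * 2 ^ pr.L := by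
  have e : pr.F = 1 + (2 * pr.L + 1) + (pr.L + 1) + (pr.L + 1) := by rw [F]; ring
  rw [e, Finset.sum_range_add, Finset.sum_range_add, Finset.sum_range_add]
  have h0 : ∑ f ∈ Finset.range 1, ∑ r ∈ Finset.range (2 ^ pr.L), (pr.fieldCode w f r).length = 0 := by
    simp [fieldCode]
  have h1 : ∑ d ∈ Finset.range (2 * pr.L + 1), ∑ r ∈ Finset.range (2 ^ pr.L),
      (pr.fieldCode w (1 + d) r).length ≤ ∑ r ∈ Finset.range (2 ^ w.L), (8 * w.dep r + 4) := by
    refine le_trans (le_of_eq ?_) sum_levels_le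
    rw [hL]
    refine Finset.sum_congr rfl fun d hd => Finset.sum_congr rfl fun r _ => ?_
    rw [Finset.mem_range] at hd
    rw [fieldCode, if_neg (by omega), if_pos (by omega), Nat.add_sub_cancel_left]
  have h2 : ∑ j ∈ Finset.range (pr.L + 1), ∑ r ∈ Finset.range (2 ^ pr.L),
      (pr.fieldCode w (1 + (2 * pr.L + 1) + j) r).length ≤
      ∑ r ∈ Finset.range (2 ^ w.L), (19 * w.dep r + 7) := by
    refine le_trans (le_of_eq ?_) (sum_array_le (g := 0) (Nat.zero_le _))
    rw [hL]
    refine Finset.sum_congr rfl fun j hj => Finset.sum_congr rfl fun r _ => ?_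
    rw [Finset.mem_range] at hj
    rw [fieldCode, if_neg (by omega), if_neg (by omega), if_pos (by omega)]
    congr 2
    omega
  have h3 : ∑ j ∈ Finset.range (pr.L + 1), ∑ r ∈ Finset.range (2 ^ pr.L),
      (pr.fieldCode w (1 + (2 * pr.L + 1) + (pr.L + 1) + j) r).length ≤
      ∑ r ∈ Finset.range (2 ^ w.L), (19 * w.dep r + 7) := by
    refine le_trans (le_of_eq ?_) (sum_array_le (g := pr.g) (hL ▸ g_le))
    rw [hL]
    refine Finset.sum_congr rfl fun j hj => Finset.sum_congr rfl fun r _ => ?_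
    rw [Finset.mem_range] at hj
    rw [fieldCode, if_neg (by omega), if_neg (by omega), if_neg (by omega)]
    congr 2
    omega
  rw [h0, zero_add]
  refine (Nat.add_le_add (Nat.add_le_add h1 h2) h3).trans (le_of_eq ?_)
  rw [← Finset.sum_add_distrib, ← Finset.sum_add_distrib, hL]
  rw [Finset.sum_congr rfl (g := fun r => 46 * w.dep r + 18) fun r _ => by ring,
    Finset.sum_add_distrib, ← Finset.mul_sum]
  simp [mul_comm]

theorem length_dataBits_le {m seed : ℕ} {ws : ℕ → World} (hL : ∀ t < 2, (ws t).L = pr.L) :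
    (pr.dataBits m ws seed).length ≤ pr.W * pr.tableSize m +
      (46 * (∑ r ∈ Finset.range (2 ^ pr.L), (ws 0).dep r) + 18 * 2 ^ pr.L) +
      (46 * (∑ r ∈ Finset.range (2 ^ pr.L), (ws 1).dep r) + 18 * 2 ^ pr.L) := by
  rw [dataBits, List.length_append, length_table, length_flatMap_range_eq, two_mul,
    Finset.sum_range_add, ← add_assoc]
  simp only [length_flatMap_range_eq]
  refine Nat.add_le_add (Nat.add_le_add_left ?_ _) ?_
  · refine le_trans (le_of_eq ?_) (sum_fieldCode_le (hL 0 (by norm_num)))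
    refine Finset.sum_congr rfl fun f hf => ?_
    have := sec_eq (pr := pr) (ws := ws) (t := 0) (Finset.mem_range.1 hf)
    rw [zero_mul, zero_add] at this
    rw [this]
  · refine le_trans (le_of_eq ?_) (sum_fieldCode_le (hL 1 (by norm_num)))
    refine Finset.sum_congr rfl fun f hf => ?_
    have := sec_eq (pr := pr) (ws := ws) (t := 1) (Finset.mem_range.1 hf)
    rw [one_mul] at this
    rw [this]

end Space

end Params

/-! ### Random hash functions -/

section Hash

variable {L : ℕ}

/-- The number with the given binary digits. -/
def vecNum (v : Fin L → ZMod 2) : ℕ := Nat.ofBits fun j => decide (v j = 1)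

/-- The binary digits of a number. -/
def numVec (L y : ℕ) : Fin L → ZMod 2 := fun j => if y.testBit j then 1 else 0

theorem vecNum_lt (v : Fin L → ZMod 2) : vecNum v < 2 ^ L := Nat.ofBits_lt_two_pow _

theorem numVec_vecNum (v : Fin L → ZMod 2) : numVec L (vecNum v) = v := by
  funext j
  have h : ∀ z : ZMod 2, (if z = 1 then (1 : ZMod 2) else 0) = z := by decide
  rw [numVec, vecNum, Nat.testBit_ofBits_lt _ _ j.2]
  simp only [decide_eq_true_eq]
  exact h (v j)

theorem vecNum_numVec {y : ℕ} (hy : y < 2 ^ L) : vecNum (numVec L y) = y := by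
  have h : (fun j : Fin L => decide (numVec L y j = 1)) = fun j : Fin L => y.testBit j := by
    funext j
    rw [numVec]
    cases y.testBit j <;> simp
  rw [vecNum, h, Nat.ofBits_testBit, Nat.mod_eq_of_lt hy]

theorem agree_vecNum {P : Finset ℕ} (hP : P ⊆ Finset.range L) (u v : Fin L → ZMod 2) :
    Agree P (vecNum u) (vecNum v) ↔ ∀ j : Fin L, (j : ℕ) ∈ P → (u - v) j = 0 := by
  have h : ∀ a b : ZMod 2, decide (a = 1) = decide (b = 1) ↔ a - b = 0 := by decide
  constructor
  · intro H j hj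
    have := H j hj
    rw [vecNum, vecNum, Nat.testBit_ofBits_lt _ _ j.2, Nat.testBit_ofBits_lt _ _ j.2] at this
    exact (h _ _).1 this
  · intro H p hp
    have hpL := Finset.mem_range.1 (hP hp)
    rw [vecNum, vecNum, Nat.testBit_ofBits_lt _ _ hpL, Nat.testBit_ofBits_lt _ _ hpL]
    exact (h _ _).2 (H ⟨p, hpL⟩ hp)

theorem card_vanishing {P : Finset ℕ} (hP : P ⊆ Finset.range L) :
    (Finset.univ.filter fun v : Fin L → ZMod 2 => ∀ j : Fin L, (j : ℕ) ∈ P → v j = 0).card =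
      2 ^ (L - P.card) := by
  classical
  have h1 : (Finset.univ.filter fun v : Fin L → ZMod 2 => ∀ j : Fin L, (j : ℕ) ∈ P → v j = 0) =
      Fintype.piFinset fun j : Fin L => if (j : ℕ) ∈ P then {0} else Finset.univ := by
    ext v
    simp only [Finset.mem_filter, Finset.mem_univ, true_and, Fintype.mem_piFinset]
    refine forall_congr' fun j => ?_
    split_ifs with h <;> simp [h]
  rw [h1, Fintype.card_piFinset]
  have h2 : ∀ j : Fin L, (if (j : ℕ) ∈ P then ({0} : Finset (ZMod 2)) else Finset.univ).card =
      if (j : ℕ) ∈ P then 1 else 2 := by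
    intro j
    split_ifs
    · simp
    · rw [Finset.card_univ, ZMod.card]
  rw [Finset.prod_congr rfl fun j _ => h2 j,
    Fin.prod_univ_eq_prod_range (fun j => if j ∈ P then 1 else 2) L,
    Finset.prod_ite, Finset.prod_const_one, one_mul, Finset.prod_const]
  congr 1
  rw [Finset.filter_not, Finset.filter_mem_eq_inter, Finset.inter_eq_right.2 hP,
    Finset.card_sdiff_of_subset hP, Finset.card_range]

/-- A family of bijective hash functions on the numbers below `2 ^ L`, indexed by seeds that are
numbers, such that different arguments agree on a set of bits for at most the fraction of the seeds
given by `weight`. The functions are the multiplications with a nonzero element in the field with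
`2 ^ L` elements. -/
theorem exists_hash (hL : 0 < L) : ∃ (S : Type) (_ : Fintype S) (_ : Nonempty S) (num : S → ℕ)
    (hash : ℕ → ℕ → ℕ), (∀ a, num a < 2 ^ L) ∧ (∀ c y, hash c y < 2 ^ L) ∧
    (∀ a, ∀ y < 2 ^ L, ∀ y' < 2 ^ L, hash (num a) y = hash (num a) y' → y = y') ∧
    ∀ P ⊆ Finset.range L, ∀ y < 2 ^ L, ∀ y' < 2 ^ L, y ≠ y' →
      (Nat.card {a : S // Agree P (hash (num a) y) (hash (num a) y')} : ℝ) ≤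
        Params.weight L P * Fintype.card S := by
  classical
  have : Fact (Nat.Prime 2) := ⟨Nat.prime_two⟩
  let K := GaloisField 2 L
  let : Fintype K := Fintype.ofFinite K
  let φ : K ≃ₗ[ZMod 2] (Fin L → ZMod 2) :=
    (Module.finBasisOfFinrankEq (ZMod 2) K (GaloisField.finrank 2 hL.ne')).equivFun
  let ι : ℕ → K := fun y => φ.symm (numVec L y)
  have hι : ∀ y < 2 ^ L, ∀ y' < 2 ^ L, ι y = ι y' → y = y' := by
    intro y hy y' hy' h
    rw [← vecNum_numVec hy, ← vecNum_numVec hy', φ.symm.injective h]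
  let num : Kˣ → ℕ := fun a => vecNum (φ a)
  have hnum : ∀ a : Kˣ, ι (num a) = a := by
    intro a
    show φ.symm (numVec L (vecNum (φ a))) = a
    rw [numVec_vecNum, LinearEquiv.symm_apply_apply]
  have hinj : Function.Injective (vecNum : (Fin L → ZMod 2) → ℕ) := fun u v h => by
    rw [← numVec_vecNum u, ← numVec_vecNum v, h]
  refine ⟨Kˣ, inferInstance, inferInstance, num, fun c y => vecNum (φ (ι c * ι y)),
    fun a => vecNum_lt _, fun c y => vecNum_lt _, ?_, ?_⟩
  · intro a y hy y' hy' h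
    have h1 := φ.injective (hinj h)
    rw [hnum] at h1
    exact hι y hy y' hy' (a.isUnit.mul_left_cancel h1)
  · intro P hP y hy y' hy' hne
    have hc : ι y - ι y' ≠ 0 := fun h => hne (hι y hy y' hy' (sub_eq_zero.1 h))
    have hcard : Nat.card {a : Kˣ // Agree P (vecNum (φ (ι (num a) * ι y)))
        (vecNum (φ (ι (num a) * ι y')))} + 1 ≤ 2 ^ (L - P.card) := by
      rw [Nat.card_eq_fintype_card, Fintype.card_subtype, ← card_vanishing hP]
      have hmem : (0 : Fin L → ZMod 2) ∈ Finset.univ.filter fun v : Fin L → ZMod 2 =>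
          ∀ j : Fin L, (j : ℕ) ∈ P → v j = 0 := by simp
      rw [← Finset.card_erase_add_one hmem]
      refine Nat.add_le_add_right (Finset.card_le_card_of_injOn
        (fun a : Kˣ => φ (a * (ι y - ι y'))) ?_ ?_) 1
      · intro a ha
        have ha := (Finset.mem_filter.1 ha).2
        rw [hnum, agree_vecNum hP, ← map_sub, ← mul_sub] at ha
        refine Finset.mem_coe.2 (Finset.mem_erase.2 ⟨?_, Finset.mem_filter.2 ⟨Finset.mem_univ _, ha⟩⟩)
        rw [Ne, LinearEquiv.map_eq_zero_iff]
        exact mul_ne_zero a.ne_zero hc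
      · intro a _ b _ h
        exact Units.ext (mul_right_cancel₀ hc (φ.injective h))
    have hS : Fintype.card Kˣ + 1 = 2 ^ L := by
      rw [Fintype.card_units, ← Nat.card_eq_fintype_card, GaloisField.card 2 L hL.ne']
      have := Nat.one_le_two_pow (n := L)
      omega
    have hPL : P.card ≤ L := by simpa using Finset.card_le_card hP
    have h1 : (Nat.card {a : Kˣ // Agree P (vecNum (φ (ι (num a) * ι y)))
        (vecNum (φ (ι (num a) * ι y')))} : ℝ) + 1 ≤ 2 ^ (L - P.card) := by exact_mod_cast hcard
    have h2 : (Fintype.card Kˣ : ℝ) + 1 = 2 ^ L := by exact_mod_cast hS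
    rw [Params.weight]
    split_ifs with h
    · rw [h, Nat.sub_self, pow_zero] at h1
      linarith
    · have h3 : (2 : ℝ) ^ (L - P.card) = (1 / 2) ^ P.card * 2 ^ L := by
        rw [one_div, inv_pow, pow_sub₀ _ (by norm_num) hPL, mul_comm]
      have h4 : ((1 : ℝ) / 2) ^ P.card ≤ 1 := pow_le_one₀ (by norm_num) (by norm_num)
      rw [← h2, mul_add] at h3
      linarith

end Hash

/-! ### Strings as worlds -/

section StringWorld

variable {n : ℕ} {A : Type*} [LinearOrder A] [Fintype A] (L : ℕ) (x : Fin n → A)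

/-- The index of a character in the ordered alphabet. -/
def alphaIdx (a : A) : ℕ := ((Fintype.orderIsoFinOfCardEq A rfl).symm a : Fin (Fintype.card A))

theorem alphaIdx_lt (a : A) : alphaIdx a < Fintype.card A := Fin.is_lt _

theorem alphaIdx_le_iff (a a' : A) : alphaIdx a ≤ alphaIdx a' ↔ a ≤ a' := by
  rw [alphaIdx, alphaIdx, Fin.val_fin_le, OrderIso.le_iff_le]

/-- The boundaries between the runs of equal characters in the sorted string; a last run of
padding extends to `2 ^ L`. -/
def boundary (i : ℕ) : ℕ :=
  if i ≤ Fintype.card A then (Finset.univ.filter fun j => alphaIdx (x j) < i).card else 2 ^ L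

/-- The position of a given rank, in the order of the characters; beyond `n` there is padding, which
is its own position. -/
def sortPos (ρ : ℕ) : ℕ :=
  if h : ρ < n then (Tuple.sort (fun j => alphaIdx (x j)) ⟨ρ, h⟩ : Fin n) else ρ

/-- The string as a world, for a hash function. -/
def stringWorld (hash : ℕ → ℕ) : World where
  L := L
  m := Fintype.card A + 1
  b := boundary L x
  key ρ := hash (sortPos x ρ)

/-- The world with the order of the ranks reversed. -/
def World.mirror (w : World) : World where
  L := w.L
  m := w.m
  b i := 2 ^ w.L - w.b (w.m - i)
  key ρ := w.key (2 ^ w.L - 1 - ρ)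

variable {L x}

theorem boundary_zero : boundary L x 0 = 0 := by simp [boundary]

theorem boundary_le_n {i : ℕ} (hi : i ≤ Fintype.card A) : boundary L x i ≤ n := by
  rw [boundary, if_pos hi]
  exact (Finset.card_filter_le _ _).trans (by simp)

theorem boundary_card : boundary L x (Fintype.card A) = n := by
  rw [boundary, if_pos le_rfl, Finset.filter_true_of_mem fun j _ => alphaIdx_lt _]
  simp

theorem boundary_of_gt {i : ℕ} (hi : Fintype.card A < i) : boundary L x i = 2 ^ L := by
  rw [boundary, if_neg (by omega)]

theorem boundary_le (hn : n ≤ 2 ^ L) (i : ℕ) : boundary L x i ≤ 2 ^ L := by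
  by_cases hi : i ≤ Fintype.card A
  · exact (boundary_le_n hi).trans hn
  · rw [boundary_of_gt (by omega)]

theorem boundary_mono (hn : n ≤ 2 ^ L) : Monotone (boundary L x) := by
  intro i i' h
  by_cases hi : i' ≤ Fintype.card A
  · rw [boundary, boundary, if_pos hi, if_pos (h.trans hi)]
    refine Finset.card_le_card fun j hj => ?_
    rw [Finset.mem_filter] at hj ⊢
    exact ⟨hj.1, by omega⟩
  · rw [boundary_of_gt (i := i') (by omega)]
    exact boundary_le hn i

theorem lt_boundary_iff (ρ : Fin n) {i : ℕ} (hi : i ≤ Fintype.card A) :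
    (ρ : ℕ) < boundary L x i ↔ alphaIdx (x (Tuple.sort (fun j => alphaIdx (x j)) ρ)) < i := by
  have h := Tuple.lt_card_lt_iff_apply_lt_of_monotone (j := ρ) (a := i)
    (Tuple.monotone_sort fun j => alphaIdx (x j))
  simp only [Function.comp] at h
  rw [← h, boundary, if_pos hi]
  have e : (Finset.univ.filter fun j => alphaIdx (x j) < i).card =
      (Finset.univ.filter fun j =>
        alphaIdx (x (Tuple.sort (fun j => alphaIdx (x j)) j)) < i).card := by
    refine (Finset.card_bij (fun j _ => Tuple.sort (fun j => alphaIdx (x j)) j) ?_ ?_ ?_).symm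
    · intro j hj; simpa using hj
    · intro j _ j' _ h'; exact (Tuple.sort _).injective h'
    · intro j hj
      exact ⟨(Tuple.sort fun j => alphaIdx (x j)).symm j, by simpa using hj, by simp⟩
  rw [e]

/-- The result of a range query is an interval of ranks. -/
theorem sort_mem_rangeAnswer (l r : A) (ρ : Fin n) :
    Tuple.sort (fun j => alphaIdx (x j)) ρ ∈ rangeAnswer x l r ↔
      boundary L x (alphaIdx l) ≤ ρ ∧ (ρ : ℕ) < boundary L x (alphaIdx r + 1) := by
  rw [lt_boundary_iff ρ (alphaIdx_lt r), ← not_lt (b := boundary L x (alphaIdx l)),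
    lt_boundary_iff ρ (alphaIdx_lt l).le, rangeAnswer]
  simp only [Finset.mem_filter, Finset.mem_univ, true_and, not_lt, Nat.lt_succ_iff]
  rw [alphaIdx_le_iff, alphaIdx_le_iff]

theorem card_rangeAnswer (l r : A) : (rangeAnswer x l r).card =
    boundary L x (alphaIdx r + 1) - boundary L x (alphaIdx l) := by
  have hr : boundary L x (alphaIdx r + 1) ≤ n := boundary_le_n (alphaIdx_lt r)
  rw [← Nat.card_Ico]
  refine (Finset.card_bij (fun ρ hρ => (Tuple.sort (fun j => alphaIdx (x j))
    ⟨ρ, (Finset.mem_Ico.1 hρ).2.trans_le hr⟩ : Fin n)) ?_ ?_ ?_).symm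
  · intro ρ hρ
    exact (sort_mem_rangeAnswer (L := L) l r _).2 (Finset.mem_Ico.1 hρ)
  · intro ρ _ ρ' _ h
    simpa using h
  · intro j hj
    have h := (sort_mem_rangeAnswer (x := x) (L := L) l r
      ((Tuple.sort fun j => alphaIdx (x j)).symm j)).1 (by simpa using hj)
    exact ⟨_, Finset.mem_Ico.2 h, by simp⟩

theorem sortPos_lt {ρ : ℕ} (hρ : ρ < n) : sortPos x ρ < n := by
  rw [sortPos, dif_pos hρ]; exact Fin.is_lt _

theorem sortPos_inj {ρ ρ' : ℕ} (h : sortPos x ρ = sortPos x ρ') : ρ = ρ' := by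
  by_cases h1 : ρ < n <;> by_cases h2 : ρ' < n
  · rw [sortPos, sortPos, dif_pos h1, dif_pos h2] at h
    simpa using (Tuple.sort _).injective (Fin.ext h)
  · have := sortPos_lt (x := x) h1
    rw [h, sortPos, dif_neg h2] at this
    omega
  · have := sortPos_lt (x := x) h2
    rw [← h, sortPos, dif_neg h1] at this
    omega
  · rwa [sortPos, sortPos, dif_neg h1, dif_neg h2] at h

theorem sortPos_lt_two_pow (hn : n ≤ 2 ^ L) {ρ : ℕ} (hρ : ρ < 2 ^ L) : sortPos x ρ < 2 ^ L := by
  by_cases h : ρ < n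
  · exact (sortPos_lt h).trans_le hn
  · rw [sortPos, dif_neg h]; exact hρ

theorem mem_rangeAnswer_iff (l r : A) (i : Fin n) : i ∈ rangeAnswer x l r ↔
    ∃ ρ, boundary L x (alphaIdx l) ≤ ρ ∧ ρ < boundary L x (alphaIdx r + 1) ∧ sortPos x ρ = i := by
  have hr : boundary L x (alphaIdx r + 1) ≤ n := boundary_le_n (alphaIdx_lt r)
  constructor
  · intro hi
    have h := (sort_mem_rangeAnswer (x := x) (L := L) l r
      ((Tuple.sort fun j => alphaIdx (x j)).symm i)).1 (by simpa using hi)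
    exact ⟨_, h.1, h.2, by rw [sortPos, dif_pos (Fin.is_lt _)]; simp⟩
  · rintro ⟨ρ, h1, h2, h3⟩
    rw [sortPos, dif_pos (h2.trans_le hr)] at h3
    rw [← Fin.ext h3]
    exact (sort_mem_rangeAnswer l r _).2 ⟨h1, h2⟩

theorem valid_stringWorld (hn : n ≤ 2 ^ L) {hash : ℕ → ℕ} (h1 : ∀ y, hash y < 2 ^ L)
    (h2 : ∀ y < 2 ^ L, ∀ y' < 2 ^ L, hash y = hash y' → y = y') :
    (stringWorld L x hash).Valid :=
  ⟨fun _ _ => h1 _, fun _ hr _ hr' h =>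
    sortPos_inj (h2 _ (sortPos_lt_two_pow hn hr) _ (sortPos_lt_two_pow hn hr') h)⟩

theorem World.Valid.mirror {w : World} (hw : w.Valid) : w.mirror.Valid := by
  have h0 := Nat.two_pow_pos w.L
  refine ⟨fun r hr => hw.key_lt _ (by omega), fun r hr r' hr' h => ?_⟩
  have h1 : r < 2 ^ w.L := hr
  have h2 : r' < 2 ^ w.L := hr'
  have := hw.key_inj _ (by omega) _ (by omega) h
  omega

/-! ### The sum of the depths -/

theorem sum_dep_le (w : World) (hb : Monotone w.b) (h0 : w.b 0 = 0) (hm : w.b w.m = 2 ^ w.L) :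
    ∑ r ∈ Finset.range (2 ^ w.L), w.dep r ≤ ∑ i ∈ Finset.range w.m,
      (w.b (i + 1) - w.b i) * (w.L - Nat.log 2 (w.b (i + 1) - w.b i) + 4) := by
  have key : ∀ k ≤ w.m, ∑ r ∈ Finset.range (w.b k), w.dep r ≤ ∑ i ∈ Finset.range k,
      (w.b (i + 1) - w.b i) * (w.L - Nat.log 2 (w.b (i + 1) - w.b i) + 4) := by
    intro k
    induction k with
    | zero => intro _; simp [h0]
    | succ k ih =>
      intro hk
      rw [Finset.sum_range_succ, Finset.range_eq_Ico,
        ← Finset.sum_Ico_consecutive _ (Nat.zero_le _) (hb (Nat.le_succ k)), ← Finset.range_eq_Ico]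
      exact Nat.add_le_add (ih (by omega)) (w.sum_dep_run_le hb k (hm ▸ hb hk))
  rw [← hm]
  exact key _ le_rfl

theorem sum_dep_mirror_le (w : World) (hb : Monotone w.b) (h0 : w.b 0 = 0)
    (hm : w.b w.m = 2 ^ w.L) :
    ∑ r ∈ Finset.range (2 ^ w.L), w.mirror.dep r ≤ ∑ i ∈ Finset.range w.m,
      (w.b (i + 1) - w.b i) * (w.L - Nat.log 2 (w.b (i + 1) - w.b i) + 4) := by
  have hle : ∀ i ≤ w.m, w.b i ≤ 2 ^ w.L := fun i hi => hm ▸ hb hi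
  refine (sum_dep_le w.mirror ?_ ?_ ?_).trans (le_of_eq ?_)
  · intro i i' h
    exact Nat.sub_le_sub_left (hb (by omega)) _
  · simp [World.mirror, hm]
  · simp [World.mirror, h0]
  · rw [← Finset.sum_range_reflect]
    refine Finset.sum_congr rfl fun i hi => ?_
    have hi : i < w.m := Finset.mem_range.1 hi
    have e1 : w.m - (w.m - 1 - i + 1) = i := by omega
    have e2 : w.m - (w.m - 1 - i) = i + 1 := by omega
    have e3 : w.mirror.b (w.m - 1 - i + 1) - w.mirror.b (w.m - 1 - i) = w.b (i + 1) - w.b i := by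
      have h1 := hle i hi.le
      have h2 := hle (i + 1) hi
      have h3 := hb (Nat.le_succ i)
      show 2 ^ w.L - w.b (w.m - (w.m - 1 - i + 1)) - (2 ^ w.L - w.b (w.m - (w.m - 1 - i))) = _
      rw [e1, e2]
      omega
    show (w.mirror.b (w.m - 1 - i + 1) - w.mirror.b (w.m - 1 - i)) *
      (w.L - Nat.log 2 (w.mirror.b (w.m - 1 - i + 1) - w.mirror.b (w.m - 1 - i)) + 4) = _
    rw [e3]

theorem boundary_succ_sub (a : A) :
    boundary L x (alphaIdx a + 1) - boundary L x (alphaIdx a) = occ x a := by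
  rw [← card_rangeAnswer, rangeAnswer, occ]
  congr 1
  ext j
  simp [le_antisymm_iff, and_comm]

theorem sum_alphaIdx (f : ℕ → ℝ) :
    ∑ i ∈ Finset.range (Fintype.card A), f i = ∑ a : A, f (alphaIdx a) := by
  rw [← Fin.sum_univ_eq_sum_range, ← Equiv.sum_comp (Fintype.orderIsoFinOfCardEq A rfl).symm.toEquiv]
  rfl

theorem lg_natCast_lt (k : ℕ) (hk : k ≠ 0) : lg k < Nat.log 2 k + 1 := by
  have h := Nat.lt_pow_succ_log_self (b := 2) (by norm_num) k
  rw [lg, Real.logb_lt_iff_lt_rpow (by norm_num) (by positivity)]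
  exact_mod_cast h

theorem le_lg_natCast (k : ℕ) (hk : k ≠ 0) : (Nat.log 2 k : ℝ) ≤ lg k := by
  have h := Nat.pow_log_le_self 2 hk
  rw [lg, Real.le_logb_iff_rpow_le (by norm_num) (by positivity)]
  exact_mod_cast h

/-- The sum that bounds the depths is at most the entropy up to a linear term. -/
theorem sum_runs_le (hn : 0 < n) :
    ((∑ i ∈ Finset.range (Fintype.card A + 1),
      (boundary (Nat.log 2 n + 1) x (i + 1) - boundary (Nat.log 2 n + 1) x i) *
        (Nat.log 2 n + 1 -
          Nat.log 2 (boundary (Nat.log 2 n + 1) x (i + 1) - boundary (Nat.log 2 n + 1) x i) + 4) :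
        ℕ) : ℝ) ≤ n * entropyZero x + 18 * n := by
  set L := Nat.log 2 n + 1 with hL
  have hN : 2 ^ L ≤ 2 * n := by
    rw [hL, pow_succ]; have := Nat.pow_log_le_self 2 hn.ne'; omega
  have hlgn := le_lg_natCast n hn.ne'
  rw [Finset.sum_range_succ, boundary_card, boundary_of_gt (by omega), Nat.cast_add, Nat.cast_sum,
    sum_alphaIdx (A := A) fun i => (((boundary L x (i + 1) - boundary L x i) *
      (L - Nat.log 2 (boundary L x (i + 1) - boundary L x i) + 4) : ℕ) : ℝ)]
  have hpad : ((2 ^ L - n) * (L - Nat.log 2 (2 ^ L - n) + 4) : ℕ) ≤ 12 * n := by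
    set p := 2 ^ L - n with hp
    have h1 : p * 4 ≤ 4 * n := by omega
    have h2 : p * (L - Nat.log 2 p) ≤ 2 * 2 ^ L := by
      rcases Nat.lt_or_ge (Nat.log 2 p) L with h | h
      · obtain ⟨k, hk⟩ := Nat.exists_eq_add_of_lt h
        have h3 : p ≤ 2 ^ (Nat.log 2 p + 1) := (Nat.lt_pow_succ_log_self (by norm_num) p).le
        calc p * (L - Nat.log 2 p) ≤ 2 ^ (Nat.log 2 p + 1) * 2 ^ (k + 1) :=
              Nat.mul_le_mul h3 (by
                have : k + 1 < 2 ^ (k + 1) := Nat.lt_two_pow_self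
                omega)
          _ = 2 * 2 ^ L := by rw [← pow_add, hk, ← pow_succ']; congr 1; ring
      · rw [Nat.sub_eq_zero_of_le h]; omega
    rw [mul_add]; omega
  have hpad' : (((2 ^ L - n) * (L - Nat.log 2 (2 ^ L - n) + 4) : ℕ) : ℝ) ≤ 12 * n := by
    exact_mod_cast hpad
  have hrun : ∀ a : A, (((boundary L x (alphaIdx a + 1) - boundary L x (alphaIdx a)) *
      (L - Nat.log 2 (boundary L x (alphaIdx a + 1) - boundary L x (alphaIdx a)) + 4) : ℕ) : ℝ) ≤
      n * ((occ x a / n : ℝ) * lg (n / occ x a)) + 6 * occ x a := by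
    intro a
    rw [boundary_succ_sub]
    rcases Nat.eq_zero_or_pos (occ x a) with h | h
    · simp [h]
    · have hocc : occ x a ≤ n := (Finset.card_filter_le _ _).trans (by simp)
      have h1 : Nat.log 2 (occ x a) ≤ L := (Nat.log_mono_right hocc).trans (by omega)
      have h2 := lg_natCast_lt (occ x a) h.ne'
      have hn' : (n : ℝ) ≠ 0 := by positivity
      have ho' : (occ x a : ℝ) ≠ 0 := by positivity
      have h3 : lg (n / occ x a) = lg n - lg (occ x a) := Real.logb_div hn' ho'
      have h4 : (L : ℝ) = Nat.log 2 n + 1 := by rw [hL]; push_cast; ring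
      rw [h3, Nat.cast_mul, Nat.cast_add, Nat.cast_sub h1, ← mul_assoc, mul_div_cancel₀ _ hn']
      have h5 : (L : ℝ) - Nat.log 2 (occ x a) + (4 : ℕ) ≤ lg n - lg (occ x a) + 6 := by
        push_cast; linarith
      calc _ ≤ (occ x a : ℝ) * (lg n - lg (occ x a) + 6) := by gcongr
        _ = _ := by ring
  have hocc : ∑ a : A, (occ x a : ℝ) = n := by
    have : ∑ a : A, occ x a = n := by
      have := Finset.card_eq_sum_card_fiberwise (s := (Finset.univ : Finset (Fin n))) (f := x)
        (t := Finset.univ) (by simp [Set.MapsTo])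
      simpa [occ] using this.symm
    exact_mod_cast this
  have := Finset.sum_le_sum fun a (_ : a ∈ Finset.univ) => hrun a
  rw [Finset.sum_add_distrib, ← Finset.mul_sum, ← Finset.mul_sum, hocc] at this
  rw [entropyZero]
  linarith

end StringWorld

/-! ### Queries with two halves -/

/-- The point at which the interval of ranks `s, …, t - 1` is split: the multiple of the largest
power of two in the interval. -/
def midRank (L s t : ℕ) : ℕ :=
  t / 2 ^ Nat.findGreatest (fun J => s ≤ t / 2 ^ J * 2 ^ J) L *
    2 ^ Nat.findGreatest (fun J => s ≤ t / 2 ^ J * 2 ^ J) L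

theorem midRank_spec {L s t : ℕ} (hst : s ≤ t) (ht : t < 2 ^ L) :
    s ≤ midRank L s t ∧ midRank L s t ≤ t ∧
      ∃ J ≤ L, 2 ^ J ∣ midRank L s t ∧ midRank L s t - s < 2 ^ J ∧ t - midRank L s t < 2 ^ J := by
  have hJ : Nat.findGreatest (fun J => s ≤ t / 2 ^ J * 2 ^ J) L ≤ L := Nat.findGreatest_le _
  have hspec := Nat.findGreatest_spec (P := fun J => s ≤ t / 2 ^ J * 2 ^ J) (Nat.zero_le L)
    (by simpa using hst)
  have hgt := fun k h h' => Nat.findGreatest_is_greatest (P := fun J => s ≤ t / 2 ^ J * 2 ^ J)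
    (n := L) (k := k) h h'
  rw [midRank]
  generalize Nat.findGreatest (fun J => s ≤ t / 2 ^ J * 2 ^ J) L = J at *
  have h0 := Nat.two_pow_pos J
  have hmod := Nat.mod_lt t h0
  have hdm := Nat.div_add_mod' t (2 ^ J)
  refine ⟨hspec, Nat.div_mul_le_self _ _, J, hJ, Dvd.intro_left _ rfl, ?_, by omega⟩
  rcases hJ.lt_or_eq with h | rfl
  · have h1 := hgt (J + 1) (Nat.lt_succ_self _) h
    rw [pow_succ, ← Nat.div_div_eq_div_mul, mul_comm (2 ^ J) 2, ← mul_assoc] at h1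
    have h2 : t / 2 ^ J / 2 * 2 + 1 ≥ t / 2 ^ J := by omega
    have h3 := Nat.mul_le_mul_right (2 ^ J) h2
    rw [add_mul, one_mul] at h3
    omega
  · rw [Nat.div_eq_of_lt ht]
    simp

theorem ceilPow_log_eq {L J s z : ℕ} (hz : z ≠ 0) (hJ : J ≤ L) (hd : 2 ^ J ∣ s + z)
    (h : z < 2 ^ J) : ceilPow (Nat.log 2 z + 1) s = s + z ∧ Nat.log 2 z + 1 ≤ L := by
  have h1 : Nat.log 2 z + 1 ≤ J := Nat.log_lt_of_lt_pow hz h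
  refine ⟨ceilPow_eq (Nat.le_add_right _ _) ((pow_dvd_pow 2 h1).trans hd) ?_, h1.trans hJ⟩
  have := Nat.lt_pow_succ_log_self (b := 2) (by norm_num) z
  exact Nat.add_lt_add_left this s

/-- The half of the query above the split point, seen in the reversed order. -/
theorem midRank_right {L s t : ℕ} (hst : s ≤ t) (ht : t < 2 ^ L) (hz : t - midRank L s t ≠ 0) :
    ceilPow (Nat.log 2 (t - midRank L s t) + 1) (2 ^ L - t) = 2 ^ L - t + (t - midRank L s t) ∧
      Nat.log 2 (t - midRank L s t) + 1 ≤ L := by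
  obtain ⟨h1, h2, J, h3, h4, h5, h6⟩ := midRank_spec hst ht
  refine ceilPow_log_eq hz h3 ?_ h6
  rw [show 2 ^ L - t + (t - midRank L s t) = 2 ^ L - midRank L s t by omega]
  exact Nat.dvd_sub (pow_dvd_pow 2 h3) h4

theorem midRank_left {L s t : ℕ} (hst : s ≤ t) (ht : t < 2 ^ L) (hz : midRank L s t - s ≠ 0) :
    ceilPow (Nat.log 2 (midRank L s t - s) + 1) s = s + (midRank L s t - s) ∧
      Nat.log 2 (midRank L s t - s) + 1 ≤ L := by
  obtain ⟨h1, h2, J, h3, h4, h5, h6⟩ := midRank_spec hst ht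
  refine ceilPow_log_eq hz h3 ?_ h5
  rwa [Nat.add_sub_cancel' h1]

namespace Params

variable (pr : Params)

/-- The tasks of a query for the ranks from boundary `il` to boundary `ir`, which have the values
`s` and `t`; the second half, which is marked `true`, is done in the reversed order. -/
def queryTasks (m il ir e s t : ℕ) : List (Bool × Task) :=
  if s < t then
    (pr.sideTasks (pr.baseIdx m 0 il) s (midRank pr.L s t - s) e).map (Prod.mk false) ++
      (pr.sideTasks (pr.baseIdx m 1 (m - ir)) (2 ^ pr.L - t) (t - midRank pr.L s t) e).map
        (Prod.mk true)
  else []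

/-- The bits on which the hash value of a position has to agree with that of the element of rank
`ρ`, in order that the position is generated. -/
noncomputable def queryBits (w : World) (e s t ρ : ℕ) : Finset ℕ :=
  if ρ < midRank pr.L s t then pr.sideBits w s (midRank pr.L s t - s) e ρ
  else pr.sideBits w.mirror (2 ^ pr.L - t) (t - midRank pr.L s t) e (2 ^ pr.L - 1 - ρ)

/-- The hits of a task in the half of the query to which it belongs. -/
def QueryHits (w : World) (s t h : ℕ) (τ : Bool × Task) : Prop :=
  if τ.1 then Hits w.mirror (2 ^ w.L - t) h τ.2 else Hits w s h τ.2

variable {pr}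

theorem query_hits_iff {w : World} (hL : w.L = pr.L) (hw : w.Valid) {m il ir e s t h : ℕ}
    (ht : t < 2 ^ pr.L) (hh : h < 2 ^ pr.L) :
    (∃ τ ∈ pr.queryTasks m il ir e s t, QueryHits w s t h τ) ↔
      ∃ ρ, s ≤ ρ ∧ ρ < t ∧ Agree (pr.queryBits w e s t ρ) h (w.key ρ) := by
  rw [queryTasks]
  split_ifs with hst
  swap
  · simp; intros; omega
  obtain ⟨h1, h2, -⟩ := midRank_spec hst.le ht
  rw [exists_mem_append]
  have hleft := side_hits_iff (base := pr.baseIdx m 0 il) (e := e) hL hw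
    (fun hz => (midRank_left hst.le ht hz).1) (by omega) hh
  have hright := side_hits_iff (w := w.mirror) (base := pr.baseIdx m 1 (m - ir)) (e := e) hL
    hw.mirror (fun hz => (midRank_right hst.le ht hz).1) (by omega) hh
  have e1 : (∃ τ ∈ (pr.sideTasks (pr.baseIdx m 0 il) s (midRank pr.L s t - s) e).map
      (Prod.mk false), QueryHits w s t h τ) ↔
      ∃ τ ∈ pr.sideTasks (pr.baseIdx m 0 il) s (midRank pr.L s t - s) e, Hits w s h τ := by
    simp [QueryHits]
  have e2 : (∃ τ ∈ (pr.sideTasks (pr.baseIdx m 1 (m - ir)) (2 ^ pr.L - t) (t - midRank pr.L s t)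
      e).map (Prod.mk true), QueryHits w s t h τ) ↔
      ∃ τ ∈ pr.sideTasks (pr.baseIdx m 1 (m - ir)) (2 ^ pr.L - t) (t - midRank pr.L s t) e,
        Hits w.mirror (2 ^ pr.L - t) h τ := by
    simp [QueryHits, hL]
  have hkey : ∀ ρ, w.mirror.key ρ = w.key (2 ^ pr.L - 1 - ρ) := fun ρ => by rw [← hL]; rfl
  rw [e1, e2, hleft, hright]
  constructor
  · rintro (⟨ρ, h3, h4, h5⟩ | ⟨ρ, h3, h4, h5⟩)
    · refine ⟨ρ, h3, by omega, ?_⟩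
      rwa [queryBits, if_pos (by omega)]
    · refine ⟨2 ^ pr.L - 1 - ρ, by omega, by omega, ?_⟩
      rw [queryBits, if_neg (by omega), show 2 ^ pr.L - 1 - (2 ^ pr.L - 1 - ρ) = ρ by omega]
      rwa [hkey] at h5
  · rintro ⟨ρ, h3, h4, h5⟩
    rw [queryBits] at h5
    split_ifs at h5 with h6
    · exact Or.inl ⟨ρ, h3, by omega, h5⟩
    · refine Or.inr ⟨2 ^ pr.L - 1 - ρ, by omega, by omega, ?_⟩
      rw [hkey]
      rwa [show 2 ^ pr.L - 1 - (2 ^ pr.L - 1 - ρ) = ρ by omega]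

theorem queryBits_subset {w : World} {e s t ρ : ℕ} :
    pr.queryBits w e s t ρ ⊆ Finset.range pr.L := by
  rw [queryBits]; split_ifs <;> exact sideBits_subset

theorem log_succ_le {L z : ℕ} (hL : 0 < L) (h : z ≠ 0 → Nat.log 2 z + 1 ≤ L) :
    Nat.log 2 z + 1 ≤ L := by
  rcases eq_or_ne z 0 with rfl | h0
  · simpa using Nat.succ_le_of_lt hL
  · exact h h0

/-- With accuracy at least `L`, a query is exact. -/
theorem card_queryBits {w : World} (hL : w.L = pr.L) (hL0 : 0 < pr.L) {e s t ρ : ℕ}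
    (hst : s ≤ t) (ht : t < 2 ^ pr.L) (he : pr.L ≤ e) :
    (pr.queryBits w e s t ρ).card = pr.L := by
  rw [queryBits]
  split_ifs
  · exact card_sideBits hL (log_succ_le hL0 fun hz => (midRank_left hst ht hz).2) he
  · exact card_sideBits (w := w.mirror) hL
      (log_succ_le hL0 fun hz => (midRank_right hst ht hz).2) he

/-- The shares of all elements of a query in the error probability. -/
theorem sum_weight_query_le {w : World} (hL : w.L = pr.L) {e s t : ℕ}
    (hst : s ≤ t) (ht : t < 2 ^ pr.L) (hν : 2 * (w.m + 1) * pr.L + 1 ≤ 2 ^ pr.ν) :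
    ∑ ρ ∈ Finset.Ico s t, weight pr.L (pr.queryBits w e s t ρ) ≤ 2 * (1 / 2) ^ e := by
  obtain ⟨h1, h2, -⟩ := midRank_spec hst ht
  rw [← Finset.sum_Ico_consecutive _ h1 h2, two_mul]
  refine add_le_add ?_ ?_
  · rcases eq_or_ne (midRank pr.L s t - s) 0 with hz | hz
    · rw [Finset.Ico_eq_empty_of_le (by omega)]; simp
    obtain ⟨h3, h4⟩ := midRank_left hst ht hz
    have := sum_weight_le (e := e) hL h3 (by omega) h4 hν
    rw [Nat.add_sub_cancel' h1] at this
    refine le_trans (le_of_eq (Finset.sum_congr rfl fun ρ hρ => ?_)) this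
    rw [queryBits, if_pos (Finset.mem_Ico.1 hρ).2]
  · rcases eq_or_ne (t - midRank pr.L s t) 0 with hz | hz
    · rw [Finset.Ico_eq_empty_of_le (by omega)]; simp
    obtain ⟨h3, h4⟩ := midRank_right hst ht hz
    have := sum_weight_le (w := w.mirror) (e := e) hL h3 (by omega) h4 hν
    refine le_trans (le_of_eq ?_) this
    refine Finset.sum_bij' (fun ρ _ => 2 ^ pr.L - 1 - ρ) (fun ρ _ => 2 ^ pr.L - 1 - ρ) ?_ ?_ ?_ ?_ ?_
    · intro ρ hρ; rw [Finset.mem_Ico] at hρ ⊢; omega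
    · intro ρ hρ; rw [Finset.mem_Ico] at hρ ⊢; omega
    · intro ρ hρ; rw [Finset.mem_Ico] at hρ; omega
    · intro ρ hρ; rw [Finset.mem_Ico] at hρ; omega
    · intro ρ hρ
      rw [queryBits, if_neg (not_lt.2 (Finset.mem_Ico.1 hρ).1)]

theorem length_sideTasks_le {base s z e : ℕ} (hzL : Nat.log 2 z + 1 ≤ pr.L) :
    (pr.sideTasks base s z e).length ≤ 3 * pr.L + 2 := by
  have hgroup : ∀ fld g r₀ r₁ e, (pr.groupTasks fld g r₀ r₁ e).length ≤ pr.L + 1 := by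
    intro fld g r₀ r₁ e
    have h1 : pr.grpExp e ≤ pr.Jm := min_le_right _ _
    have h2 := Jm_le (pr := pr)
    simp only [groupTasks, List.length_map, List.length_range]
    omega
  have hnode : (pr.nodeTasks base s z e).length ≤ pr.L := by
    rw [nodeTasks, List.length_map]
    refine (List.length_filter_le _ _).trans ?_
    rw [List.length_range']
    omega
  rw [sideTasks]
  split_ifs
  · simp
  rw [List.length_append, scanTasks]
  split_ifs
  · have := hgroup (base + (2 * pr.L + 2)) 0 (ceilPow 0 s) (ceilPow (pr.cutExp z e) s)
      (e + 2 + pr.ν)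
    omega
  · rw [List.length_append]
    have h1 := hgroup (base + (3 * pr.L + 3)) pr.g (ceilPow pr.g s) (ceilPow (pr.cutExp z e) s)
      (e + 2 + (pr.β - pr.g))
    have h2 := hgroup (base + (2 * pr.L + 2)) 0 (ceilPow 0 s)
      (ceilPow (min pr.g (pr.cutExp z e)) s) (e + 2 + pr.g)
    omega
  · have h2 := hgroup (base + (2 * pr.L + 2)) 0 (ceilPow 0 s)
      (ceilPow (min pr.g (pr.cutExp z e)) s) (e + 2 + pr.g)
    rw [List.nil_append]
    omega

theorem length_queryTasks_le (hL0 : 0 < pr.L) {m il ir e s t : ℕ} (ht : t < 2 ^ pr.L) :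
    (pr.queryTasks m il ir e s t).length ≤ 6 * pr.L + 4 := by
  rw [queryTasks]
  split_ifs with hst
  swap
  · simp
  rw [List.length_append, List.length_map, List.length_map]
  have h1 := length_sideTasks_le (pr := pr) (base := pr.baseIdx m 0 il) (s := s) (e := e)
    (log_succ_le hL0 fun hz => (midRank_left hst.le ht hz).2)
  have h2 := length_sideTasks_le (pr := pr) (base := pr.baseIdx m 1 (m - ir)) (s := 2 ^ pr.L - t)
    (e := e) (log_succ_le hL0 fun hz => (midRank_right hst.le ht hz).2)
  omega

/-- The I/Os of all the tasks of a query. -/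
theorem query_cost_le (hp : pr.Valid) {κ m il ir e s t : ℕ} (hν : pr.ν ≤ κ * (pr.E₀ + 1))
    (he : e ≤ 2 * pr.L) (ht : t < 2 ^ pr.L) :
    ((pr.queryTasks m il ir e s t).map fun τ => taskCost pr.B τ.2).sum * pr.B ≤
      (48 * κ + 172) * (e + 4) * (t - s) + 400 * (pr.Jm + 1) * pr.B := by
  rw [queryTasks]
  split_ifs with hst
  swap
  · simp
  obtain ⟨h1, h2, -⟩ := midRank_spec hst.le ht
  have h3 := side_cost_le (base := pr.baseIdx m 0 il) (s := s) hp hν he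
    (log_succ_le hp.L_pos fun hz => (midRank_left hst.le ht hz).2)
  have h4 := side_cost_le (base := pr.baseIdx m 1 (m - ir)) (s := 2 ^ pr.L - t) hp hν he
    (log_succ_le hp.L_pos fun hz => (midRank_right hst.le ht hz).2)
  have h5 : t - s = (midRank pr.L s t - s) + (t - midRank pr.L s t) := by omega
  rw [List.map_append, List.map_map, List.map_map, List.sum_append, add_mul, h5, mul_add]
  refine (Nat.add_le_add h3 h4).trans (le_of_eq ?_)
  ring

end Params

/-! ### The query machine -/

/-- A query as it is given to the machine: the indices of the two boundaries, and the accuracy. -/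
@[ext] structure QueryArgs where
  il : ℕ
  ir : ℕ
  e : ℕ

/-- What is known of a query after the table has been consulted: in addition to the query, the seed
of the hash function and the values of the two boundaries. -/
@[ext] structure QueryPar extends QueryArgs where
  seed : ℕ
  s : ℕ
  t : ℕ

/-- The numbers fit into `W` bits. -/
def QueryArgs.Good (W : ℕ) (q : QueryArgs) : Prop := q.il < 2 ^ W ∧ q.ir < 2 ^ W ∧ q.e < 2 ^ W

/-- The numbers fit into `W` bits. -/
def QueryPar.Good (W : ℕ) (p : QueryPar) : Prop :=
  p.toQueryArgs.Good W ∧ p.seed < 2 ^ W ∧ p.s < 2 ^ W ∧ p.t < 2 ^ W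

/-- The control states of the machine. -/
abbrev QueryState : Type := QueryArgs ⊕ QueryPar × ℕ × Inner

/-- A state within a task as a sequence of numbers. -/
def Inner.code : Inner → ℕ → ℕ
  | .fresh, _ => 0
  | .scan a st, i => [1, a, st.mode, st.rk, st.kp, st.q, st.got, st.acc].getD i 0
  | .node c ptr, i => if i = 0 then 2 else if i = 1 then c else ptr (i - 2)

/-- A control state as a sequence of numbers. -/
def QueryState.code : QueryState → ℕ → ℕ
  | .inl q, i => [0, q.il, q.ir, q.e].getD i 0
  | .inr (p, k, x), i =>
    if i < 8 then [1, p.il, p.ir, p.e, p.seed, p.s, p.t, k].getD i 0 else x.code (i - 8)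

theorem getD_lt {l : List ℕ} {N : ℕ} (hN : 0 < N) (h : ∀ v ∈ l, v < N) (i : ℕ) : l.getD i 0 < N := by
  rw [List.getD_eq_getElem?_getD]
  rcases hv : l[i]? with _ | v
  · exact hN
  · exact h v (List.mem_of_getElem? hv)

theorem Inner.code_lt {L W X : ℕ} (hW : L + 1 < W) {x : Inner} (hx : x.Good L W X) (i : ℕ) :
    x.code i < 2 ^ W := by
  have h0 : 0 < 2 ^ W := Nat.two_pow_pos W
  have h2 : 2 < 2 ^ W := by
    calc 2 < 2 ^ 2 := by norm_num
      _ ≤ 2 ^ W := Nat.pow_le_pow_right (by norm_num) (by omega)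
  cases x with
  | fresh => exact h0
  | scan a st =>
    obtain ⟨h1, h3, h4, h5, h6, h7, h8⟩ := hx
    have hL : ∀ k ≤ L, 2 ^ k < 2 ^ W := fun k hk => Nat.pow_lt_pow_right (by norm_num) (by omega)
    have hL' : ∀ k ≤ L, k < 2 ^ W := fun k hk => Nat.lt_two_pow_self.trans (hL k hk)
    refine getD_lt h0 ?_ i
    simp only [List.mem_cons, List.not_mem_nil, or_false]
    rintro v (rfl | rfl | rfl | rfl | rfl | rfl | rfl | rfl)
    · omega
    · exact h1
    · omega
    · exact h4.trans_lt (hL L le_rfl)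
    · exact hL' _ h5
    · exact h6.trans (hL _ h5)
    · exact hL' _ h7
    · exact h8.trans (hL _ h7)
  | node c ptr =>
    obtain ⟨h1, h3⟩ := hx
    rw [Inner.code]
    split_ifs
    · exact h2
    · exact h1
    · exact (h3 _).1

theorem Inner.code_injOn {L W X : ℕ} {x x' : Inner} (hx : x.Good L W X) (hx' : x'.Good L W X)
    (h : ∀ i < X + 8, x.code i = x'.code i) : x = x' := by
  have c0 := h 0 (by omega)
  cases x with
  | fresh => cases x' <;> simp [Inner.code] at c0 ⊢
  | scan a st =>
    cases x' with
    | fresh => simp [Inner.code] at c0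
    | node => simp [Inner.code] at c0
    | scan a' st' =>
      have c1 := h 1 (by omega)
      have c2 := h 2 (by omega)
      have c3 := h 3 (by omega)
      have c4 := h 4 (by omega)
      have c5 := h 5 (by omega)
      have c6 := h 6 (by omega)
      have c7 := h 7 (by omega)
      simp only [Inner.code, List.getD_cons_succ, List.getD_cons_zero] at c1 c2 c3 c4 c5 c6 c7
      rw [c1, Decoder.ext c2 c3 c4 c5 c6 c7]
  | node c ptr =>
    cases x' with
    | fresh => simp [Inner.code] at c0
    | scan => simp [Inner.code] at c0
    | node c' ptr' =>
      have c1 := h 1 (by omega)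
      simp only [Inner.code] at c1
      have hptr : ptr = ptr' := by
        funext i
        rcases Nat.lt_or_ge i X with hi | hi
        · simpa [Inner.code] using h (i + 2) (by omega)
        · rw [(hx.2 i).2 hi, (hx'.2 i).2 hi]
      rw [hptr]
      simpa using c1

/-- The states with room in memory. -/
abbrev QueryState.Good (L W X kmax : ℕ) : QueryState → Prop :=
  TaskGood (QueryArgs.Good W) (QueryPar.Good W) (Inner.Good L W X) kmax

theorem QueryState.code_lt {L W X kmax : ℕ} (hW : L + 1 < W) (hk : kmax < 2 ^ W) {γ : QueryState}
    (hγ : QueryState.Good L W X kmax γ) (i : ℕ) : γ.code i < 2 ^ W := by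
  have h1 : 1 < 2 ^ W := Nat.one_lt_two_pow (by omega)
  have h0 : 0 < 2 ^ W := Nat.two_pow_pos W
  rcases γ with q | ⟨p, k, x⟩
  · obtain ⟨h2, h3, h4⟩ := hγ
    refine getD_lt h0 ?_ i
    simp only [List.mem_cons, List.not_mem_nil, or_false]
    rintro v (rfl | rfl | rfl | rfl) <;> assumption
  · obtain ⟨⟨⟨h2, h3, h4⟩, h5, h6, h7⟩, h8, h9⟩ := hγ
    have h10 : k < 2 ^ W := by omega
    rw [QueryState.code]
    split_ifs
    · refine getD_lt h0 ?_ i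
      simp only [List.mem_cons, List.not_mem_nil, or_false]
      rintro v (rfl | rfl | rfl | rfl | rfl | rfl | rfl | rfl) <;> assumption
    · exact Inner.code_lt hW h9 _

theorem QueryState.code_injOn {L W X kmax : ℕ} {γ γ' : QueryState}
    (hγ : QueryState.Good L W X kmax γ) (hγ' : QueryState.Good L W X kmax γ')
    (h : ∀ i < X + 16, γ.code i = γ'.code i) : γ = γ' := by
  have c0 := h 0 (by omega)
  have c1 := h 1 (by omega)
  have c2 := h 2 (by omega)
  have c3 := h 3 (by omega)
  rcases γ with q | ⟨p, k, x⟩ <;> rcases γ' with q' | ⟨p', k', x'⟩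
  · simp only [QueryState.code, List.getD_cons_succ, List.getD_cons_zero] at c1 c2 c3
    rw [QueryArgs.ext c1 c2 c3]
  · simp [QueryState.code] at c0
  · simp [QueryState.code] at c0
  · have c4 := h 4 (by omega)
    have c5 := h 5 (by omega)
    have c6 := h 6 (by omega)
    have c7 := h 7 (by omega)
    simp only [QueryState.code, List.getD_cons_succ, List.getD_cons_zero, if_pos (show 1 < 8 by omega),
      if_pos (show 2 < 8 by omega), if_pos (show 3 < 8 by omega), if_pos (show 4 < 8 by omega),
      if_pos (show 5 < 8 by omega), if_pos (show 6 < 8 by omega), if_pos (show 7 < 8 by omega)]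
      at c1 c2 c3 c4 c5 c6 c7
    have hx : x = x' := Inner.code_injOn hγ.2.2 hγ'.2.2 fun i hi => by
      have := h (i + 8) (by omega)
      simpa [QueryState.code] using this
    rw [QueryPar.ext c1 c2 c3 c4 c5 c6, c7, hx]

/-- A control state in memory. -/
def QueryState.enc (W X : ℕ) (γ : QueryState) : Fin (X + 16) → Fin (2 ^ W) :=
  fun i => ⟨γ.code i % 2 ^ W, Nat.mod_lt _ (Nat.two_pow_pos W)⟩

theorem QueryState.injOn_enc {L W X kmax : ℕ} (hW : L + 1 < W) (hk : kmax < 2 ^ W) :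
    Set.InjOn (QueryState.enc W X) {γ | QueryState.Good L W X kmax γ} := by
  intro γ hγ γ' hγ' h
  refine QueryState.code_injOn hγ hγ' fun i hi => ?_
  have := congrArg Fin.val (congrFun h ⟨i, hi⟩)
  simpa only [QueryState.enc, Nat.mod_eq_of_lt (QueryState.code_lt hW hk hγ i),
    Nat.mod_eq_of_lt (QueryState.code_lt hW hk hγ' i)] using this

/-- A world and its mirror image. -/
def World.pair (w : World) (t : ℕ) : World := if t = 0 then w else w.mirror

namespace Params

variable (pr : Params)

/-- Read the seed and the values of the two boundaries. -/
noncomputable def queryStart (m : ℕ) (q : QueryArgs) : Tree pr.B QueryPar :=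
  (readNum pr.B pr.W 0).bind fun seed =>
    (readNum pr.B pr.W (pr.baseIdx m 0 q.il + 0)).bind fun s =>
      (readNum pr.B pr.W (pr.baseIdx m 0 q.ir + 0)).bind fun t => .ret ⟨q, seed, s, t⟩

variable {pr}

theorem cost_queryStart (hp : pr.Valid) (m : ℕ) (q : QueryArgs) (D : Disk pr.B) :
    (pr.queryStart m q).cost D ≤ 30 := by
  have h := fun i => cost_readNum D i hp.B_pos hp.W_le
  simp only [queryStart, Tree.cost_bind, Tree.cost_ret]
  have h1 := h 0
  have h2 := h (pr.baseIdx m 0 q.il + 0)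
  have h3 := h (pr.baseIdx m 0 q.ir + 0)
  omega

theorem run_queryStart (hp : pr.Valid) {m seed : ℕ} {w : World} (hb : ∀ i ≤ m, w.b i < 2 ^ pr.W)
    (hseed : seed < 2 ^ pr.W) {q : QueryArgs} (hl : q.il ≤ m) (hr : q.ir ≤ m) :
    (pr.queryStart m q).run (Disk.ofBits pr.B (pr.dataBits m w.pair seed)) =
      ⟨q, seed, w.b q.il, w.b q.ir⟩ := by
  have hF : 0 < pr.F := F_pos
  have h0 : (readNum pr.B pr.W 0).run (Disk.ofBits pr.B (pr.dataBits m w.pair seed)) = seed :=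
    run_readNum _ _ _ _ hseed fun t ht => by
      rw [table_bit hp.B_pos (by rw [tableSize]; omega) ht, entry, if_pos rfl]
  have hi : ∀ i ≤ m, (readNum pr.B pr.W (pr.baseIdx m 0 i + 0)).run
      (Disk.ofBits pr.B (pr.dataBits m w.pair seed)) = w.b i := fun i hi =>
    run_readNum _ _ _ _ (hb i hi) fun t ht => by
      rw [table_bit hp.B_pos (baseIdx_lt (by norm_num) hi hF) ht, entry_base hi, World.pair,
        if_pos rfl]
  simp only [queryStart, Tree.run_bind, Tree.run_ret, h0, hi _ hl, hi _ hr]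

/-- There is a machine that answers the queries on the data structure of every string. -/
theorem exists_query_algorithm (hp : pr.Valid) {n M m : ℕ} {Q : Type*} (args : Q → QueryArgs)
    (hash : ℕ → ℕ → ℕ) (hk : 6 * pr.L + 4 < 2 ^ pr.W)
    (hM : pr.W * (2 ^ (pr.E₀ + 1) + 16) + (pr.B * (38 * (pr.E₀ + 1) * 2 ^ pr.E₀) + 1) + pr.B ≤ M) :
    ∃ P : Algorithm Q n pr.B M, ∀ (q : Q) (w : World) (seed : ℕ), w.L = pr.L → w.m = m → w.Valid →
      (∀ i ≤ m, w.b i ≤ 2 ^ pr.L) → seed < 2 ^ pr.L → (∀ y, hash seed y < 2 ^ pr.L) →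
      (pr.dataBits m w.pair seed).length < 2 ^ pr.W → (args q).il ≤ m → (args q).ir ≤ m →
      (args q).Good pr.W → w.b (args q).ir < 2 ^ pr.L →
      ∃ out : Finset (Fin n),
        P.answer (31 + ((pr.queryTasks m (args q).il (args q).ir (args q).e (w.b (args q).il)
          (w.b (args q).ir)).map fun τ => taskCost pr.B τ.2).sum) (pr.dataBits m w.pair seed) q =
            some out ∧
        ∀ y, y ∈ out ↔ ∃ ρ, w.b (args q).il ≤ ρ ∧ ρ < w.b (args q).ir ∧
          Agree (pr.queryBits w (args q).e (w.b (args q).il) (w.b (args q).ir) ρ)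
            (hash seed y) (w.key ρ) := by
  classical
  have hLW := hp.L_lt
  have hE : 38 ≤ 38 * (pr.E₀ + 1) * 2 ^ pr.E₀ := by
    have := Nat.mul_le_mul (show 38 ≤ 38 * (pr.E₀ + 1) by omega) (Nat.one_le_two_pow (n := pr.E₀))
    omega
  have : Nonempty QueryState := ⟨.inl ⟨0, 0, 0⟩⟩
  obtain ⟨P, hP⟩ := exists_algorithm (n := n) (M := M)
    (taskBody (pr.queryStart m) (fun p : QueryPar => pr.queryTasks m p.il p.ir p.e p.s p.t)
      Inner.fresh fun p τ => pr.taskStep (fun y : Fin n => hash p.seed y) τ.2)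
    (QueryState.Good pr.L pr.W (2 ^ (pr.E₀ + 1)) (6 * pr.L + 4))
    (38 * (pr.E₀ + 1) * 2 ^ pr.E₀) (pr.W * (2 ^ (pr.E₀ + 1) + 16))
    (QueryState.enc pr.W (2 ^ (pr.E₀ + 1)))
    (QueryState.injOn_enc hLW hk) hp.B_pos (by simp [← pow_mul]) hM
    (fun q : Q => Sum.inl (args q))
  refine ⟨P, fun q w seed hL hm hw hb hseed hhash hlen hil hir hgood ht => ?_⟩
  set il := (args q).il
  set ir := (args q).ir
  set e := (args q).e
  have hpow : 2 ^ pr.L < 2 ^ pr.W := Nat.pow_lt_pow_right (by norm_num) (by omega)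
  have hrun := run_queryStart hp (q := args q) (fun i hi => (hb i hi).trans_lt hpow)
    (hseed.trans hpow) hil hir
  have hcost := cost_queryStart hp m (args q) (Disk.ofBits pr.B (pr.dataBits m w.pair seed))
  have hpairb : ∀ t < 2, ∀ i ≤ m, (w.pair t).b i ≤ 2 ^ pr.L := by
    intro t _ i hi
    rw [World.pair]
    split_ifs
    · exact hb i hi
    · rw [← hL]; exact Nat.sub_le _ _
  have hside := fun (t i : ℕ) (h1 : t < 2) (h2 : i ≤ m) =>
    sideData_dataBits hp.B_pos hpairb hlen (by omega) h1 h2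
  have hmb : w.mirror.b (m - ir) = 2 ^ pr.L - w.b ir := by
    rw [World.mirror, hL, hm]
    simp only
    rw [Nat.sub_sub_self hir]
  have htask : ∀ τ ∈ pr.queryTasks m il ir e (w.b il) (w.b ir), ∃ E : Finset (Fin n),
      TaskRun (pr.taskStep (fun y : Fin n => hash seed y) τ.2)
        (Inner.Good pr.L pr.W (2 ^ (pr.E₀ + 1))) (38 * (pr.E₀ + 1) * 2 ^ pr.E₀)
        (Disk.ofBits pr.B (pr.dataBits m w.pair seed)) .fresh E (taskCost pr.B τ.2) ∧
      ∀ y : Fin n, y ∈ E ↔ QueryHits w (w.b il) (w.b ir) (hash seed y) τ := by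
    intro τ hτ
    rw [queryTasks] at hτ
    split_ifs at hτ with hst
    swap
    · simp at hτ
    obtain ⟨h1, h2, -⟩ := midRank_spec hst.le ht
    rcases List.mem_append.1 hτ with h | h
    · clear hτ
      obtain ⟨τ, hτ, rfl⟩ := List.mem_map.1 h
      have hz : midRank pr.L (w.b il) (w.b ir) - w.b il ≠ 0 := by
        intro hz
        rw [sideTasks, if_pos hz] at hτ
        simp at hτ
      obtain ⟨h3, h4⟩ := midRank_left hst.le ht hz
      exact exists_taskRun (hash := fun y : Fin n => hash seed y) hp hL hw (hm ▸ hil) (by omega)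
        le_rfl le_rfl (hside 0 il (by norm_num) hil) (by rw [h3]; omega) h4 hτ
    · clear hτ
      obtain ⟨τ, hτ, rfl⟩ := List.mem_map.1 h
      have hz : w.b ir - midRank pr.L (w.b il) (w.b ir) ≠ 0 := by
        intro hz
        rw [sideTasks, if_pos hz] at hτ
        simp at hτ
      obtain ⟨h3, h4⟩ := midRank_right hst.le ht hz
      rw [← hmb] at h3 hτ
      have hside := hside 1 (m - ir) (by norm_num) (Nat.sub_le _ _)
      obtain ⟨E, h5, h6⟩ := exists_taskRun (hash := fun y : Fin n => hash seed y) (w := w.mirror)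
        (i := m - ir) (X := 2 ^ (pr.E₀ + 1)) (T₀ := 38 * (pr.E₀ + 1) * 2 ^ pr.E₀) hp hL hw.mirror
        (by show m - ir ≤ w.m; omega) (by omega) le_rfl le_rfl hside
        (by rw [h3, hmb]; omega) h4 hτ
      refine ⟨E, h5, fun y => ?_⟩
      rw [h6, QueryHits, if_pos rfl, hmb, hL]
  choose! out hout1 hout2 using htask
  have hPgood : QueryPar.Good pr.W ⟨args q, seed, w.b il, w.b ir⟩ :=
    ⟨hgood, hseed.trans hpow, (hb _ hil).trans_lt hpow, ht.trans hpow⟩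
  obtain ⟨E, hE, hsteps⟩ := steps_machine (n := n)
    (tasks := fun p : QueryPar => pr.queryTasks m p.il p.ir p.e p.s p.t)
    (step := fun p τ => pr.taskStep (fun y : Fin n => hash p.seed y) τ.2)
    (GoodQ := QueryArgs.Good pr.W) (fresh := Inner.fresh)
    (p := ⟨args q, seed, w.b il, w.b ir⟩) hPgood (GoodI := Inner.Good pr.L pr.W (2 ^ (pr.E₀ + 1)))
    trivial (kmax := 6 * pr.L + 4) (length_queryTasks_le hp.L_pos ht) out
    (fun τ => taskCost pr.B τ.2) hout1 hrun (hcost.trans (by omega))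
  refine ⟨E, hP q _ E _ _ hgood (hsteps.mono (Nat.add_le_add_right (Nat.add_le_add_right hcost 1) _)) (taskBody_end _ _), fun y => ?_⟩
  rw [hE, ← query_hits_iff (m := m) (il := il) (ir := ir) hL hw ht (hhash y)]
  exact exists_congr fun τ => and_congr_right fun hτ => hout2 τ hτ y

end Params

/-! ### The choice of the parameters -/

/-- The parameters for strings of length `n` over an alphabet of size `σ`. Only the largest
accuracy for which a node is processed depends on the memory, whose size is governed by `δ`. -/
noncomputable def queryParams (δ : ℝ) (n σ B : ℕ) : Params where
  L := Nat.log 2 n + 1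
  B := B
  E₀ := ⌊δ / 4 * lg (σ * lg n)⌋₊
  ν := Nat.clog 2 (2 * (σ + 2) * (Nat.log 2 n + 1) + 1)
  W := 4 * (Nat.log 2 n + 1)

/-- The accuracy for the error probability `ε`: with accuracy `2 L`, a query is exact. -/
noncomputable def queryAcc (L : ℕ) (ε : ℝ) : ℕ := min (⌈lg (1 / ε)⌉₊ + 1) (2 * L)

section Parameters

variable {δ : ℝ} {n σ B : ℕ}

theorem lg_mono {a b : ℝ} (ha : 0 < a) (h : a ≤ b) : lg a ≤ lg b :=
  Real.logb_le_logb_of_le (by norm_num) ha h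

theorem lg_mul {a b : ℝ} (ha : 0 < a) (hb : 0 < b) : lg (a * b) = lg a + lg b :=
  Real.logb_mul ha.ne' hb.ne'

theorem lg_two_pow (k : ℕ) : lg (2 ^ k) = k := by
  rw [lg, Real.logb_pow, Real.logb_self_eq_one (by norm_num), mul_one]

theorem two_rpow_lg {a : ℝ} (ha : 0 < a) : (2 : ℝ) ^ lg a = a :=
  Real.rpow_logb (by norm_num) (by norm_num) ha

theorem clog_le_lg {k : ℕ} (hk : 0 < k) : (Nat.clog 2 k : ℝ) ≤ lg k + 1 := by
  rcases Nat.lt_or_ge 1 k with h | h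
  · have h1 := Nat.pow_pred_clog_lt_self (b := 2) (by norm_num) h
    have h2 := Nat.clog_pos (b := 2) (by norm_num) h
    have h3 : (2 : ℝ) ^ (Nat.clog 2 k - 1) ≤ k := by exact_mod_cast h1.le
    have h4 := lg_mono (by positivity) h3
    rw [lg_two_pow, Nat.cast_sub h2] at h4
    push_cast at h4
    linarith
  · obtain rfl : k = 1 := by omega
    simp [lg]

theorem two_pow_le_of_le_lg (hn : 32 ≤ lg n) : 2 ^ 32 ≤ n := by
  have h0 : 0 < n := by
    rcases Nat.eq_zero_or_pos n with rfl | h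
    · simp [lg] at hn; norm_num at hn
    · exact h
  have h : (2 : ℝ) ^ (32 : ℝ) ≤ 2 ^ lg n := Real.rpow_le_rpow_of_exponent_le (by norm_num) hn
  rw [two_rpow_lg (by positivity)] at h
  have h' : (2 : ℝ) ^ (32 : ℕ) ≤ n := by
    rw [← Real.rpow_natCast]; exact_mod_cast h
  exact_mod_cast h'

theorem L_le_two_mul_lg (hn : 32 ≤ lg n) : ((Nat.log 2 n + 1 : ℕ) : ℝ) ≤ 2 * lg n := by
  have h := two_pow_le_of_le_lg hn
  have := le_lg_natCast n (by omega)
  push_cast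
  linarith

theorem five_le_lg_lg (hn : 32 ≤ lg n) : 5 ≤ lg (lg n) := by
  have h := lg_mono (a := 2 ^ 5) (by norm_num) (by norm_num; exact hn)
  rw [lg_two_pow] at h
  exact_mod_cast h

theorem lg_le_mul (hσ : 0 < σ) (hn : 32 ≤ lg n) : lg n ≤ σ * lg n :=
  le_mul_of_one_le_left (by linarith) (by exact_mod_cast hσ)

theorem two_pow_E₀_le (hδ : 0 < δ) (hσ : 0 < σ) (hn : 32 ≤ lg n) :
    (2 : ℝ) ^ (queryParams δ n σ B).E₀ ≤ (σ * lg n) ^ (δ / 4) := by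
  have hY := lg_le_mul hσ hn
  have h1 : 0 ≤ lg (σ * lg n) := by
    have := five_le_lg_lg hn
    have := lg_mono (by linarith) hY
    linarith
  have h2 : ((queryParams δ n σ B).E₀ : ℝ) ≤ δ / 4 * lg (σ * lg n) :=
    Nat.floor_le (mul_nonneg (by linarith) h1)
  rw [← Real.rpow_natCast]
  calc (2 : ℝ) ^ ((queryParams δ n σ B).E₀ : ℝ) ≤ 2 ^ (δ / 4 * lg (σ * lg n)) :=
        Real.rpow_le_rpow_of_exponent_le (by norm_num) h2
    _ = _ := by rw [mul_comm, Real.rpow_mul (by norm_num), two_rpow_lg (by linarith)]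

theorem ν_le (hδ : 0 < δ) (hσ : 0 < σ) (hn : 32 ≤ lg n) :
    (queryParams δ n σ B).ν ≤ ⌈8 / δ⌉₊ * ((queryParams δ n σ B).E₀ + 1) := by
  have hY := lg_le_mul hσ hn
  have h0 : 0 < lg n := by linarith
  have h1 : 5 ≤ lg (σ * lg n) := (five_le_lg_lg hn).trans (lg_mono h0 hY)
  have hσ' : (1 : ℝ) ≤ σ := by exact_mod_cast hσ
  have hL := L_le_two_mul_lg hn
  have h2 : ((2 * (σ + 2) * (Nat.log 2 n + 1) + 1 : ℕ) : ℝ) ≤ 2 ^ 4 * (σ * lg n) := by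
    push_cast at hL ⊢
    have h3 : 2 * ((σ : ℝ) + 2) * (Nat.log 2 n + 1) ≤ 2 * (3 * σ) * (2 * lg n) := by
      gcongr
      linarith
    nlinarith
  have h3 := (clog_le_lg (k := 2 * (σ + 2) * (Nat.log 2 n + 1) + 1) (by omega)).trans
    (add_le_add_left (lg_mono (by positivity) h2) 1)
  rw [lg_mul (by norm_num) (by linarith), lg_two_pow] at h3
  have h4 : δ / 4 * lg (σ * lg n) < (queryParams δ n σ B).E₀ + 1 := Nat.lt_floor_add_one _
  have h5 : 8 / δ ≤ ⌈8 / δ⌉₊ := Nat.le_ceil _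
  have h6 : ((queryParams δ n σ B).ν : ℝ) ≤ 2 * lg (σ * lg n) := by
    push_cast at h3
    have : ((queryParams δ n σ B).ν : ℝ) ≤ 4 + lg (σ * lg n) + 1 := by
      exact_mod_cast h3
    linarith
  have h7 : 2 * lg (σ * lg n) = 8 / δ * (δ / 4 * lg (σ * lg n)) := by field_simp; ring
  have : ((queryParams δ n σ B).ν : ℝ) ≤ (⌈8 / δ⌉₊ * ((queryParams δ n σ B).E₀ + 1) : ℕ) := by
    push_cast
    rw [h7] at h6
    refine h6.trans (mul_le_mul h5 h4.le ?_ (by positivity))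
    exact mul_nonneg (by linarith) (by linarith)
  exact_mod_cast this

theorem valid_queryParams (hn : 32 ≤ lg n) (hB : lg n ≤ B) : (queryParams δ n σ B).Valid := by
  have hL := L_le_two_mul_lg hn
  refine ⟨Nat.succ_pos _, ?_, ?_, ?_⟩
  · have : (0 : ℝ) < B := by linarith
    exact_mod_cast this
  · have : ((4 * (Nat.log 2 n + 1) : ℕ) : ℝ) ≤ ((8 * B : ℕ) : ℝ) := by
      push_cast at hL ⊢; linarith
    exact_mod_cast this
  · show Nat.log 2 n + 1 + 1 < 4 * (Nat.log 2 n + 1)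
    omega

theorem memory_le {M : ℕ} (hδ : 0 < δ) (hσ : 0 < σ) (hn : 32 ≤ lg n)
    (hn' : 184 ≤ lg n ^ (δ / 2)) (hB : lg n ≤ B) (hM : (B : ℝ) * ((σ : ℝ) * lg n) ^ δ ≤ M) :
    (queryParams δ n σ B).W * (2 ^ ((queryParams δ n σ B).E₀ + 1) + 16) +
      ((queryParams δ n σ B).B *
        (38 * ((queryParams δ n σ B).E₀ + 1) * 2 ^ (queryParams δ n σ B).E₀) + 1) +
      (queryParams δ n σ B).B ≤ M := by
  have hv := valid_queryParams (δ := δ) (σ := σ) hn hB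
  have hW := hv.W_le
  have hB0 := hv.B_pos
  have hE := two_pow_E₀_le (B := B) hδ hσ hn
  have hBB : (queryParams δ n σ B).B = B := rfl
  rw [hBB] at hW hB0 ⊢
  generalize (queryParams δ n σ B).E₀ = E at *
  generalize (queryParams δ n σ B).W = W at *
  have hY := lg_le_mul hσ hn
  have h0 : 0 < lg n := by linarith
  -- everything is at most `184 B 4 ^ E`
  have h1 : E + 1 ≤ 2 ^ E := Nat.lt_two_pow_self
  have h2 : W * (2 ^ (E + 1) + 16) + (B * (38 * (E + 1) * 2 ^ E) + 1) + B ≤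
      B * (184 * (2 ^ E * 2 ^ E)) := by
    have h3 : W * (2 ^ (E + 1) + 16) ≤ B * (144 * (2 ^ E * 2 ^ E)) := by
      calc W * (2 ^ (E + 1) + 16) ≤ 8 * B * (18 * (2 ^ E * 2 ^ E)) := by
            refine Nat.mul_le_mul hW ?_
            rw [pow_succ]
            nlinarith
        _ = _ := by ring
    have h4 : B * (38 * (E + 1) * 2 ^ E) ≤ B * (38 * (2 ^ E * 2 ^ E)) := by
      rw [mul_assoc 38]
      gcongr
    have h5 : B * 1 ≤ B * (2 ^ E * 2 ^ E) := Nat.mul_le_mul_left _ (by nlinarith)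
    nlinarith
  have h3 : ((B * (184 * (2 ^ E * 2 ^ E)) : ℕ) : ℝ) ≤ M := by
    push_cast
    refine le_trans ?_ hM
    have hY0 : 0 < (σ : ℝ) * lg n := by linarith
    have h4 : ((2 : ℝ) ^ E * 2 ^ E) ≤ (σ * lg n) ^ (δ / 2) := by
      calc (2 : ℝ) ^ E * 2 ^ E ≤ (σ * lg n) ^ (δ / 4) * (σ * lg n) ^ (δ / 4) := by gcongr
        _ = _ := by rw [← Real.rpow_add hY0]; congr 1; ring
    have h5 : 184 ≤ ((σ : ℝ) * lg n) ^ (δ / 2) :=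
      hn'.trans (Real.rpow_le_rpow h0.le hY (by linarith))
    have h6 : ((σ : ℝ) * lg n) ^ δ = (σ * lg n) ^ (δ / 2) * (σ * lg n) ^ (δ / 2) := by
      rw [← Real.rpow_add hY0]; congr 1; ring
    rw [h6]
    gcongr
  have h4 : B * (184 * (2 ^ E * 2 ^ E)) ≤ M := by exact_mod_cast h3
  exact h2.trans h4

theorem clog_L_le (hn : 32 ≤ lg n) : ((queryParams δ n σ B).Jm : ℝ) ≤ lg (lg n) + 2 := by
  have h0 : 0 < lg n := by linarith
  have h1 := clog_le_lg (k := Nat.log 2 n + 1) (by omega)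
  have h2 := lg_mono (by positivity) (L_le_two_mul_lg hn)
  rw [lg_mul (by norm_num) h0] at h2
  have h3 : lg 2 = 1 := by simpa using lg_two_pow 1
  show (Nat.clog 2 (Nat.log 2 n + 1) : ℝ) ≤ _
  linarith

theorem queryAcc_add_four_le {L : ℕ} {ε : ℝ} (hε : 0 < ε) (hε1 : ε < 1) :
    (queryAcc L ε : ℝ) + 4 ≤ 7 * max 1 (lg (1 / ε)) := by
  have h1 : (queryAcc L ε : ℝ) ≤ (⌈lg (1 / ε)⌉₊ + 1 : ℕ) := by
    exact_mod_cast min_le_left _ _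
  have h0 : 0 ≤ lg (1 / ε) := Real.logb_nonneg (by norm_num) (by rw [le_div_iff₀ hε]; linarith)
  have h2 := Nat.ceil_lt_add_one h0
  have h3 := le_max_left 1 (lg (1 / ε))
  have h4 := le_max_right 1 (lg (1 / ε))
  push_cast at h1
  linarith

theorem two_mul_half_pow_le {ε : ℝ} (hε : 0 < ε) :
    2 * (1 / 2 : ℝ) ^ (⌈lg (1 / ε)⌉₊ + 1) ≤ ε := by
  have h : (1 / ε : ℝ) ≤ 2 ^ ⌈lg (1 / ε)⌉₊ := by
    calc (1 / ε : ℝ) = 2 ^ lg (1 / ε) := (two_rpow_lg (by positivity)).symm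
      _ ≤ 2 ^ (⌈lg (1 / ε)⌉₊ : ℝ) :=
        Real.rpow_le_rpow_of_exponent_le (by norm_num) (Nat.le_ceil _)
      _ = _ := Real.rpow_natCast _ _
  calc 2 * (1 / 2 : ℝ) ^ (⌈lg (1 / ε)⌉₊ + 1) = 1 / 2 ^ ⌈lg (1 / ε)⌉₊ := by
        rw [pow_succ, one_div_pow]; ring
    _ ≤ 1 / (1 / ε) := by gcongr
    _ = ε := by simp

end Parameters

/-! ### The size of the data structure and the error probability -/

section Bounds

variable {δ : ℝ} {n B : ℕ} {A : Type*} [LinearOrder A] [Fintype A]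

theorem lt_two_pow_L (n : ℕ) : n < 2 ^ (Nat.log 2 n + 1) := Nat.lt_pow_succ_log_self (by norm_num) n

/-- The numbers in the table suffice for addresses. -/
theorem length_dataBits_lt {x : Fin n → A} {hash : ℕ → ℕ} {seed : ℕ} (hn : 32 ≤ lg n)
    (hA : Fintype.card A ≤ n) :
    ((queryParams δ n (Fintype.card A) B).dataBits (Fintype.card A + 1)
      (stringWorld (Nat.log 2 n + 1) x hash).pair seed).length <
        2 ^ (queryParams δ n (Fintype.card A) B).W := by
  set pr := queryParams δ n (Fintype.card A) B
  have hbig := two_pow_le_of_le_lg hn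
  have hN := lt_two_pow_L n
  have hLL : pr.L = Nat.log 2 n + 1 := rfl
  have hWW : pr.W = 4 * pr.L := rfl
  rw [← hLL] at hN ⊢
  have h1 := pr.length_dataBits_le (m := Fintype.card A + 1) (seed := seed)
    (ws := (stringWorld pr.L x hash).pair) (by intro t _; rw [World.pair]; split_ifs <;> rfl)
  have h2 : ∀ w : World, w.L = pr.L →
      ∑ r ∈ Finset.range (2 ^ pr.L), w.dep r ≤ 2 ^ pr.L * pr.L := by
    intro w hw
    refine (Finset.sum_le_card_nsmul _ _ pr.L fun r _ => ?_).trans (by simp)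
    rw [← hw]; exact Nat.sub_le _ _
  have h3 := h2 ((stringWorld pr.L x hash).pair 0) rfl
  have h4 := h2 ((stringWorld pr.L x hash).pair 1) rfl
  refine h1.trans_lt ?_
  have h5 : pr.L < 2 ^ pr.L := Nat.lt_two_pow_self
  have h6 : 0 < pr.L := Nat.succ_pos _
  rw [hWW, mul_comm 4 pr.L, pow_mul, Params.tableSize, Params.F]
  generalize ∑ r ∈ Finset.range (2 ^ pr.L), ((stringWorld pr.L x hash).pair 0).dep r = d₀ at *
  generalize ∑ r ∈ Finset.range (2 ^ pr.L), ((stringWorld pr.L x hash).pair 1).dep r = d₁ at *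
  generalize 2 ^ pr.L = N at *
  generalize pr.L = L at *
  generalize Fintype.card A = σ at *
  have h7 : L * 4 * (1 + 2 * (σ + 1 + 1) * (4 * L + 4)) ≤ N * 4 * (1 + 2 * (2 * N) * (8 * N)) :=
    Nat.mul_le_mul (by omega) (Nat.add_le_add_left (Nat.mul_le_mul (by omega) (by omega)) _)
  have h8 : N * L ≤ N * N := Nat.mul_le_mul_left _ h5.le
  have h9 : N * 4 * (1 + 2 * (2 * N) * (8 * N)) = 4 * N + 128 * N ^ 3 := by ring
  have h10 : N ≤ N ^ 3 := Nat.le_self_pow (by norm_num) N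
  have h11 : N * N ≤ N ^ 3 := by
    rw [← pow_two]; exact Nat.pow_le_pow_right (by omega) (by norm_num)
  have h12 : 1000 * N ^ 3 ≤ N ^ 4 := by
    rw [pow_succ N 3, mul_comm]; exact Nat.mul_le_mul_left _ (by omega)
  omega

theorem length_dataBits_le_spaceBound {x : Fin n → A} {hash : ℕ → ℕ} {seed : ℕ} (hn : 32 ≤ lg n)
    (hA : 0 < Fintype.card A) :
    (((queryParams δ n (Fintype.card A) B).dataBits (Fintype.card A + 1)
      (stringWorld (Nat.log 2 n + 1) x hash).pair seed).length : ℝ) ≤ 1728 * spaceBound x := by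
  set pr := queryParams δ n (Fintype.card A) B
  have hbig := two_pow_le_of_le_lg hn
  have hN := lt_two_pow_L n
  have hLL : pr.L = Nat.log 2 n + 1 := rfl
  have hWW : pr.W = 4 * pr.L := rfl
  have hN2 : 2 ^ pr.L ≤ 2 * n := by
    rw [hLL, pow_succ]; have := Nat.pow_log_le_self 2 (x := n) (by omega); omega
  have hL2 := L_le_two_mul_lg hn
  have hruns := sum_runs_le (n := n) (x := x) (by omega)
  rw [← hLL] at hN hL2 hruns ⊢
  set w := stringWorld pr.L x hash
  have h1 := pr.length_dataBits_le (m := Fintype.card A + 1) (seed := seed) (ws := w.pair)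
    (by intro t _; rw [World.pair]; split_ifs <;> rfl)
  have hmono : Monotone w.b := boundary_mono hN.le
  have hw0 : w.b 0 = 0 := boundary_zero (L := pr.L)
  have hwm : w.b w.m = 2 ^ w.L := boundary_of_gt (L := pr.L) (x := x) (Nat.lt_succ_self _)
  have h3 : ∑ r ∈ Finset.range (2 ^ pr.L), (w.pair 0).dep r ≤ _ := sum_dep_le w hmono hw0 hwm
  have h4 : ∑ r ∈ Finset.range (2 ^ pr.L), (w.pair 1).dep r ≤ _ := sum_dep_mirror_le w hmono hw0 hwm
  have h5 : ∀ d : ℕ, d ≤ ∑ i ∈ Finset.range w.m,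
      (w.b (i + 1) - w.b i) * (w.L - Nat.log 2 (w.b (i + 1) - w.b i) + 4) →
      (d : ℝ) ≤ n * entropyZero x + 18 * n := fun d hd =>
    le_trans (Nat.cast_le.2 hd) hruns
  have h6 := h5 _ h3
  have h7 := h5 _ h4
  generalize ∑ r ∈ Finset.range (2 ^ pr.L), (w.pair 0).dep r = d₀ at *
  generalize ∑ r ∈ Finset.range (2 ^ pr.L), (w.pair 1).dep r = d₁ at *
  have hσ : (1 : ℝ) ≤ Fintype.card A := by exact_mod_cast hA
  have hL1 : (1 : ℝ) ≤ pr.L := by exact_mod_cast Nat.succ_pos _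
  have h8 : ((pr.W * pr.tableSize (Fintype.card A + 1) : ℕ) : ℝ) ≤
      784 * (Fintype.card A * lg n ^ 2) := by
    rw [hWW, Params.tableSize, Params.F]
    push_cast
    calc 4 * (pr.L : ℝ) * (1 + 2 * ((Fintype.card A : ℝ) + 1 + 1) * (4 * pr.L + 4))
        ≤ 4 * (pr.L : ℝ) * (Fintype.card A * pr.L +
            2 * (3 * Fintype.card A) * (8 * pr.L)) := by
          gcongr
          · nlinarith
          · linarith
          · linarith
      _ = 196 * (Fintype.card A * (pr.L : ℝ) ^ 2) := by ring
      _ ≤ 196 * (Fintype.card A * (2 * lg n) ^ 2) := by gcongr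
      _ = _ := by ring
  have h9 : ((2 ^ pr.L : ℕ) : ℝ) ≤ 2 * n := by exact_mod_cast hN2
  have h10 : 0 ≤ (n : ℝ) * entropyZero x := by
    refine mul_nonneg (by positivity) (Finset.sum_nonneg fun a _ => ?_)
    rcases Nat.eq_zero_or_pos (occ x a) with h | h
    · simp [h]
    · have hocc : (occ x a : ℝ) ≤ n := by
        exact_mod_cast (Finset.card_filter_le _ _).trans (by simp)
      have : (0 : ℝ) < occ x a := by exact_mod_cast h
      exact mul_nonneg (by positivity) (Real.logb_nonneg (by norm_num) ((one_le_div this).2 hocc))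
  have h11 : 0 ≤ (Fintype.card A : ℝ) * lg n ^ 2 := by positivity
  have h12 : (((pr.dataBits (Fintype.card A + 1) w.pair seed).length : ℕ) : ℝ) ≤ _ :=
    Nat.cast_le.2 h1
  refine h12.trans ?_
  rw [spaceBound]
  push_cast at h8 h9 ⊢
  linarith

/-- The union bound for a uniformly random seed. -/
theorem toOuterMeasure_map_uniform_le {S β : Type*} [Fintype S] [Nonempty S] (f : S → β)
    (U : Set β) (I : Finset ℕ) (R : ℕ → S → Prop) (wt : ℕ → ℝ)
    (h : ∀ a, f a ∈ U → ∃ ρ ∈ I, R ρ a)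
    (hwt : ∀ ρ ∈ I, (Nat.card {a : S // R ρ a} : ℝ) ≤ wt ρ * Fintype.card S) :
    ((PMF.uniformOfFintype S).map f).toOuterMeasure U ≤ ENNReal.ofReal (∑ ρ ∈ I, wt ρ) := by
  classical
  have hS : (0 : ℝ) < Fintype.card S := by exact_mod_cast Fintype.card_pos
  rw [PMF.toOuterMeasure_map_apply, PMF.toOuterMeasure_uniformOfFintype_apply]
  refine ENNReal.div_le_of_le_mul ?_
  have h1 : Fintype.card (f ⁻¹' U) ≤ ∑ ρ ∈ I, Nat.card {a : S // R ρ a} := by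
    have e : ∀ ρ, Nat.card {a : S // R ρ a} = (Finset.univ.filter (R ρ)).card := fun ρ => by
      rw [Nat.card_eq_fintype_card, Fintype.card_subtype]
    simp only [e]
    rw [← Set.toFinset_card]
    refine (Finset.card_le_card fun a ha => ?_).trans Finset.card_biUnion_le
    obtain ⟨ρ, h2, h3⟩ := h a (by simpa using ha)
    exact Finset.mem_biUnion.2 ⟨ρ, h2, by simpa using h3⟩
  have h2 : (Fintype.card (f ⁻¹' U) : ℝ) ≤ (∑ ρ ∈ I, wt ρ) * Fintype.card S := by
    rw [Finset.sum_mul]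
    refine le_trans ?_ (Finset.sum_le_sum hwt)
    exact_mod_cast h1
  have h3 : 0 ≤ ∑ ρ ∈ I, wt ρ := by
    by_contra! h4
    have : (0 : ℝ) ≤ Fintype.card (f ⁻¹' U) := by positivity
    nlinarith
  rw [← ENNReal.ofReal_natCast, ← ENNReal.ofReal_natCast (Fintype.card S),
    ← ENNReal.ofReal_mul h3]
  exact ENNReal.ofReal_le_ofReal h2

end Bounds

end SecondaryIndex

open SecondaryIndex
theorem theorem3 (δ : ℝ) (hδ : 0 < δ) :
    ∃ C : ℝ, 0 < C ∧ ∃ n₀ : ℕ,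
      ∀ (A : Type*) [Fintype A] [LinearOrder A] (n B M : ℕ),
        n₀ ≤ n →
        Fintype.card A ≤ n →
        lg n ≤ B →
        (B : ℝ) * ((Fintype.card A : ℝ) * lg n) ^ δ ≤ M →
        ∃ (P : Algorithm (ApproxQuery A) n B M) (store : (Fin n → A) → PMF (List Bool)),
          ∀ x : Fin n → A,
            (∀ bits ∈ (store x).support, (bits.length : ℝ) ≤ C * spaceBound x) ∧
            ∀ (l r : A) (ε : ℝ), 0 < ε → ε < 1 →
              ∃ T : ℕ,
                (T : ℝ) ≤ C * queryBound n B (rangeAnswer x l r).card ε ∧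
                (∀ bits ∈ (store x).support, ∃ out : Finset (Fin n),
                  P.answer T bits ⟨l, r, ε⟩ = some out ∧ rangeAnswer x l r ⊆ out) ∧
                ∀ i ∉ rangeAnswer x l r,
                  (store x).toOuterMeasure
                    {bits | ∃ out : Finset (Fin n),
                      P.answer T bits ⟨l, r, ε⟩ = some out ∧ i ∈ out} ≤ ENNReal.ofReal ε := by
  set κ : ℕ := ⌈8 / δ⌉₊ with hκ
  have hlg : Filter.Tendsto (fun n : ℕ => lg n) Filter.atTop Filter.atTop :=
    (Real.tendsto_logb_atTop (by norm_num)).comp tendsto_natCast_atTop_atTop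
  obtain ⟨n₀, hn₀⟩ := Filter.eventually_atTop.1 ((hlg.eventually_ge_atTop 32).and
    (((tendsto_rpow_atTop (half_pos hδ)).comp hlg).eventually_ge_atTop 184))
  refine ⟨7 * (48 * κ + 172) + 1728, by positivity, n₀, ?_⟩
  intro A _ _ n B M hnn hA hB hM
  obtain ⟨hn, hn'⟩ := hn₀ n hnn
  have hbig := two_pow_le_of_le_lg hn
  rcases Nat.eq_zero_or_pos (Fintype.card A) with hσ | hσ
  -- over the empty alphabet there is no string of positive length
  · have := Fintype.card_eq_zero_iff.1 hσ
    exact ⟨⟨fun _ _ => false, fun mem => ⟨mem, ∅, .halt⟩⟩, fun _ => PMF.pure [],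
      fun x => (this.false (x ⟨0, by omega⟩)).elim⟩
  set L := Nat.log 2 n + 1 with hL
  set σ := Fintype.card A with hσA
  set pr := queryParams δ n σ B with hpr
  have hprL : pr.L = L := rfl
  have hnL : n < 2 ^ L := lt_two_pow_L n
  have hv : pr.Valid := valid_queryParams hn hB
  obtain ⟨S, _, _, num, hash, hnum, hhash, hinj, hcoll⟩ := exists_hash (L := L) (Nat.succ_pos _)
  have hLW : 2 ^ L * 2 ^ L ≤ 2 ^ pr.W := by
    rw [← pow_add]
    exact Nat.pow_le_pow_right (by norm_num) (show L + L ≤ 4 * L by omega)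
  have hLN : L < 2 ^ L := Nat.lt_two_pow_self
  have hbigW : 6 * L + 4 < 2 ^ pr.W := by nlinarith
  obtain ⟨P, hP⟩ := Params.exists_query_algorithm (n := n) (m := σ + 1) hv
    (fun q : ApproxQuery A => ⟨alphaIdx q.left, alphaIdx q.right + 1, queryAcc L q.eps⟩) hash
    hbigW (memory_le hδ hσ hn hn' hB hM)
  refine ⟨P, fun x => (PMF.uniformOfFintype S).map fun a =>
    pr.dataBits (σ + 1) (stringWorld L x (hash (num a))).pair (num a), fun x => ⟨?_, ?_⟩⟩
  · intro bits hbits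
    rw [PMF.support_map] at hbits
    obtain ⟨a, -, rfl⟩ := hbits
    refine (length_dataBits_le_spaceBound hn hσ).trans ?_
    have h0 : 0 ≤ spaceBound x := by
      have := length_dataBits_le_spaceBound (δ := δ) (B := B) (x := x) (hash := id) (seed := 0) hn hσ
      have h1 := (Nat.cast_nonneg (α := ℝ) _).trans this
      linarith
    have : (0 : ℝ) ≤ 7 * (48 * κ + 172) := by positivity
    nlinarith
  intro l r ε hε hε1
  set s := boundary L x (alphaIdx l) with hs
  set t := boundary L x (alphaIdx r + 1) with ht
  have htn : t ≤ n := boundary_le_n (alphaIdx_lt r)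
  set e := queryAcc L ε with he
  have he2 : e ≤ 2 * pr.L := min_le_right _ _
  set bits₀ := fun ρ => pr.queryBits (stringWorld L x id) e s t ρ with hbits₀
  set tasks := pr.queryTasks (σ + 1) (alphaIdx l) (alphaIdx r + 1) e s t with htasks
  have hQ : ∀ a : S, ∃ out : Finset (Fin n),
      P.answer (31 + (tasks.map fun τ => Params.taskCost pr.B τ.2).sum)
        (pr.dataBits (σ + 1) (stringWorld L x (hash (num a))).pair (num a)) ⟨l, r, ε⟩ = some out ∧
      ∀ y : Fin n, y ∈ out ↔ ∃ ρ, s ≤ ρ ∧ ρ < t ∧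
        Agree (bits₀ ρ) (hash (num a) y) (hash (num a) (sortPos x ρ)) := by
    intro a
    have hl := alphaIdx_lt l
    have hr := alphaIdx_lt r
    refine hP ⟨l, r, ε⟩ (stringWorld L x (hash (num a))) (num a) rfl rfl
      (valid_stringWorld hnL.le (hhash _) (hinj a)) (fun i _ => boundary_le hnL.le i) (hnum a)
      (hhash _) (length_dataBits_lt hn hA) (by simp only; omega) (by simp only; omega)
      ⟨?_, ?_, ?_⟩ (htn.trans_lt hnL)
    · simp only; nlinarith
    · simp only; nlinarith
    · show e < _
      omega
  choose out hout1 hout2 using hQ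
  refine ⟨31 + (tasks.map fun τ => Params.taskCost pr.B τ.2).sum, ?_, ?_, ?_⟩
  · have h1 := Params.query_cost_le (m := σ + 1) (il := alphaIdx l) (ir := alphaIdx r + 1) (s := s)
      hv (ν_le hδ hσ hn) he2 (htn.trans_lt hnL)
    rw [← htasks, ← card_rangeAnswer] at h1
    rw [queryBound]
    generalize (tasks.map fun τ => Params.taskCost pr.B τ.2).sum = c at *
    generalize (rangeAnswer x l r).card = z at *
    have hB0 : (0 : ℝ) < B := by linarith
    have h2 : (c : ℝ) * B ≤ (48 * κ + 172) * (e + 4) * z + 400 * (pr.Jm + 1) * B := by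
      exact_mod_cast h1
    have h3 : (c : ℝ) ≤ (48 * κ + 172) * (e + 4) * z / B + 400 * (pr.Jm + 1) := by
      rw [← sub_le_iff_le_add, le_div_iff₀ hB0]
      linarith
    have h4 : (pr.Jm : ℝ) ≤ lg (lg n) + 2 := clog_L_le hn
    have h5 := five_le_lg_lg hn
    have h6 : (e : ℝ) + 4 ≤ 7 * max 1 (lg (1 / ε)) := queryAcc_add_four_le hε hε1
    have h7 : (48 * κ + 172) * ((e : ℝ) + 4) * z / B ≤
        7 * (48 * κ + 172) * (z * max 1 (lg (1 / ε)) / B) := by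
      calc (48 * κ + 172) * ((e : ℝ) + 4) * z / B ≤
            (48 * κ + 172) * (7 * max 1 (lg (1 / ε))) * z / B := by gcongr
        _ = _ := by ring
    have h8 : 0 ≤ Real.logb (wordsPerBlock n B) n :=
      Real.logb_nonneg (lt_of_lt_of_le (by norm_num) (le_max_left _ _))
        (by exact_mod_cast (show 1 ≤ n by omega))
    have h9 : 0 ≤ (z : ℝ) * max 1 (lg (1 / ε)) / B := by positivity
    have h10 : (0 : ℝ) ≤ 7 * (48 * κ + 172) := by positivity
    push_cast
    nlinarith [mul_nonneg h10 h8, mul_nonneg h10 (by linarith : 0 ≤ lg (lg n))]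
  · intro bits hbits
    rw [PMF.support_map] at hbits
    obtain ⟨a, -, rfl⟩ := hbits
    refine ⟨out a, hout1 a, fun i hi => ?_⟩
    obtain ⟨ρ, h1, h2, h3⟩ := (mem_rangeAnswer_iff (L := L) l r i).1 hi
    exact (hout2 a i).2 ⟨ρ, h1, h2, fun _ _ => by rw [h3]⟩
  · intro i hi
    refine (toOuterMeasure_map_uniform_le _ _ (Finset.Ico s t) (fun ρ a =>
      Agree (bits₀ ρ) (hash (num a) i) (hash (num a) (sortPos x ρ)))
      (fun ρ => Params.weight L (bits₀ ρ)) ?_ ?_).trans (ENNReal.ofReal_le_ofReal ?_)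
    · rintro a ⟨out', h1, h2⟩
      obtain rfl : out a = out' := Option.some.inj ((hout1 a).symm.trans h1)
      obtain ⟨ρ, h3, h4, h5⟩ := (hout2 a i).1 h2
      exact ⟨ρ, Finset.mem_Ico.2 ⟨h3, h4⟩, h5⟩
    · intro ρ hρ
      obtain ⟨h1, h2⟩ := Finset.mem_Ico.1 hρ
      refine hcoll _ Params.queryBits_subset _ (i.2.trans hnL) _
        ((sortPos_lt (by omega)).trans hnL) fun h => hi ?_
      exact (mem_rangeAnswer_iff (L := L) l r i).2 ⟨ρ, h1, h2, h.symm⟩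
    · rcases Nat.lt_or_ge t s with hst | hst
      · rw [Finset.Ico_eq_empty_of_le hst.le]
        simpa using hε.le
      have hwL : (stringWorld L x id).L = pr.L := rfl
      rcases min_choice (⌈lg (1 / ε)⌉₊ + 1) (2 * L) with h | h
      · have hν : 2 * ((stringWorld L x id).m + 1) * pr.L + 1 ≤ 2 ^ pr.ν :=
          Nat.le_pow_clog (by norm_num) _
        refine (Params.sum_weight_query_le hwL hst (htn.trans_lt hnL) hν).trans ?_
        rw [he, queryAcc, h]
        exact two_mul_half_pow_le hε
      · have hz : ∀ ρ ∈ Finset.Ico s t, Params.weight L (bits₀ ρ) = 0 := fun ρ _ => by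
          rw [Params.weight, if_pos]
          exact Params.card_queryBits hwL (Nat.succ_pos _) hst (htn.trans_lt hnL)
            (by rw [he, queryAcc, h, hprL]; omega)
        rw [Finset.sum_eq_zero hz]
        exact hε.le
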